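/- **Model.** Fix $\sigma>0$, $\rho>0$. For $d,h\in\mathbb N$, draw an anchor $x_0\sim\mathcal N(0,I_d)$ and, given $x_0$, two independent views $x,x'\sim\mathcal N(x_0,\sigma^2I_d)$; $\mathbb E$ denotes the expectation over $(x_0,x,x')$ only. For $\Phi\in\mathbb R^{h\times d}$ and $W\in\mathbb R^{h\times h}$ put $\Psi=W\Phi$, $z'=\Phi x'/\|\Phi x'\|_2$, $\omega=\Psi x/\|\Psi x\|_2$ and $$H(\Phi,W)=\mathbb E\big[z'\omega^\top-(\omega^\top z')\,\omega\omega^\top\big].$$ The training objective is the cosine loss with stop-gradient on the target branch and weight decay, $$\mathbb E\Big[-\frac{\langle W\Phi x,\mathrm{SG}(\Phi x')\rangle}{\|W\Phi x\|_2\,\|\mathrm{SG}(\Phi x')\|_2}\Big]+\frac\rho2\big(\|\Phi\|_F^2+\|W\|_F^2\big).$$ **Assumptions.** Let $d=d_n\to\infty$ and $h=h_n\to\infty$ with $d/h\to\alpha\in(0,\infty)$, and fix a time $t\ge0$. Let $(\Phi(s),W(s))$ be random paths (depending on $n$) such that: 1. (Gaussian initialization) $\sqrt d\,\Phi(0)_{ij}\sim\mathcal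 N(0,1)$ for all $i,j$, $\sqrt h\,W(0)_{ij}\sim\mathcal N(0,1)$ for all $i,j$, $W(0)$ is symmetric, and the entries $\Phi(0)_{ij}$ (all $i,j$) and $W(0)_{ij}$ ($i\le j$) are jointly independent. 2. (Training with symmetric $W$) With probability tending to $1$, on $[0,t]$ the matrix $W(s)$ is symmetric and $(\Phi(s),W(s))$ solves the gradient flow of the objective with $W$ ranging over the symmetric matrices, that is, $\dot\Phi=-\nabla_\Phi$ and $\dot W=-\tfrac12(\nabla_W+\nabla_W^\top)$ (the objective being differentiable in $\Phi$ and in $W$ along the path). A solution of the unconstrained gradient flow $\dot\Phi=-\nabla_\Phi$, $\dot W=-\nabla_W$ along which $W$ stays symmetric is a special case. 3. (Norms bounded away from zero) $\|\Phi(t)\|_F$ and $\|\Psi(t)\|_F$, $\Psi=W\Phi$, are bounded away from zero in probability: for every $\delta>0$ there is $c>0$ such that $\Pr(\|\Phi(t)\|_F<c)\le\delta$ and $\Pr(\|\Psi(t)\|_F<c)\le\delta$ for all large $n$. **Conclusion.** With $\Phi=\Phi(t)$, $W=W(t)$, $\tilde\Phi=\Phi/\|\Phi\|_F$ and $\tilde\Psi=\Psi/\|\Psi\|_F$,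 $$H(\Phi,W)=\frac{\tilde\Phi\tilde\Psi^\top-2\,\tilde\Psi\tilde\Phi^\top\tilde\Psi\tilde\Psi^\top-\mathrm{tr}(\tilde\Phi^\top\tilde\Psi)\,\tilde\Psi\tilde\Psi^\top}{1+\sigma^2}+o_{\mathbb P}(1),$$ where $o_{\mathbb P}(1)$ is an $h\times h$ random matrix whose nuclear norm (hence also its Frobenius norm, its spectral norm and its largest entry) tends to $0$ in probability. -/

import Mathlib

open MeasureTheory ProbabilityTheory Filter Topology
open scoped Matrix

-- Norms of matrices written `‖A‖` are Frobenius norms.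
attribute [local instance] Matrix.frobeniusNormedAddCommGroup Matrix.frobeniusNormedSpace

namespace SimSiam

noncomputable section

/-! ### Matrix norms and gradients -/

/-- The nuclear norm of a square matrix (the sum of its singular values), as the dual norm of the
spectral norm: the largest value of `tr (Mᵀ A)` over all `M` with `‖Mv‖₂ ≤ ‖v‖₂` for all `v`. -/
def nuclearNorm {h : ℕ} (A : Matrix (Fin h) (Fin h) ℝ) : ℝ :=
  sSup {r : ℝ | ∃ M : Matrix (Fin h) (Fin h) ℝ,
    ‖Matrix.toEuclideanCLM (n := Fin h) (𝕜 := ℝ) M‖ ≤ 1 ∧ r = (Mᵀ * A).trace}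

/-- The Frobenius inner product `B ↦ ∑ i j, A i j * B i j` with a fixed matrix `A`. -/
def frobeniusInner {m n : ℕ} (A : Matrix (Fin m) (Fin n) ℝ) : Matrix (Fin m) (Fin n) ℝ →L[ℝ] ℝ :=
  LinearMap.toContinuousLinearMap
    { toFun := fun B => ∑ i, ∑ j, A i j * B i j
      map_add' := fun B C => by simp [mul_add, Finset.sum_add_distrib]
      map_smul' := fun c B => by simp [Finset.mul_sum, mul_left_comm] }

/-- `f` is Fréchet differentiable at `A`, with gradient `G` for the Frobenius inner product. -/
def HasMatrixGradientAt {m n : ℕ} (f : Matrix (Fin m) (Fin n) ℝ → ℝ)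
    (G A : Matrix (Fin m) (Fin n) ℝ) : Prop :=
  HasFDerivAt f (frobeniusInner G) A

/-! ### Data, features and losses -/

/-- The product `A x`, as a vector of Euclidean space. -/
def apply {m n : ℕ} (A : Matrix (Fin m) (Fin n) ℝ) (x : EuclideanSpace ℝ (Fin n)) :
    EuclideanSpace ℝ (Fin m) :=
  WithLp.toLp 2 (A *ᵥ x.ofLp)

/-- `v / ‖v‖₂`. -/
def normalize {m : ℕ} (v : EuclideanSpace ℝ (Fin m)) : EuclideanSpace ℝ (Fin m) :=
  ‖v‖⁻¹ • v

/-- The law `𝒩(0, I)` of the anchor input. -/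
def inputLaw (d : ℕ) : Measure (EuclideanSpace ℝ (Fin d)) :=
  multivariateGaussian 0 1

/-- The augmentation law `𝒩(x₀, σ² I)`. -/
def augLaw {d : ℕ} (σ : ℝ) (x₀ : EuclideanSpace ℝ (Fin d)) : Measure (EuclideanSpace ℝ (Fin d)) :=
  multivariateGaussian x₀ (σ ^ 2 • 1)

/-- The expectation of `f x x'` over an anchor input `x₀` and two views `x`, `x'` that are
independent draws from the augmentation law given `x₀`. -/
def expectViews {d : ℕ} (σ : ℝ)
    (f : EuclideanSpace ℝ (Fin d) → EuclideanSpace ℝ (Fin d) → ℝ) : ℝ :=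
  ∫ x₀, ∫ x, ∫ x', f x x' ∂(augLaw σ x₀) ∂(augLaw σ x₀) ∂(inputLaw d)

/-- The cosine loss. The encoder `Φsg` of the target branch, which is under the stop-gradient
operator, is a separate argument, to be held fixed in differentiation. -/
def cosLoss {d h : ℕ} (σ : ℝ) (Φsg Φ : Matrix (Fin h) (Fin d) ℝ)
    (W : Matrix (Fin h) (Fin h) ℝ) : ℝ :=
  expectViews σ fun x x' =>
    -(inner ℝ (apply (W * Φ) x) (apply Φsg x') / (‖apply (W * Φ) x‖ * ‖apply Φsg x'‖))

/-- The cosine loss with weight decay `ρ/2 (‖Φ‖² + ‖W‖²)` (Frobenius norms). -/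
def objective {d h : ℕ} (σ ρ : ℝ) (Φsg Φ : Matrix (Fin h) (Fin d) ℝ)
    (W : Matrix (Fin h) (Fin h) ℝ) : ℝ :=
  cosLoss σ Φsg Φ W + ρ / 2 * (‖Φ‖ ^ 2 + ‖W‖ ^ 2)

/-! ### Initialization and training -/

/-- Gaussian initialization: `√d Φ₀ᵢⱼ ∼ 𝒩(0, 1)`, `√h W₀ᵢⱼ ∼ 𝒩(0, 1)`, the matrix `W₀` is
symmetric, and all entries of `Φ₀` and the entries of `W₀` on and above its diagonal are
independent. -/
structure IsGaussianInit {Ω : Type*} [MeasurableSpace Ω] (μ : Measure Ω) {d h : ℕ}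
    (Φ₀ : Ω → Matrix (Fin h) (Fin d) ℝ) (W₀ : Ω → Matrix (Fin h) (Fin h) ℝ) : Prop where
  law_Φ : ∀ i j, HasLaw (fun ω => √(d : ℝ) * Φ₀ ω i j) (gaussianReal 0 1) μ
  law_W : ∀ i j, HasLaw (fun ω => √(h : ℝ) * W₀ ω i j) (gaussianReal 0 1) μ
  symm_W : ∀ᵐ ω ∂μ, (W₀ ω).IsSymm
  indep : iIndepFun
    (fun (k : (Fin h × Fin d) ⊕ {p : Fin h × Fin h // p.1 ≤ p.2}) (ω : Ω) =>
      Sum.elim (fun p => Φ₀ ω p.1 p.2) (fun p => W₀ ω p.1.1 p.1.2) k) μ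

/-- `(Φ, W)` follows, on the time interval `[0, T]`, the gradient flow of the objective in which
`W` ranges over the space of symmetric matrices: `Φ' = -∇_Φ` and `W' = -∇_W`, the gradient in the
space of symmetric matrices being the symmetric part of the gradient in the space of all matrices.
If `(Φ, W)` follows the gradient flow in the space of all matrices and `W` stays symmetric, then
the gradient in `W` is symmetric along the flow, so that `(Φ, W)` satisfies this too. -/
structure IsSymmGradientFlow {d h : ℕ} (σ ρ T : ℝ) (Φ : ℝ → Matrix (Fin h) (Fin d) ℝ)
    (W : ℝ → Matrix (Fin h) (Fin h) ℝ) : Prop where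
  symm : ∀ s ∈ Set.Icc 0 T, (W s).IsSymm
  flow_Φ : ∀ s ∈ Set.Icc 0 T, ∃ G : Matrix (Fin h) (Fin d) ℝ,
    HasMatrixGradientAt (fun Θ => objective σ ρ (Φ s) Θ (W s)) G (Φ s) ∧
      HasDerivWithinAt Φ (-G) (Set.Icc 0 T) s
  flow_W : ∀ s ∈ Set.Icc 0 T, ∃ G : Matrix (Fin h) (Fin h) ℝ,
    HasMatrixGradientAt (fun V => objective σ ρ (Φ s) (Φ s) V) G (W s) ∧
      HasDerivWithinAt W (-((1 / 2 : ℝ) • (G + Gᵀ))) (Set.Icc 0 T) s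

/-! ### The matrix `H` and its closed form -/

/-- `H = 𝔼[z' ωᵀ - (ωᵀ z') ω ωᵀ]` with `z' = Φx' / ‖Φx'‖₂` and `ω = WΦx / ‖WΦx‖₂`. -/
def featureExpectation {d h : ℕ} (σ : ℝ) (Φ : Matrix (Fin h) (Fin d) ℝ)
    (W : Matrix (Fin h) (Fin h) ℝ) : Matrix (Fin h) (Fin h) ℝ :=
  Matrix.of fun i j => expectViews σ fun x x' =>
    let z' := normalize (apply Φ x')
    let w := normalize (apply (W * Φ) x)
    z' i * w j - inner ℝ w z' * (w i * w j)

/-- `A / ‖A‖` for the Frobenius norm. -/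
def frobeniusNormalize {m n : ℕ} (A : Matrix (Fin m) (Fin n) ℝ) : Matrix (Fin m) (Fin n) ℝ :=
  ‖A‖⁻¹ • A

/-- `(Φ̃ Ψ̃ᵀ - 2 Ψ̃ Φ̃ᵀ Ψ̃ Ψ̃ᵀ - tr(Φ̃ᵀ Ψ̃) Ψ̃ Ψ̃ᵀ) / (1 + σ²)`, where `Ψ = W Φ` and the tilde is
normalization by the Frobenius norm. -/
def closedForm {d h : ℕ} (σ : ℝ) (Φ : Matrix (Fin h) (Fin d) ℝ)
    (W : Matrix (Fin h) (Fin h) ℝ) : Matrix (Fin h) (Fin h) ℝ :=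
  let P := frobeniusNormalize Φ
  let Q := frobeniusNormalize (W * Φ)
  (1 + σ ^ 2)⁻¹ • (P * Qᵀ - (2 : ℝ) • (Q * Pᵀ * Q * Qᵀ) - (Pᵀ * Q).trace • (Q * Qᵀ))

end

end SimSiam

namespace SimSiam

/-! ### Frobenius and spectral norms -/

/-! The closed form is what `featureExpectation` becomes when random norms are replaced by their
typical values, and this replacement is legitimate as soon as `Φ` and `W * Φ` have small spectral
norm relative to their Frobenius norm.

Static half. Let `P`, `Q` be the Frobenius-normalized `Φ`, `W * Φ`. A Gaussian quadratic form with
matrix `B` has variance of order at most `‖B‖ ^ 2`, and `‖Qᵀ * Q‖ ≤ opNorm Q`. So `‖P x'‖²` and `‖Q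
x‖²` concentrate at `1 + σ²`, and `⟨Q x, P x'⟩` at `tr (Qᵀ P)`. After this only second moments
remain: they give `P Qᵀ - tr (Pᵀ Q) Q Qᵀ` over `1 + σ²`. The term `2 Q Pᵀ Q Qᵀ` of the closed form
has nuclear norm at most `2 * opNorm Q` and is itself negligible. All estimates are uniform over
test matrices `M` with `opNorm M ≤ 1`, which by duality controls the nuclear norm: see
`abs_integral_feature_sub_le` and `nuclearNorm_featureExpectation_sub_closedForm_le`.

Dynamic half. The cosine loss is Lipschitz in `Ψ = W * Φ` with constant of order `1 / ‖Ψ‖`, because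
the inverse second moment of `‖Ψ x‖` is finite (`lintegral_inv_norm_apply_sq_stdGaussian_le`). Its
gradients are therefore at most `3 * opNorm W / ‖Ψ‖` and `3 * opNorm Φ / ‖Ψ‖`. The factor `exp (ρ
s)` removes the weight decay, and the rescaled pair moves by at most `1` in Frobenius norm on `[0,
t]` (`IsSymmGradientFlow.displacement_le_one`).

At initialization the Frobenius norms of `Φ` and `W * Φ` are of order `√h`, while all spectral norms
are at most `q √h` for any fixed `q`, with probability tending to `1`
(`IsGaussianInit.measure_not_isWellScaled_le`). A displacement of `1` and a common exponential
factor do not spoil these ratios, so the error at time `t` is `O(q)`, and `q` is arbitrary. -/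

theorem frobenius_norm_sq {m n : Type*} [Fintype m] [Fintype n] (A : Matrix m n ℝ) :
    ‖A‖ ^ 2 = ∑ i, ∑ j, A i j ^ 2 := by
  rw [Matrix.frobenius_norm_def, ← Real.sqrt_eq_rpow, Real.sq_sqrt (by positivity)]
  simp

theorem trace_transpose_mul {m n : Type*} [Fintype m] [Fintype n] (A B : Matrix m n ℝ) :
    (Aᵀ * B).trace = ∑ i, ∑ j, A i j * B i j := by
  simp only [Matrix.trace, Matrix.diag_apply, Matrix.mul_apply, Matrix.transpose_apply]
  exact Finset.sum_comm

theorem trace_transpose_mul_self {m n : Type*} [Fintype m] [Fintype n] (A : Matrix m n ℝ) :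
    (Aᵀ * A).trace = ‖A‖ ^ 2 := by
  rw [trace_transpose_mul, frobenius_norm_sq]
  simp [sq]

theorem abs_trace_transpose_mul_le {m n : Type*} [Fintype m] [Fintype n] (A B : Matrix m n ℝ) :
    |(Aᵀ * B).trace| ≤ ‖A‖ * ‖B‖ := by
  rw [trace_transpose_mul]
  refine abs_le_of_sq_le_sq ?_ (by positivity)
  rw [mul_pow, frobenius_norm_sq, frobenius_norm_sq]
  simp_rw [← Fintype.sum_prod_type']
  exact Finset.sum_mul_sq_le_sq_mul_sq _ _ _

variable {m n l : ℕ}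

/-- The spectral norm of a matrix. -/
noncomputable def opNorm (A : Matrix (Fin m) (Fin n) ℝ) : ℝ :=
  ‖LinearMap.toContinuousLinearMap (Matrix.toEuclideanLin A)‖

theorem opNorm_nonneg (A : Matrix (Fin m) (Fin n) ℝ) : 0 ≤ opNorm A := norm_nonneg _

theorem norm_apply_le (A : Matrix (Fin m) (Fin n) ℝ) (x : EuclideanSpace ℝ (Fin n)) :
    ‖apply A x‖ ≤ opNorm A * ‖x‖ :=
  (LinearMap.toContinuousLinearMap (Matrix.toEuclideanLin A)).le_opNorm x

theorem opNorm_le_of_forall {A : Matrix (Fin m) (Fin n) ℝ} {c : ℝ} (hc : 0 ≤ c)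
    (hA : ∀ x, ‖apply A x‖ ≤ c * ‖x‖) : opNorm A ≤ c :=
  ContinuousLinearMap.opNorm_le_bound _ hc hA

theorem apply_mul (A : Matrix (Fin m) (Fin n) ℝ) (B : Matrix (Fin n) (Fin l) ℝ)
    (x : EuclideanSpace ℝ (Fin l)) : apply (A * B) x = apply A (apply B x) := by
  simp [apply, Matrix.mulVec_mulVec]

theorem apply_sub (A B : Matrix (Fin m) (Fin n) ℝ) (x : EuclideanSpace ℝ (Fin n)) :
    apply (A - B) x = apply A x - apply B x := by
  simp [apply, Matrix.sub_mulVec]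

theorem apply_smul (c : ℝ) (A : Matrix (Fin m) (Fin n) ℝ) (x : EuclideanSpace ℝ (Fin n)) :
    apply (c • A) x = c • apply A x := by
  simp [apply, Matrix.smul_mulVec]

theorem apply_smul_right (c : ℝ) (A : Matrix (Fin m) (Fin n) ℝ) (x : EuclideanSpace ℝ (Fin n)) :
    apply A (c • x) = c • apply A x := by
  simp [apply, Matrix.mulVec_smul]

theorem inner_apply_apply (A : Matrix (Fin m) (Fin n) ℝ) (B : Matrix (Fin m) (Fin l) ℝ)
    (x : EuclideanSpace ℝ (Fin n)) (y : EuclideanSpace ℝ (Fin l)) :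
    inner ℝ (apply A x) (apply B y) = x.ofLp ⬝ᵥ (Aᵀ * B) *ᵥ y.ofLp := by
  simp only [apply, EuclideanSpace.inner_eq_star_dotProduct, star_trivial]
  rw [← Matrix.mulVec_mulVec, dotProduct_comm, Matrix.dotProduct_mulVec x.ofLp,
    Matrix.vecMul_transpose]

theorem norm_apply_sq (A : Matrix (Fin m) (Fin n) ℝ) (x : EuclideanSpace ℝ (Fin n)) :
    ‖apply A x‖ ^ 2 = x.ofLp ⬝ᵥ (Aᵀ * A) *ᵥ x.ofLp := by
  rw [← inner_apply_apply, real_inner_self_eq_norm_sq]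

theorem inner_apply_left (A : Matrix (Fin m) (Fin n) ℝ) (x : EuclideanSpace ℝ (Fin n))
    (y : EuclideanSpace ℝ (Fin m)) : inner ℝ (apply A x) y = inner ℝ x (apply Aᵀ y) := by
  simp only [apply, EuclideanSpace.inner_eq_star_dotProduct, star_trivial]
  rw [Matrix.dotProduct_mulVec, Matrix.vecMul_eq_sum, Matrix.mulVec_transpose,
    ← Matrix.vecMul_eq_sum]

theorem frobenius_norm_sq_eq_sum_norm (A : Matrix (Fin m) (Fin n) ℝ) :
    ‖A‖ ^ 2 = ∑ j, ‖(WithLp.toLp 2 (fun i => A i j) : EuclideanSpace ℝ (Fin m))‖ ^ 2 := by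
  rw [frobenius_norm_sq, Finset.sum_comm]
  simp [EuclideanSpace.real_norm_sq_eq]

theorem opNorm_transpose_le (A : Matrix (Fin m) (Fin n) ℝ) : opNorm Aᵀ ≤ opNorm A := by
  refine opNorm_le_of_forall (opNorm_nonneg _) fun x => ?_
  have h1 : ‖apply Aᵀ x‖ * ‖apply Aᵀ x‖ ≤ opNorm A * ‖x‖ * ‖apply Aᵀ x‖ := by
    rw [← real_inner_self_eq_norm_mul_norm, inner_apply_left, Matrix.transpose_transpose]
    calc _ ≤ ‖x‖ * ‖apply A (apply Aᵀ x)‖ := real_inner_le_norm _ _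
      _ ≤ ‖x‖ * (opNorm A * ‖apply Aᵀ x‖) := by gcongr; exact norm_apply_le _ _
      _ = _ := by ring
  rcases (norm_nonneg (apply Aᵀ x)).eq_or_lt with h | h
  · rw [← h]
    exact mul_nonneg (opNorm_nonneg _) (norm_nonneg _)
  · exact le_of_mul_le_mul_right h1 h

theorem opNorm_transpose (A : Matrix (Fin m) (Fin n) ℝ) : opNorm Aᵀ = opNorm A :=
  le_antisymm (opNorm_transpose_le A) (by simpa using opNorm_transpose_le Aᵀ)

theorem frobenius_norm_mul_le_opNorm_mul (A : Matrix (Fin m) (Fin n) ℝ)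
    (B : Matrix (Fin n) (Fin l) ℝ) : ‖A * B‖ ≤ opNorm A * ‖B‖ := by
  refine le_of_sq_le_sq ?_ (mul_nonneg (opNorm_nonneg _) (norm_nonneg _))
  rw [mul_pow, frobenius_norm_sq_eq_sum_norm, frobenius_norm_sq_eq_sum_norm, Finset.mul_sum]
  refine Finset.sum_le_sum fun j _ => ?_
  rw [← mul_pow]
  gcongr
  exact norm_apply_le A (WithLp.toLp 2 fun i => B i j)

theorem frobenius_norm_mul_le_mul_opNorm (A : Matrix (Fin m) (Fin n) ℝ)
    (B : Matrix (Fin n) (Fin l) ℝ) : ‖A * B‖ ≤ ‖A‖ * opNorm B := by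
  have := frobenius_norm_mul_le_opNorm_mul Bᵀ Aᵀ
  rwa [← Matrix.transpose_mul, Matrix.frobenius_norm_transpose, Matrix.frobenius_norm_transpose,
    opNorm_transpose, mul_comm] at this

theorem opNorm_le_frobenius (A : Matrix (Fin m) (Fin n) ℝ) : opNorm A ≤ ‖A‖ := by
  refine opNorm_le_of_forall (norm_nonneg _) fun x => ?_
  have h := Matrix.frobenius_norm_mul A (Matrix.replicateCol Unit x.ofLp)
  rw [← Matrix.replicateCol_mulVec, Matrix.frobenius_norm_replicateCol,
    Matrix.frobenius_norm_replicateCol] at h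
  exact h

theorem opNorm_add_le (A B : Matrix (Fin m) (Fin n) ℝ) : opNorm (A + B) ≤ opNorm A + opNorm B := by
  simp only [opNorm, map_add]
  exact norm_add_le _ _

theorem opNorm_smul (c : ℝ) (A : Matrix (Fin m) (Fin n) ℝ) : opNorm (c • A) = |c| * opNorm A := by
  simp only [opNorm, map_smul]
  exact norm_smul _ _

/-- A crude substitute for sharp spectral bounds on random matrices. The right side is accessible
through second moments and is of order `√h` for the initial matrices, so `opNorm` is at most of
order `h ^ (1/4)`, which is small against `√h`. -/
theorem opNorm_sq_le (A : Matrix (Fin m) (Fin n) ℝ) : opNorm A ^ 2 ≤ ‖Aᵀ * A‖ := by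
  have : opNorm A ≤ √‖Aᵀ * A‖ := by
    refine opNorm_le_of_forall (Real.sqrt_nonneg _) fun x => ?_
    refine le_of_sq_le_sq ?_ (by positivity)
    rw [mul_pow, Real.sq_sqrt (norm_nonneg _), ← real_inner_self_eq_norm_sq, inner_apply_left,
      ← apply_mul]
    calc _ ≤ ‖x‖ * ‖apply (Aᵀ * A) x‖ := real_inner_le_norm _ _
      _ ≤ ‖x‖ * (‖Aᵀ * A‖ * ‖x‖) := by
        gcongr
        exact (norm_apply_le _ _).trans (by gcongr; exact opNorm_le_frobenius _)
      _ = _ := by ring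
  calc _ ≤ √‖Aᵀ * A‖ ^ 2 := by gcongr; exact opNorm_nonneg _
    _ = _ := Real.sq_sqrt (norm_nonneg _)

/-! ### Gaussian quadratic forms -/

section QuadraticForms

variable {ι : Type*} [Fintype ι]

/-- Combined with the rotation invariance of the standard Gaussian law, this turns any Gaussian
quadratic form into a weighted sum of independent squares. -/
theorem dotProduct_mulVec_sum_eigenvectorBasis [DecidableEq ι] {A : Matrix ι ι ℝ} (hA : A.IsHermitian)
    (y : ι → ℝ) :
    (∑ i, y i • hA.eigenvectorBasis i).ofLp ⬝ᵥ A *ᵥ (∑ i, y i • hA.eigenvectorBasis i).ofLp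
      = ∑ i, hA.eigenvalues i * y i ^ 2 := by
  have h1 : A *ᵥ (∑ i, y i • hA.eigenvectorBasis i).ofLp
      = (∑ i, (y i * hA.eigenvalues i) • hA.eigenvectorBasis i).ofLp := by
    simp only [WithLp.ofLp_sum, WithLp.ofLp_smul, Matrix.mulVec_sum, Matrix.mulVec_smul,
      hA.mulVec_eigenvectorBasis, smul_smul]
  rw [h1, dotProduct_comm]
  have h2 := (hA.eigenvectorBasis).orthonormal.inner_sum y (fun i => y i * hA.eigenvalues i)
    Finset.univ
  rw [EuclideanSpace.inner_eq_star_dotProduct] at h2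
  simp only [star_trivial] at h2
  rw [h2]
  exact Finset.sum_congr rfl fun i _ => by simp; ring

theorem sum_eigenvalues_sq [DecidableEq ι] {A : Matrix ι ι ℝ} (hA : A.IsHermitian) :
    ∑ i, hA.eigenvalues i ^ 2 = ‖A‖ ^ 2 := by
  have hA' : Aᵀ = A := by simpa using hA.eq
  rw [← trace_transpose_mul_self, hA', ← Matrix.trace_toLin_eq (A * A)
    (EuclideanSpace.basisFun ι ℝ).toBasis, LinearMap.trace_eq_sum_inner _ hA.eigenvectorBasis]
  refine Finset.sum_congr rfl fun i _ => ?_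
  have : Matrix.toLin (EuclideanSpace.basisFun ι ℝ).toBasis (EuclideanSpace.basisFun ι ℝ).toBasis
      (A * A) (hA.eigenvectorBasis i) = hA.eigenvalues i ^ 2 • hA.eigenvectorBasis i := by
    rw [← Matrix.toEuclideanLin_eq_toLin_orthonormal]
    apply (WithLp.equiv 2 _).injective
    change (A * A) *ᵥ (hA.eigenvectorBasis i).ofLp = _
    rw [← Matrix.mulVec_mulVec, hA.mulVec_eigenvectorBasis, Matrix.mulVec_smul,
      hA.mulVec_eigenvectorBasis, smul_smul, sq]
    rfl
  rw [this, inner_smul_right, real_inner_self_eq_norm_sq, hA.eigenvectorBasis.norm_eq_one]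
  simp

/-- The variance of the square of a standard Gaussian variable. -/
noncomputable def gaussianSqVariance : ℝ := Var[fun y : ℝ => y ^ 2; gaussianReal 0 1]

theorem gaussianSqVariance_nonneg : 0 ≤ gaussianSqVariance := variance_nonneg _ _

theorem memLp_sq_gaussianReal : MemLp (fun y : ℝ => y ^ 2) 2 (gaussianReal 0 1) := by
  have h := memLp_id_gaussianReal' (μ := 0) (v := 1) 4 (by simp)
  have := h.mul h (r := 2) (hpqr := ⟨by
    rw [← two_mul, show (4 : ENNReal) = 2 * 2 by norm_num, ENNReal.mul_inv (by simp) (by simp),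
      ← mul_assoc, ENNReal.mul_inv_cancel (by simp) (by simp), one_mul]⟩)
  refine this.congr_norm (by fun_prop) (.of_forall fun y => ?_)
  simp [sq]

theorem integral_sq_gaussianReal : ∫ y, y ^ 2 ∂(gaussianReal 0 1) = 1 := by
  have h := variance_fun_id_gaussianReal (μ := 0) (v := 1)
  rw [variance_of_integral_eq_zero (by fun_prop) (by simp)] at h
  simpa using h

theorem memLp_weighted_sum_sq_pi (c : ι → ℝ) :
    MemLp (fun y : ι → ℝ => ∑ i, c i * y i ^ 2) 2 (Measure.pi fun _ => gaussianReal 0 1) := by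
  refine memLp_finsetSum _ fun i _ => ?_
  exact (memLp_sq_gaussianReal.const_mul (c i)).comp_measurePreserving
    (measurePreserving_eval (fun _ : ι => gaussianReal 0 1) i)

theorem integral_weighted_sum_sq_pi (c : ι → ℝ) :
    ∫ y, ∑ i, c i * y i ^ 2 ∂(Measure.pi fun _ : ι => gaussianReal 0 1) = ∑ i, c i := by
  have hi (i : ι) := (memLp_sq_gaussianReal.const_mul (c i))
  rw [integral_finsetSum]
  · refine Finset.sum_congr rfl fun i _ => ?_
    have hmp := measurePreserving_eval (fun _ : ι => gaussianReal 0 1) i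
    have := integral_map hmp.aemeasurable (f := fun z : ℝ => c i * z ^ 2) (by fun_prop)
    rw [hmp.map_eq, integral_const_mul, integral_sq_gaussianReal, mul_one] at this
    exact this.symm
  · intro i _
    exact ((hi i).comp_measurePreserving
      (measurePreserving_eval (fun _ : ι => gaussianReal 0 1) i)).integrable (by norm_num)

theorem variance_weighted_sum_sq_pi (c : ι → ℝ) :
    Var[fun y : ι → ℝ => ∑ i, c i * y i ^ 2; Measure.pi fun _ => gaussianReal 0 1]
      = gaussianSqVariance * ∑ i, c i ^ 2 := by
  have := variance_sum_pi (μ := fun _ : ι => gaussianReal 0 1)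
    (X := fun i (z : ℝ) => c i * z ^ 2) (fun i => memLp_sq_gaussianReal.const_mul (c i))
  convert this using 1
  · congr 1
    ext y
    simp
  · rw [Finset.mul_sum]
    refine Finset.sum_congr rfl fun i _ => ?_
    rw [variance_const_mul, gaussianSqVariance]
    ring

theorem measurable_quadratic (B : Matrix ι ι ℝ) :
    Measurable fun x : EuclideanSpace ℝ ι => x.ofLp ⬝ᵥ B *ᵥ x.ofLp := by
  simp only [dotProduct, Matrix.mulVec]
  fun_prop

theorem measurePreserving_sum_smul (b : OrthonormalBasis ι ℝ (EuclideanSpace ℝ ι)) :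
    MeasurePreserving (fun y : ι → ℝ => ∑ i, y i • b i) (Measure.pi fun _ => gaussianReal 0 1)
      (stdGaussian (EuclideanSpace ℝ ι)) :=
  ⟨by fun_prop, (stdGaussian_eq_map_pi_orthonormalBasis b).symm⟩

/-- Passing to the symmetric part makes the spectral theorem available for arbitrary `B`, without
changing the trace or increasing the Frobenius norm. -/
theorem quadratic_symmetrize (B : Matrix ι ι ℝ) (x : ι → ℝ) :
    x ⬝ᵥ B *ᵥ x = x ⬝ᵥ ((1 / 2 : ℝ) • (B + Bᵀ)) *ᵥ x := by
  have : x ⬝ᵥ Bᵀ *ᵥ x = x ⬝ᵥ B *ᵥ x := by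
    rw [Matrix.mulVec_transpose, dotProduct_comm, ← Matrix.dotProduct_mulVec]
  rw [Matrix.smul_mulVec, Matrix.add_mulVec, dotProduct_smul, dotProduct_add, this, smul_eq_mul]
  ring

theorem isHermitian_symmetrize {κ : Type*} (B : Matrix κ κ ℝ) : ((1 / 2 : ℝ) • (B + Bᵀ)).IsHermitian := by
  ext i j
  simp only [Matrix.conjTranspose_apply, Matrix.smul_apply, Matrix.add_apply,
    Matrix.transpose_apply, star_trivial, add_comm]

theorem trace_symmetrize (B : Matrix ι ι ℝ) : ((1 / 2 : ℝ) • (B + Bᵀ)).trace = B.trace := by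
  rw [Matrix.trace_smul, Matrix.trace_add, Matrix.trace_transpose, smul_eq_mul]
  ring

theorem norm_symmetrize_le (B : Matrix ι ι ℝ) : ‖(1 / 2 : ℝ) • (B + Bᵀ)‖ ≤ ‖B‖ := by
  rw [norm_smul]
  have := norm_add_le B Bᵀ
  rw [Matrix.frobenius_norm_transpose] at this
  norm_num
  linarith

theorem memLp_quadratic_stdGaussian (B : Matrix ι ι ℝ) :
    MemLp (fun x : EuclideanSpace ℝ ι => x.ofLp ⬝ᵥ B *ᵥ x.ofLp) 2
      (stdGaussian (EuclideanSpace ℝ ι)) := by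
  classical
  simp_rw [quadratic_symmetrize B]
  have hA := isHermitian_symmetrize B
  have hmp := measurePreserving_sum_smul hA.eigenvectorBasis
  rw [← hmp.map_eq]
  rw [memLp_map_measure_iff (measurable_quadratic _).aestronglyMeasurable hmp.aemeasurable]
  simp only [Function.comp_def, dotProduct_mulVec_sum_eigenvectorBasis hA]
  exact memLp_weighted_sum_sq_pi _

theorem integral_quadratic_stdGaussian (B : Matrix ι ι ℝ) :
    ∫ x, x.ofLp ⬝ᵥ B *ᵥ x.ofLp ∂(stdGaussian (EuclideanSpace ℝ ι)) = B.trace := by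
  classical
  simp_rw [quadratic_symmetrize B]
  have hA := isHermitian_symmetrize B
  have hmp := measurePreserving_sum_smul hA.eigenvectorBasis
  rw [← hmp.map_eq]
  rw [integral_map hmp.aemeasurable (measurable_quadratic _).aestronglyMeasurable]
  simp only [dotProduct_mulVec_sum_eigenvectorBasis hA]
  rw [integral_weighted_sum_sq_pi, ← trace_symmetrize B, hA.trace_eq_sum_eigenvalues]
  simp

/-- In an eigenbasis of the symmetric part the variance is exactly `gaussianSqVariance` times the
sum of the squared eigenvalues. This is the source of every concentration estimate below. -/
theorem variance_quadratic_stdGaussian_le (B : Matrix ι ι ℝ) :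
    Var[fun x : EuclideanSpace ℝ ι => x.ofLp ⬝ᵥ B *ᵥ x.ofLp; stdGaussian (EuclideanSpace ℝ ι)]
      ≤ gaussianSqVariance * ‖B‖ ^ 2 := by
  classical
  simp_rw [quadratic_symmetrize B]
  have hA := isHermitian_symmetrize B
  have hmp := measurePreserving_sum_smul hA.eigenvectorBasis
  rw [← hmp.map_eq,
    variance_map (measurable_quadratic _).aemeasurable hmp.aemeasurable]
  simp only [Function.comp_def, dotProduct_mulVec_sum_eigenvectorBasis hA]
  rw [variance_weighted_sum_sq_pi, sum_eigenvalues_sq hA]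
  have := gaussianSqVariance_nonneg
  gcongr
  exact norm_symmetrize_le B

theorem integral_quadratic_sub_trace_sq_le (B : Matrix ι ι ℝ) :
    ∫ x, (x.ofLp ⬝ᵥ B *ᵥ x.ofLp - B.trace) ^ 2 ∂(stdGaussian (EuclideanSpace ℝ ι))
      ≤ gaussianSqVariance * ‖B‖ ^ 2 := by
  have := variance_quadratic_stdGaussian_le B
  rwa [variance_eq_integral (measurable_quadratic B).aemeasurable,
    integral_quadratic_stdGaussian] at this

end QuadraticForms

/-! ### The inverse second moment -/

theorem integral_exp_neg_mul_sq_gaussianReal {c : ℝ} (hc : 0 ≤ c) :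
    ∫ y, Real.exp (-(c * y ^ 2)) ∂(gaussianReal 0 1) = (1 + 2 * c) ^ (-(1 / 2) : ℝ) := by
    rw [integral_gaussianReal_eq_integral_smul (by norm_num)]
    have h : ∀ y : ℝ, gaussianPDFReal 0 1 y • Real.exp (-(c * y ^ 2))
        = (√(2 * Real.pi))⁻¹ * Real.exp (-(c + 1 / 2) * y ^ 2) := by
      intro y
      simp only [gaussianPDFReal, NNReal.coe_one, mul_one, sub_zero, smul_eq_mul]
      rw [mul_assoc, ← Real.exp_add]
      congr 2
      ring
    simp_rw [h]
    rw [integral_const_mul, integral_gaussian, Real.rpow_neg (by positivity),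
      ← Real.sqrt_eq_rpow, ← Real.sqrt_inv, ← Real.sqrt_inv, ← Real.sqrt_mul (by positivity)]
    congr 1
    have := Real.pi_pos
    field_simp
    ring

/-- In extended nonnegative reals the identity survives at `a = 0`, where both sides are infinite,
so no almost sure positivity is needed beforehand. -/
theorem inv_ofReal_eq_lintegral_exp {a : ℝ} (ha : 0 ≤ a) :
    (ENNReal.ofReal a)⁻¹ = ∫⁻ s in Set.Ioi (0 : ℝ), ENNReal.ofReal (Real.exp (-(s * a))) := by
  rcases ha.eq_or_lt with rfl | ha
  · simp
  · have h1 := integral_exp_mul_Ioi (a := -a) (by linarith) 0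
    rw [← ofReal_integral_eq_lintegral_ofReal]
    · rw [← ENNReal.ofReal_inv_of_pos ha]
      congr 1
      simp_rw [show ∀ s : ℝ, -(s * a) = -a * s by intro s; ring]
      rw [h1]
      simp
    · have := integrableOn_exp_mul_Ioi (a := -a) (by linarith) 0
      refine this.congr_fun (fun s _ => ?_) measurableSet_Ioi
      simp only
      congr 1
      ring
    · exact .of_forall fun y => (Real.exp_pos _).le

theorem lintegral_one_add_mul_rpow {L R : ℝ} (hL : 0 < L) (hR : 2 < R) :
    ∫⁻ s in Set.Ioi (0 : ℝ), ENNReal.ofReal ((1 + 2 * s * L) ^ (-(R / 2)))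
      = ENNReal.ofReal (1 / (L * R - 2 * L)) := by
  have hd : ∀ x ∈ Set.Ici (0 : ℝ), HasDerivAt
      (fun s => -(1 / (L * R - 2 * L)) * (1 + 2 * s * L) ^ (1 - R / 2))
      ((1 + 2 * x * L) ^ (-(R / 2))) x := by
    intro x hx
    have hx : 0 ≤ x := hx
    have h0 : 0 < 1 + 2 * x * L := by positivity
    have h1 : HasDerivAt (fun s : ℝ => 1 + 2 * s * L) (2 * L) x := by
      have := (((hasDerivAt_id x).const_mul 2).mul_const L).const_add 1
      simpa using this
    have h2 := (h1.rpow_const (p := 1 - R / 2) (Or.inl h0.ne')).const_mul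
      (-(1 / (L * R - 2 * L)))
    refine h2.congr_deriv ?_
    rw [show (1 - R / 2 - 1 : ℝ) = -(R / 2) by ring]
    have : R - 2 ≠ 0 := by linarith
    rw [show L * R - 2 * L = L * (R - 2) by ring]
    field_simp
    ring
  have hlim : Tendsto (fun s => -(1 / (L * R - 2 * L)) * (1 + 2 * s * L) ^ (1 - R / 2))
      atTop (𝓝 0) := by
    rw [show (0 : ℝ) = -(1 / (L * R - 2 * L)) * 0 by ring]
    refine Tendsto.const_mul _ ?_
    have h1 : Tendsto (fun s : ℝ => 1 + 2 * s * L) atTop atTop := by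
      refine tendsto_atTop_add_const_left _ _ ?_
      exact (tendsto_id.const_mul_atTop (by norm_num)).atTop_mul_const hL
    have h2 := (tendsto_rpow_neg_atTop (y := R / 2 - 1) (by linarith)).comp h1
    refine h2.congr fun s => ?_
    simp
  have hnn : ∀ x ∈ Set.Ioi (0 : ℝ), 0 ≤ (1 + 2 * x * L) ^ (-(R / 2)) := by
    intro x hx
    have hx : 0 < x := hx
    positivity
  have hcont : ContinuousWithinAt
      (fun s => -(1 / (L * R - 2 * L)) * (1 + 2 * s * L) ^ (1 - R / 2)) (Set.Ici 0) 0 :=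
    (hd 0 (by simp)).continuousAt.continuousWithinAt
  have hd' := fun x (hx : x ∈ Set.Ioi (0 : ℝ)) => hd x (Set.Ioi_subset_Ici_self hx)
  have hint := integrableOn_Ioi_deriv_of_nonneg hcont hd' hnn hlim
  rw [← ofReal_integral_eq_lintegral_ofReal hint
    ((ae_restrict_iff' measurableSet_Ioi).2 (.of_forall hnn)),
    integral_Ioi_of_hasDerivAt_of_nonneg hcont hd' hnn hlim]
  simp

/-- Bernoulli's inequality with exponent `l / L ≤ 1`. It compares the Laplace factor of an
eigenvalue `l` with a power of that of the largest one, so that in a product only the sum of the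
eigenvalues matters. -/
theorem one_add_mul_rpow_le {s l L : ℝ} (hs : 0 ≤ s) (hl : 0 ≤ l) (hL : 0 < L) (hlL : l ≤ L) :
    (1 + 2 * (s * l)) ^ (-(1 / 2) : ℝ) ≤ (1 + 2 * s * L) ^ (-(l / L / 2)) := by
  have h1 : (1 + 2 * s * L) ^ (l / L) ≤ 1 + l / L * (2 * s * L) :=
    rpow_one_add_le_one_add_mul_self (by nlinarith [mul_nonneg hs hL.le]) (by positivity)
      ((div_le_one hL).2 hlL)
  rw [show l / L * (2 * s * L) = 2 * (s * l) by field_simp] at h1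
  have h0 : 0 < 1 + 2 * s * L := by positivity
  rw [show -(l / L / 2) = l / L * (-(1 / 2)) by ring, Real.rpow_mul h0.le]
  exact Real.rpow_le_rpow_of_nonpos (by positivity) h1 (by norm_num)

theorem lintegral_exp_neg_sum_sq_pi_le {ι : Type*} [Fintype ι] {c : ι → ℝ} {s L : ℝ}
    (hs : 0 ≤ s) (hc : ∀ i, 0 ≤ c i) (hL : 0 < L) (hcL : ∀ i, c i ≤ L) :
    ∫⁻ y, ENNReal.ofReal (Real.exp (-(s * ∑ i, c i * y i ^ 2)))
        ∂(Measure.pi fun _ : ι => gaussianReal 0 1)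
      ≤ ENNReal.ofReal ((1 + 2 * s * L) ^ (-((∑ i, c i) / L / 2))) := by
  have h0 : 0 < 1 + 2 * s * L := by positivity
  have hsc : ∀ i, 0 ≤ s * c i := fun i => mul_nonneg hs (hc i)
  have h : ∀ y : ι → ℝ, Real.exp (-(s * ∑ i, c i * y i ^ 2))
      = ∏ i, Real.exp (-((s * c i) * y i ^ 2)) := by
    intro y
    rw [← Real.exp_sum, Finset.sum_neg_distrib, Finset.mul_sum]
    simp_rw [mul_assoc]
  rw [← ofReal_integral_eq_lintegral_ofReal]
  · refine ENNReal.ofReal_le_ofReal ?_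
    simp_rw [h]
    rw [integral_fintype_prod_eq_prod (μ := fun _ : ι => gaussianReal 0 1)
      (f := fun i (z : ℝ) => Real.exp (-((s * c i) * z ^ 2)))]
    simp_rw [fun i => integral_exp_neg_mul_sq_gaussianReal (hsc i)]
    rw [Finset.sum_div, Finset.sum_div, ← Finset.sum_neg_distrib, Real.rpow_sum_of_pos h0]
    refine Finset.prod_le_prod (fun i _ => ?_) fun i _ =>
      one_add_mul_rpow_le hs (hc i) hL (hcL i)
    have := hsc i
    positivity
  · refine Integrable.of_bound (Measurable.aestronglyMeasurable (by fun_prop)) 1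
      (.of_forall fun y => ?_)
    rw [Real.norm_eq_abs, abs_of_pos (Real.exp_pos _), Real.exp_le_one_iff, neg_nonpos]
    exact mul_nonneg hs (Finset.sum_nonneg fun i _ => mul_nonneg (hc i) (sq_nonneg _))
  · exact .of_forall fun y => (Real.exp_pos _).le

/-- Write `1 / ‖A x‖²` as an integral of `exp (-s ‖A x‖²)`. With `L = opNorm A ^ 2` and effective
rank `R = ‖A‖ ^ 2 / L`, the Laplace transform is at most `(1 + 2 s L) ^ (-R / 2)`, as if `R`
eigenvalues were equal to `L`. It is integrable for `R > 2`, with integral `1 / (L (R - 2))`, the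
inverse moment of a chi-square law. -/
theorem lintegral_inv_norm_apply_sq_stdGaussian_le {m n : ℕ} (A : Matrix (Fin m) (Fin n) ℝ)
    (hA : 2 * opNorm A ^ 2 < ‖A‖ ^ 2) :
    ∫⁻ x, (ENNReal.ofReal (‖apply A x‖ ^ 2))⁻¹ ∂(stdGaussian (EuclideanSpace ℝ (Fin n)))
      ≤ ENNReal.ofReal (1 / (‖A‖ ^ 2 - 2 * opNorm A ^ 2)) := by
  have hH : (Aᵀ * A).IsHermitian := by simpa using Matrix.isHermitian_conjTranspose_mul_self A
  set L := opNorm A ^ 2 with hLdef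
  have hmeas : Measurable fun x : EuclideanSpace ℝ (Fin n) => ‖apply A x‖ ^ 2 := by
    simp_rw [norm_apply_sq]
    exact measurable_quadratic _
  have hsum : ∑ i, hH.eigenvalues i = ‖A‖ ^ 2 := by
    rw [← trace_transpose_mul_self, hH.trace_eq_sum_eigenvalues]
    simp
  have heig : ∀ i, hH.eigenvalues i = ‖apply A (hH.eigenvectorBasis i)‖ ^ 2 := by
    intro i
    rw [norm_apply_sq, hH.mulVec_eigenvectorBasis, dotProduct_smul]
    have h2 := EuclideanSpace.inner_eq_star_dotProduct (hH.eigenvectorBasis i)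
      (hH.eigenvectorBasis i)
    rw [real_inner_self_eq_norm_sq, hH.eigenvectorBasis.norm_eq_one, star_trivial] at h2
    rw [← h2]
    simp
  have hc : ∀ i, 0 ≤ hH.eigenvalues i := fun i => by rw [heig]; positivity
  have hcL : ∀ i, hH.eigenvalues i ≤ L := fun i => by
    rw [heig, hLdef]
    gcongr
    simpa [hH.eigenvectorBasis.norm_eq_one] using norm_apply_le A (hH.eigenvectorBasis i)
  have hLpos : 0 < L := by
    by_contra! h
    have h0 : ∑ i, hH.eigenvalues i ≤ 0 := Finset.sum_nonpos fun i _ => (hcL i).trans h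
    have : 0 ≤ L := by positivity
    linarith
  calc ∫⁻ x, (ENNReal.ofReal (‖apply A x‖ ^ 2))⁻¹ ∂(stdGaussian (EuclideanSpace ℝ (Fin n)))
      = ∫⁻ x, (∫⁻ s in Set.Ioi (0 : ℝ), ENNReal.ofReal (Real.exp (-(s * ‖apply A x‖ ^ 2))))
          ∂(stdGaussian (EuclideanSpace ℝ (Fin n))) := by
        exact lintegral_congr fun x => inv_ofReal_eq_lintegral_exp (sq_nonneg _)
    _ = ∫⁻ s in Set.Ioi (0 : ℝ), ∫⁻ x, ENNReal.ofReal (Real.exp (-(s * ‖apply A x‖ ^ 2)))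
          ∂(stdGaussian (EuclideanSpace ℝ (Fin n))) := by
        refine lintegral_lintegral_swap (Measurable.aemeasurable ?_)
        exact ((measurable_snd.mul (hmeas.comp measurable_fst)).neg.exp).ennreal_ofReal
    _ ≤ ∫⁻ s in Set.Ioi (0 : ℝ), ENNReal.ofReal ((1 + 2 * s * L) ^ (-(‖A‖ ^ 2 / L / 2))) := by
        refine setLIntegral_mono' measurableSet_Ioi fun s hs => ?_
        have hm : Measurable fun x => ENNReal.ofReal (Real.exp (-(s * ‖apply A x‖ ^ 2))) :=
          ((hmeas.const_mul s).neg.exp).ennreal_ofReal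
        rw [← (measurePreserving_sum_smul hH.eigenvectorBasis).lintegral_comp hm]
        simp_rw [norm_apply_sq, dotProduct_mulVec_sum_eigenvectorBasis hH]
        rw [← hsum]
        exact lintegral_exp_neg_sum_sq_pi_le (le_of_lt hs) hc hLpos hcL
    _ = _ := by
        rw [lintegral_one_add_mul_rpow hLpos ((lt_div_iff₀ hLpos).2 hA)]
        congr 3
        field_simp

/-! ### The joint law of the two views -/

/-- The law `𝒩(0, r² I)`. -/
noncomputable def scaledGaussian (r : ℝ) (d : ℕ) : Measure (EuclideanSpace ℝ (Fin d)) :=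
  (stdGaussian (EuclideanSpace ℝ (Fin d))).map (fun x => r • x)

instance (r : ℝ) (d : ℕ) : IsProbabilityMeasure (scaledGaussian r d) :=
  Measure.isProbabilityMeasure_map (by fun_prop)

theorem augLaw_eq {d : ℕ} (σ : ℝ) (x₀ : EuclideanSpace ℝ (Fin d)) :
    augLaw σ x₀ = (stdGaussian (EuclideanSpace ℝ (Fin d))).map (fun ξ => x₀ + σ • ξ) := by
  have hprob : IsProbabilityMeasure
      ((stdGaussian (EuclideanSpace ℝ (Fin d))).map (fun ξ => x₀ + σ • ξ)) :=
    Measure.isProbabilityMeasure_map (by fun_prop)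
  have hS : (σ ^ 2 • (1 : Matrix (Fin d) (Fin d) ℝ)).PosSemidef :=
    Matrix.PosSemidef.one.smul (sq_nonneg σ)
  have : IsProbabilityMeasure (augLaw σ x₀) := by
    unfold augLaw
    infer_instance
  refine Measure.ext_of_charFun (funext fun t => ?_)
  rw [augLaw, charFun_multivariateGaussian hS,
    show (fun ξ : EuclideanSpace ℝ (Fin d) => x₀ + σ • ξ) = (x₀ + ·) ∘ (σ • ·) from rfl,
    ← Measure.map_map (by fun_prop) (by fun_prop), charFun_map_const_add, charFun_map_smul,
    charFun_stdGaussian, ← Complex.exp_add]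
  congr 1
  have h := EuclideanSpace.real_norm_sq_eq t
  have h2 : t.ofLp ⬝ᵥ (σ ^ 2 • (1 : Matrix (Fin d) (Fin d) ℝ)) *ᵥ t.ofLp = σ ^ 2 * ‖t‖ ^ 2 := by
    rw [Matrix.smul_mulVec, Matrix.one_mulVec, dotProduct_smul, h, smul_eq_mul]
    simp [dotProduct, sq]
  rw [h2, real_inner_comm, ← Complex.ofReal_pow, norm_smul, mul_pow, Real.norm_eq_abs, sq_abs]
  ring

/-- The joint law of the two views `x₀ + σ ξ` and `x₀ + σ ξ'`. -/
noncomputable def viewLaw (σ : ℝ) (d : ℕ) :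
    Measure (EuclideanSpace ℝ (Fin d) × EuclideanSpace ℝ (Fin d)) :=
  ((stdGaussian _).prod ((stdGaussian _).prod (stdGaussian _))).map
    (fun p => (p.1 + σ • p.2.1, p.1 + σ • p.2.2))

instance (σ : ℝ) (d : ℕ) : IsProbabilityMeasure (viewLaw σ d) :=
  Measure.isProbabilityMeasure_map (by fun_prop)

/-- Boundedness supplies the integrability for Fubini; thereafter the iterated expectation is a
single integral against `viewLaw`. -/
theorem expectViews_eq_integral {d : ℕ} (σ : ℝ)
    {f : EuclideanSpace ℝ (Fin d) → EuclideanSpace ℝ (Fin d) → ℝ}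
    (hf : Measurable (Function.uncurry f)) {C : ℝ} (hC : ∀ x y, |f x y| ≤ C) :
    expectViews σ f = ∫ q, f q.1 q.2 ∂(viewLaw σ d) := by
  have hf1 : ∀ x, Measurable (f x) := fun x => hf.comp measurable_prodMk_left
  have hmap : Measurable fun p : EuclideanSpace ℝ (Fin d) × EuclideanSpace ℝ (Fin d) ×
      EuclideanSpace ℝ (Fin d) => (p.1 + σ • p.2.1, p.1 + σ • p.2.2) := by fun_prop
  have hg : Measurable fun p : EuclideanSpace ℝ (Fin d) × EuclideanSpace ℝ (Fin d) ×
      EuclideanSpace ℝ (Fin d) => f (p.1 + σ • p.2.1) (p.1 + σ • p.2.2) := hf.comp hmap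
  rw [viewLaw, integral_map (f := fun q => f q.1 q.2) hmap.aemeasurable hf.aestronglyMeasurable]
  rw [integral_prod _ (Integrable.of_bound hg.aestronglyMeasurable C
    (.of_forall fun p => hC _ _)), expectViews, inputLaw, multivariateGaussian_zero_one]
  refine integral_congr_ae (.of_forall fun x₀ => ?_)
  have hg' : Measurable fun p : EuclideanSpace ℝ (Fin d) × EuclideanSpace ℝ (Fin d) =>
      f (x₀ + σ • p.1) (x₀ + σ • p.2) := hg.comp measurable_prodMk_left
  simp only
  rw [integral_prod _ (Integrable.of_bound hg'.aestronglyMeasurable C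
    (.of_forall fun p => hC _ _)), augLaw_eq]
  have h1 : ∀ x, ∫ x', f x x' ∂((stdGaussian (EuclideanSpace ℝ (Fin d))).map
      (fun ξ => x₀ + σ • ξ)) = ∫ ξ, f x (x₀ + σ • ξ) ∂(stdGaussian _) := fun x =>
    integral_map (by fun_prop) (hf1 x).aestronglyMeasurable
  simp_rw [h1]
  rw [integral_map (by fun_prop)]
  refine (StronglyMeasurable.integral_prod_right
    (f := fun x ξ => f x (x₀ + σ • ξ)) ?_).aestronglyMeasurable
  have h2 : Measurable fun p : EuclideanSpace ℝ (Fin d) × EuclideanSpace ℝ (Fin d) =>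
      (p.1, x₀ + σ • p.2) := by fun_prop
  exact (hf.comp h2).stronglyMeasurable

theorem map_linear_combination_stdGaussian {d : ℕ} (a b c r : ℝ) (hr : r ^ 2 = a ^ 2 + b ^ 2 + c ^ 2) :
    ((stdGaussian (EuclideanSpace ℝ (Fin d))).prod
      ((stdGaussian (EuclideanSpace ℝ (Fin d))).prod
        (stdGaussian (EuclideanSpace ℝ (Fin d))))).map
        (fun p => a • p.1 + (b • p.2.1 + c • p.2.2)) = scaledGaussian r d := by
  have h2 : ((stdGaussian (EuclideanSpace ℝ (Fin d))).prod
      ((stdGaussian (EuclideanSpace ℝ (Fin d))).prod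
        (stdGaussian (EuclideanSpace ℝ (Fin d))))).map
        (fun p => a • p.1 + (b • p.2.1 + c • p.2.2))
      = Measure.conv (scaledGaussian a d) (Measure.conv (scaledGaussian b d)
        (scaledGaussian c d)) := by
    have h1 : Measure.conv (scaledGaussian b d) (scaledGaussian c d)
        = ((stdGaussian (EuclideanSpace ℝ (Fin d))).prod
          (stdGaussian (EuclideanSpace ℝ (Fin d)))).map (fun p => b • p.1 + c • p.2) := by
      simp only [Measure.conv, scaledGaussian]
      rw [Measure.map_prod_map _ _ (by fun_prop) (by fun_prop),
        Measure.map_map (by fun_prop) (by fun_prop)]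
      rfl
    rw [h1, Measure.conv, scaledGaussian, Measure.map_prod_map _ _ (by fun_prop) (by fun_prop),
      Measure.map_map (by fun_prop) (by fun_prop)]
    rfl
  rw [h2]
  refine Measure.ext_of_charFun (funext fun t => ?_)
  simp only [charFun_conv, scaledGaussian, charFun_map_smul, charFun_stdGaussian,
    ← Complex.exp_add, norm_smul, mul_pow, Complex.ofReal_mul, Real.norm_eq_abs]
  congr 1
  simp only [← Complex.ofReal_pow, sq_abs]
  rw [hr]
  push_cast
  ring

/-- The combination equals `(a + b) x₀ + a σ ξ + b σ ξ'` with independent standard Gaussian vectors,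
so the variances add up. -/
theorem measurePreserving_view_combination {d : ℕ} (σ a b r : ℝ)
    (hr : r ^ 2 = (a + b) ^ 2 + (a * σ) ^ 2 + (b * σ) ^ 2) :
    MeasurePreserving (fun q : EuclideanSpace ℝ (Fin d) × EuclideanSpace ℝ (Fin d) =>
      a • q.1 + b • q.2) (viewLaw σ d) (scaledGaussian r d) := by
  refine ⟨by fun_prop, ?_⟩
  rw [← map_linear_combination_stdGaussian _ _ _ _ hr, viewLaw,
    Measure.map_map (by fun_prop) (by fun_prop)]
  congr 1
  ext1 p
  simp only [Function.comp_apply]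
  module

theorem measurePreserving_view_fst {d : ℕ} (σ : ℝ) :
    MeasurePreserving (fun q : EuclideanSpace ℝ (Fin d) × EuclideanSpace ℝ (Fin d) => q.1)
      (viewLaw σ d) (scaledGaussian (√(1 + σ ^ 2)) d) := by
  have := measurePreserving_view_combination (d := d) σ 1 0 (√(1 + σ ^ 2))
    (by rw [Real.sq_sqrt (by positivity)]; ring)
  simpa using this

theorem measurePreserving_view_snd {d : ℕ} (σ : ℝ) :
    MeasurePreserving (fun q : EuclideanSpace ℝ (Fin d) × EuclideanSpace ℝ (Fin d) => q.2)
      (viewLaw σ d) (scaledGaussian (√(1 + σ ^ 2)) d) := by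
  have := measurePreserving_view_combination (d := d) σ 0 1 (√(1 + σ ^ 2))
    (by rw [Real.sq_sqrt (by positivity)]; ring)
  simpa using this

theorem measurePreserving_view_swap {d : ℕ} (σ : ℝ) :
    MeasurePreserving (Prod.swap : EuclideanSpace ℝ (Fin d) × EuclideanSpace ℝ (Fin d) → _)
      (viewLaw σ d) (viewLaw σ d) := by
  refine ⟨measurable_swap, ?_⟩
  have h : MeasurePreserving (Prod.map id Prod.swap)
      ((stdGaussian (EuclideanSpace ℝ (Fin d))).prod
        ((stdGaussian (EuclideanSpace ℝ (Fin d))).prod (stdGaussian (EuclideanSpace ℝ (Fin d)))))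
      ((stdGaussian (EuclideanSpace ℝ (Fin d))).prod
        ((stdGaussian (EuclideanSpace ℝ (Fin d))).prod (stdGaussian (EuclideanSpace ℝ (Fin d))))) :=
    (MeasurePreserving.id _).prod ⟨measurable_swap, Measure.prod_swap⟩
  rw [viewLaw, Measure.map_map measurable_swap (by fun_prop)]
  conv_rhs => rw [← h.map_eq]
  rw [Measure.map_map (by fun_prop) h.measurable]
  rfl

section Moments

variable {α : Type*} [MeasurableSpace α] {P : Measure α} {d : ℕ}
  {Y : α → EuclideanSpace ℝ (Fin d)} {r : ℝ}

theorem memLp_quadratic (hY : MeasurePreserving Y P (scaledGaussian r d))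
    (B : Matrix (Fin d) (Fin d) ℝ) : MemLp (fun a => (Y a).ofLp ⬝ᵥ B *ᵥ (Y a).ofLp) 2 P := by
  refine MemLp.comp_measurePreserving (g := fun x : EuclideanSpace ℝ (Fin d) =>
    x.ofLp ⬝ᵥ B *ᵥ x.ofLp) ?_ hY
  rw [scaledGaussian, memLp_map_measure_iff (measurable_quadratic B).aestronglyMeasurable
    (by fun_prop)]
  refine ((memLp_quadratic_stdGaussian B).const_mul (r ^ 2)).ae_eq (.of_forall fun x => ?_)
  simp only [Function.comp_apply, WithLp.ofLp_smul, Matrix.mulVec_smul, dotProduct_smul,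
    smul_dotProduct, smul_eq_mul]
  ring

theorem integrable_quadratic [IsFiniteMeasure P] (hY : MeasurePreserving Y P (scaledGaussian r d))
    (B : Matrix (Fin d) (Fin d) ℝ) : Integrable (fun a => (Y a).ofLp ⬝ᵥ B *ᵥ (Y a).ofLp) P :=
  (memLp_quadratic hY B).integrable (by norm_num)

theorem integral_quadratic (hY : MeasurePreserving Y P (scaledGaussian r d))
    (B : Matrix (Fin d) (Fin d) ℝ) :
    ∫ a, (Y a).ofLp ⬝ᵥ B *ᵥ (Y a).ofLp ∂P = r ^ 2 * B.trace := by
  have h := integral_map (μ := P) hY.aemeasurable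
    (measurable_quadratic B).aestronglyMeasurable
  rw [← h, hY.map_eq, scaledGaussian,
    integral_map (by fun_prop) (measurable_quadratic B).aestronglyMeasurable,
    ← integral_quadratic_stdGaussian, ← integral_const_mul]
  refine integral_congr_ae (.of_forall fun x => ?_)
  simp only [WithLp.ofLp_smul, Matrix.mulVec_smul, dotProduct_smul, smul_dotProduct, smul_eq_mul]
  ring

theorem integral_quadratic_sub_sq_le (hY : MeasurePreserving Y P (scaledGaussian r d))
    (B : Matrix (Fin d) (Fin d) ℝ) :
    ∫ a, ((Y a).ofLp ⬝ᵥ B *ᵥ (Y a).ofLp - r ^ 2 * B.trace) ^ 2 ∂P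
      ≤ r ^ 4 * (gaussianSqVariance * ‖B‖ ^ 2) := by
  have hm : Measurable fun x : EuclideanSpace ℝ (Fin d) =>
      (x.ofLp ⬝ᵥ B *ᵥ x.ofLp - r ^ 2 * B.trace) ^ 2 :=
    ((measurable_quadratic B).sub_const _).pow_const 2
  have h := integral_map (μ := P) hY.aemeasurable hm.aestronglyMeasurable
  rw [← h, hY.map_eq, scaledGaussian, integral_map (by fun_prop) hm.aestronglyMeasurable]
  calc _ = r ^ 4 * ∫ x, (x.ofLp ⬝ᵥ B *ᵥ x.ofLp - B.trace) ^ 2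
          ∂(stdGaussian (EuclideanSpace ℝ (Fin d))) := by
        rw [← integral_const_mul]
        refine integral_congr_ae (.of_forall fun x => ?_)
        simp only [WithLp.ofLp_smul, Matrix.mulVec_smul, dotProduct_smul, smul_dotProduct,
          smul_eq_mul]
        ring
    _ ≤ _ := by
        gcongr
        exact integral_quadratic_sub_trace_sq_le B

theorem measurable_apply {m : ℕ} (A : Matrix (Fin m) (Fin d) ℝ) : Measurable (apply A) :=
  (LinearMap.continuous_of_finiteDimensional (Matrix.toEuclideanLin A)).measurable

theorem integrable_norm_apply_sq [IsFiniteMeasure P]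
    (hY : MeasurePreserving Y P (scaledGaussian r d)) {m : ℕ} (A : Matrix (Fin m) (Fin d) ℝ) :
    Integrable (fun a => ‖apply A (Y a)‖ ^ 2) P := by
  simp_rw [norm_apply_sq]
  exact integrable_quadratic hY _

theorem integral_norm_apply_sq (hY : MeasurePreserving Y P (scaledGaussian r d)) {m : ℕ}
    (A : Matrix (Fin m) (Fin d) ℝ) :
    ∫ a, ‖apply A (Y a)‖ ^ 2 ∂P = r ^ 2 * ‖A‖ ^ 2 := by
  simp_rw [norm_apply_sq]
  rw [integral_quadratic hY, trace_transpose_mul_self]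

theorem lintegral_inv_norm_apply_sq_le (hY : MeasurePreserving Y P (scaledGaussian r d))
    (hr : 0 < r) {m : ℕ} (A : Matrix (Fin m) (Fin d) ℝ) (hA : 2 * opNorm A ^ 2 < ‖A‖ ^ 2) :
    ∫⁻ a, (ENNReal.ofReal (‖apply A (Y a)‖ ^ 2))⁻¹ ∂P
      ≤ ENNReal.ofReal (1 / (r ^ 2 * (‖A‖ ^ 2 - 2 * opNorm A ^ 2))) := by
  have hm : Measurable fun x : EuclideanSpace ℝ (Fin d) =>
      (ENNReal.ofReal (‖apply A x‖ ^ 2))⁻¹ :=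
    ((measurable_apply A).norm.pow_const 2).ennreal_ofReal.inv
  rw [hY.lintegral_comp hm, scaledGaussian, lintegral_map hm (by fun_prop)]
  have h : ∀ x : EuclideanSpace ℝ (Fin d), (ENNReal.ofReal (‖apply A (r • x)‖ ^ 2))⁻¹
      = ENNReal.ofReal (1 / r ^ 2) * (ENNReal.ofReal (‖apply A x‖ ^ 2))⁻¹ := by
    intro x
    rw [apply_smul_right, norm_smul, mul_pow, Real.norm_eq_abs, sq_abs,
      ENNReal.ofReal_mul (by positivity), ENNReal.mul_inv (by simp) (by simp),
      one_div, ENNReal.ofReal_inv_of_pos (by positivity)]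
  simp_rw [h]
  rw [lintegral_const_mul _ hm]
  calc _ ≤ ENNReal.ofReal (1 / r ^ 2)
        * ENNReal.ofReal (1 / (‖A‖ ^ 2 - 2 * opNorm A ^ 2)) := by
        gcongr
        exact lintegral_inv_norm_apply_sq_stdGaussian_le A hA
    _ = _ := by
        rw [← ENNReal.ofReal_mul (by positivity)]
        congr 1
        rw [div_mul_div_comm, one_mul]

end Moments

/-! ### Bilinear forms of the two views -/

section Bilinear

variable {d : ℕ}

theorem measurable_bilinear (B : Matrix (Fin d) (Fin d) ℝ) :
    Measurable fun q : EuclideanSpace ℝ (Fin d) × EuclideanSpace ℝ (Fin d) =>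
      q.1.ofLp ⬝ᵥ B *ᵥ q.2.ofLp := by
  simp only [dotProduct, Matrix.mulVec]
  fun_prop

theorem abs_bilinear_le (B : Matrix (Fin d) (Fin d) ℝ) (x y : EuclideanSpace ℝ (Fin d)) :
    |x.ofLp ⬝ᵥ B *ᵥ y.ofLp| ≤ opNorm B * (‖x‖ ^ 2 + ‖y‖ ^ 2) := by
  have h : x.ofLp ⬝ᵥ B *ᵥ y.ofLp = inner ℝ x (apply B y) := by
    simp only [apply, EuclideanSpace.inner_eq_star_dotProduct, star_trivial]
    exact dotProduct_comm _ _
  rw [h]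
  calc _ ≤ ‖x‖ * ‖apply B y‖ := abs_real_inner_le_norm _ _
    _ ≤ ‖x‖ * (opNorm B * ‖y‖) := by gcongr; exact norm_apply_le _ _
    _ = opNorm B * (‖x‖ * ‖y‖) := by ring
    _ ≤ _ := by
      refine mul_le_mul_of_nonneg_left ?_ (opNorm_nonneg B)
      nlinarith [sq_nonneg (‖x‖ - ‖y‖), sq_nonneg ‖x‖, sq_nonneg ‖y‖]

theorem integrable_norm_sq_of_measurePreserving {α : Type*} [MeasurableSpace α] {P : Measure α}
    [IsFiniteMeasure P] {Y : α → EuclideanSpace ℝ (Fin d)} {r : ℝ}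
    (hY : MeasurePreserving Y P (scaledGaussian r d)) : Integrable (fun a => ‖Y a‖ ^ 2) P := by
  have := integrable_norm_apply_sq hY (1 : Matrix (Fin d) (Fin d) ℝ)
  simpa [apply] using this

theorem integrable_bilinear (σ : ℝ) (B : Matrix (Fin d) (Fin d) ℝ) :
    Integrable (fun q => q.1.ofLp ⬝ᵥ B *ᵥ q.2.ofLp) (viewLaw σ d) := by
  have h1 := integrable_norm_sq_of_measurePreserving (measurePreserving_view_fst (d := d) σ)
  have h2 := integrable_norm_sq_of_measurePreserving (measurePreserving_view_snd (d := d) σ)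
  refine ((h1.add h2).const_mul (opNorm B)).mono' (measurable_bilinear B).aestronglyMeasurable
    (.of_forall fun q => ?_)
  exact abs_bilinear_le B q.1 q.2

theorem integral_bilinear_swap (σ : ℝ) (B : Matrix (Fin d) (Fin d) ℝ) :
    ∫ q, q.2.ofLp ⬝ᵥ B *ᵥ q.1.ofLp ∂(viewLaw σ d)
      = ∫ q, q.1.ofLp ⬝ᵥ B *ᵥ q.2.ofLp ∂(viewLaw σ d) := by
  have h := integral_map (μ := viewLaw σ d) measurable_swap.aemeasurable
    (measurable_bilinear B).aestronglyMeasurable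
  rw [(measurePreserving_view_swap σ).map_eq] at h
  exact h.symm

theorem bilinear_polarization (B : Matrix (Fin d) (Fin d) ℝ) (x y : EuclideanSpace ℝ (Fin d)) :
    ((1 / 2 : ℝ) • x + (1 / 2 : ℝ) • y).ofLp ⬝ᵥ B *ᵥ ((1 / 2 : ℝ) • x + (1 / 2 : ℝ) • y).ofLp
      - ((1 / 2 : ℝ) • x + (-1 / 2 : ℝ) • y).ofLp ⬝ᵥ
        B *ᵥ ((1 / 2 : ℝ) • x + (-1 / 2 : ℝ) • y).ofLp
      = 1 / 2 * (x.ofLp ⬝ᵥ B *ᵥ y.ofLp) + 1 / 2 * (y.ofLp ⬝ᵥ B *ᵥ x.ofLp) := by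
  simp only [WithLp.ofLp_add, WithLp.ofLp_smul, Matrix.mulVec_add, Matrix.mulVec_smul,
    dotProduct_add, add_dotProduct, dotProduct_smul, smul_dotProduct, smul_eq_mul]
  ring

theorem measurePreserving_view_half_add (σ : ℝ) :
    MeasurePreserving (fun q : EuclideanSpace ℝ (Fin d) × EuclideanSpace ℝ (Fin d) =>
      (1 / 2 : ℝ) • q.1 + (1 / 2 : ℝ) • q.2) (viewLaw σ d) (scaledGaussian (√(1 + σ ^ 2 / 2)) d) :=
  measurePreserving_view_combination _ _ _ _ (by rw [Real.sq_sqrt (by positivity)]; ring)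

theorem measurePreserving_view_half_sub (σ : ℝ) :
    MeasurePreserving (fun q : EuclideanSpace ℝ (Fin d) × EuclideanSpace ℝ (Fin d) =>
      (1 / 2 : ℝ) • q.1 + (-1 / 2 : ℝ) • q.2) (viewLaw σ d) (scaledGaussian (√(σ ^ 2 / 2)) d) :=
  measurePreserving_view_combination _ _ _ _ (by rw [Real.sq_sqrt (by positivity)]; ring)

/-- By polarization the bilinear form comes from the half-sum and the half-difference of the views,
whose variances `1 + σ²/2` and `σ²/2` differ by `1`, the covariance due to the common anchor.
Exchangeability of the views merges the two cross terms. -/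
theorem integral_bilinear (σ : ℝ) (B : Matrix (Fin d) (Fin d) ℝ) :
    ∫ q, q.1.ofLp ⬝ᵥ B *ᵥ q.2.ofLp ∂(viewLaw σ d) = B.trace := by
  have hu := measurePreserving_view_half_add (d := d) σ
  have hv := measurePreserving_view_half_sub (d := d) σ
  have h1 := integral_quadratic hu B
  have h2 := integral_quadratic hv B
  have h3 := integral_sub (integrable_quadratic hu B) (integrable_quadratic hv B)
  rw [h1, h2, Real.sq_sqrt (by positivity), Real.sq_sqrt (by positivity)] at h3
  simp_rw [bilinear_polarization] at h3
  have hi := integrable_bilinear σ B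
  have hi' : Integrable (fun q => q.2.ofLp ⬝ᵥ B *ᵥ q.1.ofLp) (viewLaw σ d) :=
    (measurePreserving_view_swap σ).integrable_comp_of_integrable hi
  rw [integral_add (hi.const_mul _) (hi'.const_mul _), integral_const_mul, integral_const_mul,
    integral_bilinear_swap] at h3
  linarith

theorem bilinear_eq_sub_of_isSymm {A : Matrix (Fin d) (Fin d) ℝ} (hA : A.IsSymm)
    (x y : EuclideanSpace ℝ (Fin d)) :
    x.ofLp ⬝ᵥ A *ᵥ y.ofLp
      = ((1 / 2 : ℝ) • x + (1 / 2 : ℝ) • y).ofLp ⬝ᵥ A *ᵥ ((1 / 2 : ℝ) • x + (1 / 2 : ℝ) • y).ofLp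
      - ((1 / 2 : ℝ) • x + (-1 / 2 : ℝ) • y).ofLp ⬝ᵥ
        A *ᵥ ((1 / 2 : ℝ) • x + (-1 / 2 : ℝ) • y).ofLp := by
  have h : y.ofLp ⬝ᵥ A *ᵥ x.ofLp = x.ofLp ⬝ᵥ A *ᵥ y.ofLp := by
    rw [dotProduct_comm, Matrix.dotProduct_mulVec, ← Matrix.mulVec_transpose, hA.eq,
      dotProduct_comm, Matrix.dotProduct_mulVec, ← Matrix.mulVec_transpose, hA.eq,
      dotProduct_comm]
  rw [bilinear_polarization, h]
  ring

theorem memLp_bilinear (σ : ℝ) {A : Matrix (Fin d) (Fin d) ℝ} (hA : A.IsSymm) :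
    MemLp (fun q => q.1.ofLp ⬝ᵥ A *ᵥ q.2.ofLp) 2 (viewLaw σ d) := by
  rw [funext fun q : EuclideanSpace ℝ (Fin d) × EuclideanSpace ℝ (Fin d) =>
    bilinear_eq_sub_of_isSymm hA q.1 q.2]
  exact (memLp_quadratic (measurePreserving_view_half_add σ) A).sub
    (memLp_quadratic (measurePreserving_view_half_sub σ) A)

/-- For symmetric `A` polarization is exact pointwise, so the deviation is a difference of two
deviations of quadratic forms, each with known variance. -/
theorem integral_bilinear_sub_sq_le (σ : ℝ) {A : Matrix (Fin d) (Fin d) ℝ} (hA : A.IsSymm) :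
    ∫ q, (q.1.ofLp ⬝ᵥ A *ᵥ q.2.ofLp - A.trace) ^ 2 ∂(viewLaw σ d)
      ≤ 4 * (1 + σ ^ 2) ^ 2 * (gaussianSqVariance * ‖A‖ ^ 2) := by
  have hu := measurePreserving_view_half_add (d := d) σ
  have hv := measurePreserving_view_half_sub (d := d) σ
  have h1 := integral_quadratic_sub_sq_le hu A
  have h2 := integral_quadratic_sub_sq_le hv A
  have i1 := ((memLp_quadratic hu A).sub (memLp_const (√(1 + σ ^ 2 / 2) ^ 2 * A.trace))).integrable_sq
  have i2 := ((memLp_quadratic hv A).sub (memLp_const (√(σ ^ 2 / 2) ^ 2 * A.trace))).integrable_sq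
  simp only [Pi.sub_apply] at i1 i2
  rw [show √(1 + σ ^ 2 / 2) ^ 4 = (√(1 + σ ^ 2 / 2) ^ 2) ^ 2 by ring] at h1
  rw [show √(σ ^ 2 / 2) ^ 4 = (√(σ ^ 2 / 2) ^ 2) ^ 2 by ring] at h2
  rw [Real.sq_sqrt (by positivity)] at h1 h2 i1 i2
  have hk : 0 ≤ gaussianSqVariance * ‖A‖ ^ 2 := mul_nonneg gaussianSqVariance_nonneg (sq_nonneg _)
  calc _ ≤ ∫ q, (2 * ((((1 / 2 : ℝ) • q.1 + (1 / 2 : ℝ) • q.2).ofLp ⬝ᵥ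
            A *ᵥ ((1 / 2 : ℝ) • q.1 + (1 / 2 : ℝ) • q.2).ofLp) - (1 + σ ^ 2 / 2) * A.trace) ^ 2
          + 2 * ((((1 / 2 : ℝ) • q.1 + (-1 / 2 : ℝ) • q.2).ofLp ⬝ᵥ
            A *ᵥ ((1 / 2 : ℝ) • q.1 + (-1 / 2 : ℝ) • q.2).ofLp) - (σ ^ 2 / 2) * A.trace) ^ 2)
          ∂(viewLaw σ d) := by
        refine integral_mono_of_nonneg (.of_forall fun q => sq_nonneg _)
          ((i1.const_mul 2).add (i2.const_mul 2)) (.of_forall fun q => ?_)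
        simp only
        rw [bilinear_eq_sub_of_isSymm hA]
        generalize ((1 / 2 : ℝ) • q.1 + (1 / 2 : ℝ) • q.2).ofLp ⬝ᵥ
            A *ᵥ ((1 / 2 : ℝ) • q.1 + (1 / 2 : ℝ) • q.2).ofLp = a
        generalize ((1 / 2 : ℝ) • q.1 + (-1 / 2 : ℝ) • q.2).ofLp ⬝ᵥ
            A *ᵥ ((1 / 2 : ℝ) • q.1 + (-1 / 2 : ℝ) • q.2).ofLp = b
        nlinarith [sq_nonneg ((a - (1 + σ ^ 2 / 2) * A.trace) + (b - (σ ^ 2 / 2) * A.trace))]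
    _ ≤ 2 * ((1 + σ ^ 2 / 2) ^ 2 * (gaussianSqVariance * ‖A‖ ^ 2))
        + 2 * ((σ ^ 2 / 2) ^ 2 * (gaussianSqVariance * ‖A‖ ^ 2)) := by
        rw [integral_add (i1.const_mul 2) (i2.const_mul 2), integral_const_mul, integral_const_mul]
        gcongr
    _ ≤ _ := by
        have : 2 * (1 + σ ^ 2 / 2) ^ 2 + 2 * (σ ^ 2 / 2) ^ 2 ≤ 4 * (1 + σ ^ 2) ^ 2 := by
          nlinarith [sq_nonneg σ, sq_nonneg (σ ^ 2)]
        nlinarith [mul_le_mul_of_nonneg_right this hk]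

end Bilinear

/-! ### Normalized vectors -/

theorem norm_normalize_le_one {m : ℕ} (v : EuclideanSpace ℝ (Fin m)) : ‖normalize v‖ ≤ 1 := by
  rw [normalize, norm_smul, norm_inv, norm_norm]
  exact inv_mul_le_one

theorem normalize_smul_of_pos {m : ℕ} {c : ℝ} (hc : 0 < c) (v : EuclideanSpace ℝ (Fin m)) :
    normalize (c • v) = normalize v := by
  rw [normalize, normalize, norm_smul, Real.norm_eq_abs, abs_of_pos hc, smul_smul, mul_inv]
  congr 1
  field_simp

theorem measurable_normalize {m : ℕ} :
    Measurable (normalize : EuclideanSpace ℝ (Fin m) → EuclideanSpace ℝ (Fin m)) := by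
  unfold normalize
  fun_prop

/-- The distance of `‖v‖²` from `1`. -/
noncomputable def sqNormDefect {m : ℕ} (v : EuclideanSpace ℝ (Fin m)) : ℝ := |‖v‖ ^ 2 - 1|

theorem sqNormDefect_nonneg {m : ℕ} (v : EuclideanSpace ℝ (Fin m)) : 0 ≤ sqNormDefect v :=
  abs_nonneg _

theorem abs_norm_sub_one_le {m : ℕ} (v : EuclideanSpace ℝ (Fin m)) :
    |‖v‖ - 1| ≤ sqNormDefect v := by
  rw [sqNormDefect, show ‖v‖ ^ 2 - 1 = (‖v‖ - 1) * (‖v‖ + 1) by ring, abs_mul]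
  have : 1 ≤ |‖v‖ + 1| := by
    rw [abs_of_nonneg (by positivity)]
    linarith [norm_nonneg v]
  nlinarith [abs_nonneg (‖v‖ - 1)]

/-- For `v ≠ 0` the left side is `|1 - ‖v‖|`. The bound also covers `v = 0`, where `normalize` gives
`0` and the defect is `1`. -/
theorem norm_normalize_sub_le {m : ℕ} (v : EuclideanSpace ℝ (Fin m)) :
    ‖normalize v - v‖ ≤ sqNormDefect v := by
  rcases eq_or_ne v 0 with rfl | hv
  · simp [normalize, sqNormDefect]
  · have h0 : ‖v‖ ≠ 0 := norm_ne_zero_iff.2 hv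
    have : normalize v - v = (‖v‖⁻¹ * (1 - ‖v‖)) • v := by
      rw [mul_sub, inv_mul_cancel₀ h0, mul_one, sub_smul, one_smul, normalize]
    rw [this, norm_smul, norm_mul, norm_inv, norm_norm, Real.norm_eq_abs, abs_sub_comm]
    calc _ = |‖v‖ - 1| := by field_simp
      _ ≤ _ := abs_norm_sub_one_le v

/-- The normalizations are removed one at a time. The product of the two defects is split by the
arithmetic-geometric inequality, so that each term involves one vector only and can be integrated
separately. -/
theorem abs_inner_apply_normalize_sub_le {m n : ℕ} {M : Matrix (Fin m) (Fin n) ℝ}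
    (hM : opNorm M ≤ 1) (a : EuclideanSpace ℝ (Fin m)) (b : EuclideanSpace ℝ (Fin n)) :
    |inner ℝ (normalize a) (apply M (normalize b)) - inner ℝ a (apply M b)|
      ≤ sqNormDefect a + sqNormDefect b
        + (1 / 2 * sqNormDefect a ^ 2 + 1 / 2 * sqNormDefect b ^ 2) := by
  have hMv : ∀ v, ‖apply M v‖ ≤ ‖v‖ := fun v =>
    (norm_apply_le M v).trans (by nlinarith [norm_nonneg v])
  have h1 : inner ℝ (normalize a) (apply M (normalize b)) - inner ℝ a (apply M b)
      = inner ℝ (normalize a - a) (apply M (normalize b))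
        + inner ℝ a (apply M (normalize b - b)) := by
    have : apply M (normalize b - b) = apply M (normalize b) - apply M b := by
      simp [apply, Matrix.mulVec_sub]
    rw [this, inner_sub_left, inner_sub_right]
    ring
  have ha := abs_norm_sub_one_le a
  have hb := norm_normalize_sub_le b
  have h2 : |inner ℝ (normalize a - a) (apply M (normalize b))| ≤ sqNormDefect a := by
    calc _ ≤ ‖normalize a - a‖ * ‖apply M (normalize b)‖ := abs_real_inner_le_norm _ _
      _ ≤ sqNormDefect a * 1 := by
        gcongr
        · exact sqNormDefect_nonneg a
        · exact norm_normalize_sub_le a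
        · exact (hMv _).trans (norm_normalize_le_one b)
      _ = _ := mul_one _
  have h3 : |inner ℝ a (apply M (normalize b - b))|
      ≤ (1 + sqNormDefect a) * sqNormDefect b := by
    calc _ ≤ ‖a‖ * ‖apply M (normalize b - b)‖ := abs_real_inner_le_norm _ _
      _ ≤ _ := by
        gcongr
        · linarith [sqNormDefect_nonneg a]
        · linarith [le_abs_self (‖a‖ - 1)]
        · exact (hMv _).trans hb
  rw [h1]
  refine (abs_add_le _ _).trans ?_
  nlinarith [sq_nonneg (sqNormDefect a - sqNormDefect b)]

/-! ### The closed form for feature matrices of small spectral norm -/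

/-- Cauchy-Schwarz, read off from the nonnegativity of the variance of `|f|`. -/
theorem integral_abs_le_sqrt {α : Type*} [MeasurableSpace α] {P : Measure α}
    [IsProbabilityMeasure P] {f : α → ℝ} (hf : MemLp f 2 P) {C : ℝ} (hC : ∫ a, f a ^ 2 ∂P ≤ C) :
    ∫ a, |f a| ∂P ≤ √C := by
  refine Real.le_sqrt_of_sq_le (le_trans ?_ hC)
  have h := variance_nonneg |f| P
  rw [variance_eq_sub hf.abs] at h
  simp only [Pi.pow_apply, Pi.abs_apply, sq_abs] at h
  linarith

section Concentration

variable {m d : ℕ} {α : Type*} [MeasurableSpace α] {P : Measure α}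
  {Y : α → EuclideanSpace ℝ (Fin d)} {r : ℝ}

theorem norm_smul_apply_sq_sub_one (hr : 0 < r) (Q : Matrix (Fin m) (Fin d) ℝ)
    (x : EuclideanSpace ℝ (Fin d)) :
    ‖r⁻¹ • apply Q x‖ ^ 2 - 1
      = (r ^ 2)⁻¹ * (x.ofLp ⬝ᵥ (Qᵀ * Q) *ᵥ x.ofLp - r ^ 2) := by
  rw [norm_smul, mul_pow, norm_apply_sq, Real.norm_eq_abs, sq_abs]
  field_simp

theorem memLp_sqNormDefect [IsFiniteMeasure P] (hY : MeasurePreserving Y P (scaledGaussian r d)) (hr : 0 < r)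
    (Q : Matrix (Fin m) (Fin d) ℝ) : MemLp (fun a => sqNormDefect (r⁻¹ • apply Q (Y a))) 2 P := by
  simp_rw [sqNormDefect, norm_smul_apply_sq_sub_one hr]
  exact (((memLp_quadratic hY (Qᵀ * Q)).sub (memLp_const _)).const_mul _).abs

/-- The variance of the quadratic form is controlled by `‖Qᵀ * Q‖ ≤ opNorm Q * ‖Q‖`: a small
spectral norm spreads the mass over many directions. The scale `r` cancels. -/
theorem integral_sqNormDefect_sq_le (hY : MeasurePreserving Y P (scaledGaussian r d)) (hr : 0 < r)
    {Q : Matrix (Fin m) (Fin d) ℝ} (hQ : ‖Q‖ = 1) :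
    ∫ a, sqNormDefect (r⁻¹ • apply Q (Y a)) ^ 2 ∂P ≤ gaussianSqVariance * opNorm Q ^ 2 := by
  have h := integral_quadratic_sub_sq_le hY (Qᵀ * Q)
  rw [trace_transpose_mul_self, hQ, one_pow, mul_one] at h
  simp_rw [sqNormDefect, norm_smul_apply_sq_sub_one hr, sq_abs, mul_pow]
  rw [integral_const_mul]
  have hQQ : ‖Qᵀ * Q‖ ≤ opNorm Q := by
    have := frobenius_norm_mul_le_opNorm_mul Qᵀ Q
    rwa [opNorm_transpose, hQ, mul_one] at this
  have hk := gaussianSqVariance_nonneg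
  calc _ ≤ ((r ^ 2)⁻¹) ^ 2 * (r ^ 4 * (gaussianSqVariance * ‖Qᵀ * Q‖ ^ 2)) := by gcongr
    _ = gaussianSqVariance * ‖Qᵀ * Q‖ ^ 2 := by field_simp
    _ ≤ _ := by gcongr

theorem integral_sqNormDefect_add_sq_le [IsProbabilityMeasure P]
    (hY : MeasurePreserving Y P (scaledGaussian r d))
    (hr : 0 < r) {Q : Matrix (Fin m) (Fin d) ℝ} (hQ : ‖Q‖ = 1) :
    ∫ a, (sqNormDefect (r⁻¹ • apply Q (Y a)) + 1 / 2 * sqNormDefect (r⁻¹ • apply Q (Y a)) ^ 2) ∂P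
      ≤ (√gaussianSqVariance + gaussianSqVariance) * opNorm Q := by
  have hm := memLp_sqNormDefect hY hr Q
  have h2 := integral_sqNormDefect_sq_le hY hr hQ
  have h1 := integral_abs_le_sqrt hm h2
  simp_rw [abs_of_nonneg (sqNormDefect_nonneg _)] at h1
  have hk := gaussianSqVariance_nonneg
  have hQ0 := opNorm_nonneg Q
  have hQ1 : opNorm Q ≤ 1 := (opNorm_le_frobenius Q).trans hQ.le
  rw [Real.sqrt_mul hk, Real.sqrt_sq hQ0] at h1
  rw [integral_add (hm.integrable (by norm_num)) (hm.integrable_sq.const_mul _),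
    integral_const_mul]
  have : gaussianSqVariance * opNorm Q ^ 2 ≤ gaussianSqVariance * opNorm Q := by
    gcongr
    nlinarith
  nlinarith [mul_nonneg hk hQ0]

end Concentration

theorem abs_inner_normalize_le_one {m : ℕ} (v w : EuclideanSpace ℝ (Fin m)) :
    |inner ℝ (normalize v) (normalize w)| ≤ 1 := by
  refine (abs_real_inner_le_norm _ _).trans ?_
  have h1 := norm_normalize_le_one v
  have h2 := norm_normalize_le_one w
  nlinarith [norm_nonneg (normalize v), norm_nonneg (normalize w)]

theorem abs_coord_normalize_le_one {m : ℕ} (v : EuclideanSpace ℝ (Fin m)) (i : Fin m) :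
    |normalize v i| ≤ 1 :=
  (PiLp.norm_apply_le (normalize v) i).trans (norm_normalize_le_one v)

section Features

variable {d h : ℕ}

theorem measurable_normalize_apply (A : Matrix (Fin h) (Fin d) ℝ) :
    Measurable fun x : EuclideanSpace ℝ (Fin d) => normalize (apply A x) :=
  measurable_normalize.comp (measurable_apply A)

theorem abs_feature_entry_le (z w : EuclideanSpace ℝ (Fin h)) (i j : Fin h) :
    |normalize z i * normalize w j
      - inner ℝ (normalize w) (normalize z) * (normalize w i * normalize w j)| ≤ 2 := by
  have h1 := abs_coord_normalize_le_one z i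
  have h2 := abs_coord_normalize_le_one w j
  have h3 := abs_coord_normalize_le_one w i
  have h4 := abs_inner_normalize_le_one w z
  have e1 : |normalize z i * normalize w j| ≤ 1 := by
    rw [abs_mul]
    exact mul_le_one₀ h1 (abs_nonneg _) h2
  have e2 : |inner ℝ (normalize w) (normalize z) * (normalize w i * normalize w j)| ≤ 1 := by
    rw [abs_mul, abs_mul]
    exact mul_le_one₀ h4 (by positivity) (mul_le_one₀ h3 (abs_nonneg _) h2)
  exact (abs_sub _ _).trans (by linarith)

theorem measurable_feature_entry (P Q : Matrix (Fin h) (Fin d) ℝ) (i j : Fin h) :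
    Measurable fun q : EuclideanSpace ℝ (Fin d) × EuclideanSpace ℝ (Fin d) =>
      normalize (apply P q.2) i * normalize (apply Q q.1) j
        - inner ℝ (normalize (apply Q q.1)) (normalize (apply P q.2))
          * (normalize (apply Q q.1) i * normalize (apply Q q.1) j) := by
  have h1 : Measurable fun q : EuclideanSpace ℝ (Fin d) × EuclideanSpace ℝ (Fin d) =>
      normalize (apply P q.2) := (measurable_normalize_apply P).comp measurable_snd
  have h2 : Measurable fun q : EuclideanSpace ℝ (Fin d) × EuclideanSpace ℝ (Fin d) =>
      normalize (apply Q q.1) := (measurable_normalize_apply Q).comp measurable_fst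
  have e (i : Fin h) : Measurable fun v : EuclideanSpace ℝ (Fin h) => v i := by fun_prop
  exact (((e i).comp h1).mul ((e j).comp h2)).sub
    ((h2.inner h1).mul (((e i).comp h2).mul ((e j).comp h2)))

theorem featureExpectation_apply (σ : ℝ) (Φ : Matrix (Fin h) (Fin d) ℝ)
    (W : Matrix (Fin h) (Fin h) ℝ) (i j : Fin h) :
    featureExpectation σ Φ W i j = ∫ q, (normalize (apply Φ q.2) i * normalize (apply (W * Φ) q.1) j
        - inner ℝ (normalize (apply (W * Φ) q.1)) (normalize (apply Φ q.2))
          * (normalize (apply (W * Φ) q.1) i * normalize (apply (W * Φ) q.1) j))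
        ∂(viewLaw σ d) := by
  rw [featureExpectation, Matrix.of_apply]
  exact expectViews_eq_integral σ (measurable_feature_entry Φ (W * Φ) i j)
    fun x y => abs_feature_entry_le _ _ i j

theorem sum_mul_coord_mul_coord (M : Matrix (Fin h) (Fin h) ℝ) (z w : EuclideanSpace ℝ (Fin h)) :
    ∑ i, ∑ j, M i j * (z i * w j) = inner ℝ z (apply M w) := by
  simp only [apply, PiLp.inner_apply, Matrix.mulVec, dotProduct, Real.inner_apply, Finset.mul_sum]
  exact Finset.sum_congr rfl fun i _ => Finset.sum_congr rfl fun j _ => by ring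

/-- Pairing with a test matrix reduces the nuclear norm estimate to a scalar integral, bounded
uniformly in `M`. -/
theorem trace_transpose_mul_featureExpectation (σ : ℝ) (Φ : Matrix (Fin h) (Fin d) ℝ)
    (W M : Matrix (Fin h) (Fin h) ℝ) :
    (Mᵀ * featureExpectation σ Φ W).trace
      = ∫ q, (inner ℝ (normalize (apply Φ q.2)) (apply M (normalize (apply (W * Φ) q.1)))
        - inner ℝ (normalize (apply (W * Φ) q.1)) (normalize (apply Φ q.2))
          * inner ℝ (normalize (apply (W * Φ) q.1)) (apply M (normalize (apply (W * Φ) q.1))))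
        ∂(viewLaw σ d) := by
  have hint : ∀ i j, Integrable (fun q : EuclideanSpace ℝ (Fin d) × EuclideanSpace ℝ (Fin d) =>
      M i j * (normalize (apply Φ q.2) i * normalize (apply (W * Φ) q.1) j
        - inner ℝ (normalize (apply (W * Φ) q.1)) (normalize (apply Φ q.2))
          * (normalize (apply (W * Φ) q.1) i * normalize (apply (W * Φ) q.1) j))) (viewLaw σ d) :=
    fun i j => (Integrable.of_bound
      (measurable_feature_entry Φ (W * Φ) i j).aestronglyMeasurable 2
      (.of_forall fun q => abs_feature_entry_le _ _ i j)).const_mul _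
  rw [trace_transpose_mul]
  simp_rw [featureExpectation_apply, ← integral_const_mul]
  simp_rw [← integral_finsetSum _ fun j _ => hint _ j]
  rw [← integral_finsetSum _ fun i _ => integrable_finsetSum _ fun j _ => hint i j]
  refine integral_congr_ae (.of_forall fun q => ?_)
  simp only
  rw [← sum_mul_coord_mul_coord, ← sum_mul_coord_mul_coord, Finset.mul_sum,
    ← Finset.sum_sub_distrib]
  refine Finset.sum_congr rfl fun i _ => ?_
  rw [Finset.mul_sum, ← Finset.sum_sub_distrib]
  exact Finset.sum_congr rfl fun j _ => by ring

end Features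

section ClosedForm

variable {d h : ℕ}

/-- The constant in the bound on the distance of `featureExpectation` from its closed form. -/
noncomputable def closedFormConst : ℝ :=
  4 * (√gaussianSqVariance + gaussianSqVariance) + 2 * √gaussianSqVariance + 2

theorem closedFormConst_pos : 0 < closedFormConst := by
  have := gaussianSqVariance_nonneg
  unfold closedFormConst
  positivity

theorem abs_feature_sub_le {M : Matrix (Fin h) (Fin h) ℝ} (hM : opNorm M ≤ 1)
    (z w : EuclideanSpace ℝ (Fin h)) {τ : ℝ} (hτ : |τ| ≤ 1) :
    |(inner ℝ (normalize z) (apply M (normalize w))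
        - inner ℝ (normalize w) (normalize z) * inner ℝ (normalize w) (apply M (normalize w)))
      - (inner ℝ z (apply M w) - τ * inner ℝ w (apply M w))|
    ≤ 4 * (sqNormDefect z + 1 / 2 * sqNormDefect z ^ 2)
      + 4 * (sqNormDefect w + 1 / 2 * sqNormDefect w ^ 2) + |inner ℝ w z - τ| := by
  have h1 := abs_inner_apply_normalize_sub_le hM z w
  have h2 := abs_inner_apply_normalize_sub_le hM w w
  have hI : opNorm (1 : Matrix (Fin h) (Fin h) ℝ) ≤ 1 :=
    opNorm_le_of_forall zero_le_one fun x => by simp [apply]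
  have h3 := abs_inner_apply_normalize_sub_le hI w z
  have happ : ∀ v : EuclideanSpace ℝ (Fin h), apply (1 : Matrix (Fin h) (Fin h) ℝ) v = v :=
    fun v => by simp [apply]
  simp only [happ] at h3
  have h4 : |inner ℝ (normalize w) (apply M (normalize w))| ≤ 1 := by
    refine (abs_real_inner_le_norm _ _).trans ?_
    have e1 := norm_normalize_le_one w
    have e2 := norm_apply_le M (normalize w)
    have e3 : ‖apply M (normalize w)‖ ≤ 1 := by nlinarith [norm_nonneg (normalize w)]
    exact mul_le_one₀ e1 (norm_nonneg _) e3
  have hz := sqNormDefect_nonneg z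
  have hw := sqNormDefect_nonneg w
  generalize inner ℝ (normalize z) (apply M (normalize w)) = a at *
  generalize inner ℝ (normalize w) (normalize z) = b at *
  generalize inner ℝ (normalize w) (apply M (normalize w)) = c at *
  generalize inner ℝ z (apply M w) = a' at *
  generalize inner ℝ w z = b' at *
  generalize inner ℝ w (apply M w) = c' at *
  -- Every difference is multiplied by `c` or `τ`, both at most `1` in absolute value, so the four
  -- errors simply add.
  have key : (a - b * c) - (a' - τ * c')
      = (a - a') - (b - b') * c - (b' - τ) * c - τ * (c - c') := by ring
  have k1 : |(b - b') * c| ≤ |b - b'| := by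
    rw [abs_mul]
    exact mul_le_of_le_one_right (abs_nonneg _) h4
  have k2 : |(b' - τ) * c| ≤ |b' - τ| := by
    rw [abs_mul]
    exact mul_le_of_le_one_right (abs_nonneg _) h4
  have k3 : |τ * (c - c')| ≤ |c - c'| := by
    rw [abs_mul]
    exact mul_le_of_le_one_left (abs_nonneg _) hτ
  rw [key]
  have t1 := abs_sub ((a - a') - (b - b') * c - (b' - τ) * c) (τ * (c - c'))
  have t2 := abs_sub ((a - a') - (b - b') * c) ((b' - τ) * c)
  have t3 := abs_sub (a - a') ((b - b') * c)
  nlinarith [sq_nonneg (sqNormDefect z), sq_nonneg (sqNormDefect w)]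

theorem inner_smul_apply_smul_apply (r : ℝ) (A B : Matrix (Fin h) (Fin d) ℝ)
    (x y : EuclideanSpace ℝ (Fin d)) :
    inner ℝ (r⁻¹ • apply A x) (r⁻¹ • apply B y)
      = (r ^ 2)⁻¹ * (x.ofLp ⬝ᵥ (Aᵀ * B) *ᵥ y.ofLp) := by
  rw [real_inner_smul_left, real_inner_smul_right, inner_apply_apply, ← mul_assoc]
  congr 1
  rw [sq, mul_inv]

/-- Dividing by `r = √(1 + σ²)` makes the mean squared lengths of `P x'` and `Q x` equal to `1` and
leaves their directions unchanged. Normalizations can then be dropped at the cost of the defects,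
and `⟨w, z⟩` replaced by its mean `τ`; the remaining integral is an exact trace expression. -/
theorem abs_integral_feature_sub_le {σ : ℝ} {P Q : Matrix (Fin h) (Fin d) ℝ} (hP : ‖P‖ = 1)
    (hQ : ‖Q‖ = 1) (hPQ : (Qᵀ * P).IsSymm) {M : Matrix (Fin h) (Fin h) ℝ} (hM : opNorm M ≤ 1) :
    |(∫ q, (inner ℝ (normalize (apply P q.2)) (apply M (normalize (apply Q q.1)))
        - inner ℝ (normalize (apply Q q.1)) (normalize (apply P q.2))
          * inner ℝ (normalize (apply Q q.1)) (apply M (normalize (apply Q q.1))))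
        ∂(viewLaw σ d))
      - (1 + σ ^ 2)⁻¹ * ((Mᵀ * (P * Qᵀ)).trace - (Pᵀ * Q).trace * (Mᵀ * (Q * Qᵀ)).trace)|
    ≤ 4 * (√gaussianSqVariance + gaussianSqVariance) * (opNorm P + opNorm Q)
      + 2 * √gaussianSqVariance * opNorm Q := by
  set r := √(1 + σ ^ 2) with hr
  have hr0 : 0 < r := Real.sqrt_pos.2 (by positivity)
  have hr2 : r ^ 2 = 1 + σ ^ 2 := Real.sq_sqrt (by positivity)
  have hfst := measurePreserving_view_fst (d := d) σ
  have hsnd := measurePreserving_view_snd (d := d) σ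
  rw [← hr] at hfst hsnd
  have hk := gaussianSqVariance_nonneg
  set τ := (r ^ 2)⁻¹ * (Qᵀ * P).trace with hτdef
  have hτ : |τ| ≤ 1 := by
    have h1 := abs_trace_transpose_mul_le Q P
    rw [hP, hQ, mul_one] at h1
    rw [hτdef, abs_mul, abs_inv, abs_of_pos (by positivity : 0 < r ^ 2), hr2]
    refine mul_le_one₀ ?_ (abs_nonneg _) h1
    exact inv_le_one_of_one_le₀ (by nlinarith [sq_nonneg σ])
  set z : EuclideanSpace ℝ (Fin d) × EuclideanSpace ℝ (Fin d) → EuclideanSpace ℝ (Fin h) :=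
    fun q => r⁻¹ • apply P q.2 with hz
  set w : EuclideanSpace ℝ (Fin d) × EuclideanSpace ℝ (Fin d) → EuclideanSpace ℝ (Fin h) :=
    fun q => r⁻¹ • apply Q q.1 with hw
  have hnz : ∀ q : EuclideanSpace ℝ (Fin d) × EuclideanSpace ℝ (Fin d),
      normalize (apply P q.2) = normalize (z q) := fun q =>
    (normalize_smul_of_pos (inv_pos.2 hr0) _).symm
  have hnw : ∀ q : EuclideanSpace ℝ (Fin d) × EuclideanSpace ℝ (Fin d),
      normalize (apply Q q.1) = normalize (w q) := fun q =>
    (normalize_smul_of_pos (inv_pos.2 hr0) _).symm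
  -- the limit integrand
  have hzMw : ∀ q : EuclideanSpace ℝ (Fin d) × EuclideanSpace ℝ (Fin d),
      inner ℝ (z q) (apply M (w q))
        = (r ^ 2)⁻¹ * (q.1.ofLp ⬝ᵥ ((M * Q)ᵀ * P) *ᵥ q.2.ofLp) := fun q => by
    rw [real_inner_comm, hw, hz]
    simp only
    rw [apply_smul_right, ← apply_mul, inner_smul_apply_smul_apply]
  have hwMw : ∀ q : EuclideanSpace ℝ (Fin d) × EuclideanSpace ℝ (Fin d),
      inner ℝ (w q) (apply M (w q))
        = (r ^ 2)⁻¹ * (q.1.ofLp ⬝ᵥ (Qᵀ * (M * Q)) *ᵥ q.1.ofLp) := fun q => by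
    rw [hw]
    simp only
    rw [apply_smul_right, ← apply_mul, inner_smul_apply_smul_apply]
  have hwz : ∀ q : EuclideanSpace ℝ (Fin d) × EuclideanSpace ℝ (Fin d),
      inner ℝ (w q) (z q) - τ
        = (r ^ 2)⁻¹ * (q.1.ofLp ⬝ᵥ (Qᵀ * P) *ᵥ q.2.ofLp - (Qᵀ * P).trace) := fun q => by
    rw [hw, hz]
    simp only
    rw [inner_smul_apply_smul_apply, hτdef]
    ring
  have hi1 : Integrable (fun q => inner ℝ (z q) (apply M (w q))) (viewLaw σ d) := by
    simp_rw [hzMw]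
    exact (integrable_bilinear σ _).const_mul _
  have hi2 : Integrable (fun q => inner ℝ (w q) (apply M (w q))) (viewLaw σ d) := by
    simp_rw [hwMw]
    exact (integrable_quadratic hfst _).const_mul _
  -- The cubic expression has become quadratic because `τ` is a constant, so second moments of the
  -- views suffice.
  have hT : ∫ q, (inner ℝ (z q) (apply M (w q)) - τ * inner ℝ (w q) (apply M (w q)))
      ∂(viewLaw σ d)
      = (1 + σ ^ 2)⁻¹ * ((Mᵀ * (P * Qᵀ)).trace - (Pᵀ * Q).trace * (Mᵀ * (Q * Qᵀ)).trace) := by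
    rw [integral_sub hi1 (hi2.const_mul τ), integral_const_mul]
    simp_rw [hzMw, hwMw]
    rw [integral_const_mul, integral_const_mul, integral_bilinear, integral_quadratic hfst, hτdef]
    have e1 : ((M * Q)ᵀ * P).trace = (Mᵀ * (P * Qᵀ)).trace := by
      rw [Matrix.transpose_mul, Matrix.mul_assoc, Matrix.trace_mul_comm, Matrix.mul_assoc]
    have e2 : (Qᵀ * (M * Q)).trace = (Mᵀ * (Q * Qᵀ)).trace := by
      rw [← Matrix.trace_transpose (Qᵀ * (M * Q)), Matrix.transpose_mul, Matrix.transpose_mul,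
        Matrix.transpose_transpose, Matrix.mul_assoc, Matrix.trace_mul_comm, Matrix.mul_assoc]
    have e3 : (Qᵀ * P).trace = (Pᵀ * Q).trace := by
      rw [← Matrix.trace_transpose (Qᵀ * P), Matrix.transpose_mul, Matrix.transpose_transpose]
    rw [e1, e2, e3, ← hr2]
    field_simp
  -- integrability of the error terms
  have hDz := memLp_sqNormDefect hsnd hr0 P
  have hDw := memLp_sqNormDefect hfst hr0 Q
  have hIz : Integrable (fun q => sqNormDefect (z q) + 1 / 2 * sqNormDefect (z q) ^ 2)
      (viewLaw σ d) := (hDz.integrable (by norm_num)).add (hDz.integrable_sq.const_mul _)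
  have hIw : Integrable (fun q => sqNormDefect (w q) + 1 / 2 * sqNormDefect (w q) ^ 2)
      (viewLaw σ d) := (hDw.integrable (by norm_num)).add (hDw.integrable_sq.const_mul _)
  have hB : MemLp (fun q => inner ℝ (w q) (z q) - τ) 2 (viewLaw σ d) := by
    simp_rw [hwz]
    exact ((memLp_bilinear σ hPQ).sub (memLp_const _)).const_mul _
  -- Symmetry of `Qᵀ * P` enters here, through the variance of the bilinear form in the two views.
  have hBint : ∫ q, |inner ℝ (w q) (z q) - τ| ∂(viewLaw σ d)
      ≤ 2 * √gaussianSqVariance * opNorm Q := by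
    have hPQn : ‖Qᵀ * P‖ ≤ opNorm Q := by
      have := frobenius_norm_mul_le_opNorm_mul Qᵀ P
      rwa [opNorm_transpose, hP, mul_one] at this
    have : ∫ q, (inner ℝ (w q) (z q) - τ) ^ 2 ∂(viewLaw σ d)
        ≤ (2 * opNorm Q) ^ 2 * gaussianSqVariance := by
      simp_rw [hwz, mul_pow]
      rw [integral_const_mul]
      calc _ ≤ ((r ^ 2)⁻¹) ^ 2 * (4 * (1 + σ ^ 2) ^ 2 * (gaussianSqVariance * ‖Qᵀ * P‖ ^ 2)) := by
            gcongr
            exact integral_bilinear_sub_sq_le σ hPQ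
        _ = 4 * gaussianSqVariance * ‖Qᵀ * P‖ ^ 2 := by
            rw [hr2]
            field_simp
        _ ≤ 4 * gaussianSqVariance * opNorm Q ^ 2 := by gcongr
        _ = _ := by ring
    have h2 := integral_abs_le_sqrt hB this
    rw [Real.sqrt_mul (sq_nonneg _), Real.sqrt_sq (by linarith [opNorm_nonneg Q])] at h2
    linarith
  have hmeas1 : Measurable fun q : EuclideanSpace ℝ (Fin d) × EuclideanSpace ℝ (Fin d) =>
      normalize (z q) := by
    simp_rw [← hnz]
    exact (measurable_normalize_apply P).comp measurable_snd
  have hmeas2 : Measurable fun q : EuclideanSpace ℝ (Fin d) × EuclideanSpace ℝ (Fin d) =>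
      normalize (w q) := by
    simp_rw [← hnw]
    exact (measurable_normalize_apply Q).comp measurable_fst
  have hmeas3 := (measurable_apply M).comp hmeas2
  have hbound : ∀ v u : EuclideanSpace ℝ (Fin h),
      |inner ℝ (normalize v) (apply M (normalize u))| ≤ 1 := fun v u => by
    refine (abs_real_inner_le_norm _ _).trans ?_
    have e3 : ‖apply M (normalize u)‖ ≤ 1 := by
      nlinarith [norm_apply_le M (normalize u), norm_nonneg (normalize u),
        norm_normalize_le_one u, opNorm_nonneg M]
    exact mul_le_one₀ (norm_normalize_le_one v) (norm_nonneg _) e3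
  have hF : Integrable (fun q => inner ℝ (normalize (z q)) (apply M (normalize (w q)))
      - inner ℝ (normalize (w q)) (normalize (z q))
        * inner ℝ (normalize (w q)) (apply M (normalize (w q)))) (viewLaw σ d) := by
    refine Integrable.of_bound ((hmeas1.inner hmeas3).sub
      ((hmeas2.inner hmeas1).mul (hmeas2.inner hmeas3))).aestronglyMeasurable 2
      (.of_forall fun q => ?_)
    rw [Real.norm_eq_abs]
    refine (abs_sub _ _).trans ?_
    have e1 := hbound (z q) (w q)
    have e2 : |inner ℝ (normalize (w q)) (normalize (z q))
        * inner ℝ (normalize (w q)) (apply M (normalize (w q)))| ≤ 1 := by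
      rw [abs_mul]
      exact mul_le_one₀ (abs_inner_normalize_le_one _ _) (abs_nonneg _) (hbound _ _)
    linarith
  have hIB : Integrable (fun q => |inner ℝ (w q) (z q) - τ|) (viewLaw σ d) :=
    hB.abs.integrable (by norm_num)
  have hI4 : Integrable (fun q => 4 * (sqNormDefect (z q) + 1 / 2 * sqNormDefect (z q) ^ 2)
      + 4 * (sqNormDefect (w q) + 1 / 2 * sqNormDefect (w q) ^ 2)) (viewLaw σ d) :=
    (hIz.const_mul 4).add (hIw.const_mul 4)
  simp_rw [hnz, hnw]
  have hi12 : Integrable (fun q => inner ℝ (z q) (apply M (w q))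
      - τ * inner ℝ (w q) (apply M (w q))) (viewLaw σ d) := hi1.sub (hi2.const_mul τ)
  rw [← hT, ← integral_sub hF hi12]
  refine (abs_integral_le_integral_abs).trans ?_
  calc _ ≤ ∫ q, (4 * (sqNormDefect (z q) + 1 / 2 * sqNormDefect (z q) ^ 2)
        + 4 * (sqNormDefect (w q) + 1 / 2 * sqNormDefect (w q) ^ 2)
        + |inner ℝ (w q) (z q) - τ|) ∂(viewLaw σ d) := by
        refine integral_mono_of_nonneg (.of_forall fun q => abs_nonneg _)
          (hI4.add hIB) (.of_forall fun q => ?_)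
        exact abs_feature_sub_le hM (z q) (w q) hτ
    _ ≤ 4 * ((√gaussianSqVariance + gaussianSqVariance) * opNorm P)
        + 4 * ((√gaussianSqVariance + gaussianSqVariance) * opNorm Q)
        + 2 * √gaussianSqVariance * opNorm Q := by
        rw [integral_add hI4 hIB,
          integral_add (hIz.const_mul 4) (hIw.const_mul 4), integral_const_mul, integral_const_mul]
        gcongr
        · exact integral_sqNormDefect_add_sq_le hsnd hr0 hP
        · exact integral_sqNormDefect_add_sq_le hfst hr0 hQ
    _ = _ := by ring

theorem nuclearNorm_le_of_forall {A : Matrix (Fin h) (Fin h) ℝ} {c : ℝ}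
    (hA : ∀ M : Matrix (Fin h) (Fin h) ℝ, opNorm M ≤ 1 → (Mᵀ * A).trace ≤ c) :
    nuclearNorm A ≤ c := by
  refine csSup_le ⟨0, 0, by simp, by simp⟩ ?_
  rintro _ ⟨M, hM, rfl⟩
  exact hA M hM

theorem norm_frobeniusNormalize {m n : ℕ} {A : Matrix (Fin m) (Fin n) ℝ} (hA : 0 < ‖A‖) :
    ‖frobeniusNormalize A‖ = 1 := by
  rw [frobeniusNormalize, norm_smul, norm_inv, norm_norm, inv_mul_cancel₀ hA.ne']

theorem opNorm_frobeniusNormalize {m n : ℕ} (A : Matrix (Fin m) (Fin n) ℝ) :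
    opNorm (frobeniusNormalize A) = opNorm A / ‖A‖ := by
  rw [frobeniusNormalize, opNorm_smul, abs_inv, abs_norm, div_eq_inv_mul]

theorem normalize_apply_frobeniusNormalize {m n : ℕ} {A : Matrix (Fin m) (Fin n) ℝ} (hA : 0 < ‖A‖)
    (x : EuclideanSpace ℝ (Fin n)) :
    normalize (apply (frobeniusNormalize A) x) = normalize (apply A x) := by
  rw [frobeniusNormalize, apply_smul, normalize_smul_of_pos (inv_pos.2 hA)]

/-- The distance of `featureExpectation` from its closed form is controlled by the ratios of
spectral to Frobenius norm of the feature matrices. -/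
theorem nuclearNorm_featureExpectation_sub_closedForm_le (σ : ℝ) {Φ : Matrix (Fin h) (Fin d) ℝ}
    {W : Matrix (Fin h) (Fin h) ℝ} (hW : W.IsSymm) (hΦ : 0 < ‖Φ‖) (hΨ : 0 < ‖W * Φ‖) :
    nuclearNorm (featureExpectation σ Φ W - closedForm σ Φ W)
      ≤ closedFormConst * (opNorm Φ / ‖Φ‖ + opNorm (W * Φ) / ‖W * Φ‖) := by
  refine nuclearNorm_le_of_forall fun M hM => ?_
  rw [← opNorm_frobeniusNormalize, ← opNorm_frobeniusNormalize, closedForm]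
  set P := frobeniusNormalize Φ with hPdef
  set Q := frobeniusNormalize (W * Φ) with hQdef
  have hP : ‖P‖ = 1 := norm_frobeniusNormalize hΦ
  have hQ : ‖Q‖ = 1 := norm_frobeniusNormalize hΨ
  -- Up to a scalar this matrix is `Φᵀ W Φ`, symmetric because `W` is.
  have hPQ : (Qᵀ * P).IsSymm := by
    rw [hPdef, hQdef, frobeniusNormalize, frobeniusNormalize, Matrix.transpose_smul,
      Matrix.smul_mul, Matrix.mul_smul, Matrix.transpose_mul, hW.eq, Matrix.mul_assoc]
    refine Matrix.IsSymm.smul (Matrix.IsSymm.smul ?_ _) _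
    rw [Matrix.IsSymm, Matrix.transpose_mul, Matrix.transpose_mul, Matrix.transpose_transpose,
      hW.eq, Matrix.mul_assoc]
  have hmain := abs_integral_feature_sub_le (σ := σ) hP hQ hPQ hM
  simp_rw [hPdef, hQdef, normalize_apply_frobeniusNormalize hΦ,
    normalize_apply_frobeniusNormalize hΨ, ← hPdef, ← hQdef] at hmain
  rw [← trace_transpose_mul_featureExpectation] at hmain
  -- The quartic term of the closed form is small by itself: `‖Mᵀ Q Pᵀ‖ ≤ 1`, while `‖Q Qᵀ‖ ≤ opNorm
  -- Q`. This is why it may appear in the closed form although the concentration argument does not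
  -- produce it.
  have hextra : |(Mᵀ * (Q * Pᵀ * Q * Qᵀ)).trace| ≤ opNorm Q := by
    have e : (Mᵀ * (Q * Pᵀ * Q * Qᵀ)).trace = ((Mᵀ * (Q * Pᵀ))ᵀᵀ * (Q * Qᵀ)).trace := by
      rw [Matrix.transpose_transpose]
      simp only [Matrix.mul_assoc]
    rw [e]
    refine (abs_trace_transpose_mul_le _ _).trans ?_
    rw [Matrix.frobenius_norm_transpose]
    have f1 : ‖Mᵀ * (Q * Pᵀ)‖ ≤ 1 := by
      have g1 := frobenius_norm_mul_le_opNorm_mul Mᵀ (Q * Pᵀ)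
      have g2 := Matrix.frobenius_norm_mul Q Pᵀ
      rw [Matrix.frobenius_norm_transpose, hP, hQ, mul_one] at g2
      rw [opNorm_transpose] at g1
      exact g1.trans (mul_le_one₀ hM (norm_nonneg _) g2)
    have f2 : ‖Q * Qᵀ‖ ≤ opNorm Q := by
      have g1 := frobenius_norm_mul_le_opNorm_mul Q Qᵀ
      rwa [Matrix.frobenius_norm_transpose, hQ, mul_one] at g1
    nlinarith [norm_nonneg (Q * Qᵀ), opNorm_nonneg Q]
  have hs : 0 < (1 + σ ^ 2)⁻¹ := by positivity
  have hs1 : (1 + σ ^ 2)⁻¹ ≤ 1 := inv_le_one_of_one_le₀ (by nlinarith [sq_nonneg σ])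
  have htr : (Mᵀ * (featureExpectation σ Φ W - (1 + σ ^ 2)⁻¹ • (P * Qᵀ
      - (2 : ℝ) • (Q * Pᵀ * Q * Qᵀ) - (Pᵀ * Q).trace • (Q * Qᵀ)))).trace
      = ((Mᵀ * featureExpectation σ Φ W).trace - (1 + σ ^ 2)⁻¹ * ((Mᵀ * (P * Qᵀ)).trace
        - (Pᵀ * Q).trace * (Mᵀ * (Q * Qᵀ)).trace))
        + 2 * ((1 + σ ^ 2)⁻¹ * (Mᵀ * (Q * Pᵀ * Q * Qᵀ)).trace) := by
    simp only [Matrix.mul_sub, Matrix.mul_smul, Matrix.trace_sub, Matrix.trace_smul, smul_eq_mul]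
    ring
  have hlast : (1 + σ ^ 2)⁻¹ * (Mᵀ * (Q * Pᵀ * Q * Qᵀ)).trace ≤ opNorm Q := by
    refine (le_abs_self _).trans ?_
    rw [abs_mul, abs_of_pos hs]
    nlinarith [abs_nonneg (Mᵀ * (Q * Pᵀ * Q * Qᵀ)).trace]
  have hk := gaussianSqVariance_nonneg
  have hsk := Real.sqrt_nonneg gaussianSqVariance
  rw [htr, closedFormConst]
  nlinarith [(abs_le.1 hmain).2, opNorm_nonneg P, opNorm_nonneg Q,
    mul_nonneg hsk (opNorm_nonneg P)]

end ClosedForm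

/-! ### Gradients of the objective -/

/-- Only the base vector `v` must be nonzero, since `‖u‖ • normalize u = u` holds for `u = 0` too.
The loss can thus be compared with arbitrary competitors. -/
theorem norm_normalize_sub_normalize_le {m : ℕ} (u : EuclideanSpace ℝ (Fin m))
    {v : EuclideanSpace ℝ (Fin m)} (hv : v ≠ 0) :
    ‖normalize u - normalize v‖ ≤ 2 * (‖u - v‖ * ‖v‖⁻¹) := by
  have hv0 : 0 < ‖v‖ := norm_pos_iff.2 hv
  have hu : ‖u‖ • normalize u = u := by
    rcases eq_or_ne u 0 with rfl | hu
    · simp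
    · rw [normalize, smul_smul, mul_inv_cancel₀ (norm_ne_zero_iff.2 hu), one_smul]
  have hv' : ‖v‖ • normalize v = v := by
    rw [normalize, smul_smul, mul_inv_cancel₀ hv0.ne', one_smul]
  have h1 : ‖v‖ • (normalize u - normalize v) = (‖v‖ - ‖u‖) • normalize u + (u - v) := by
    rw [smul_sub, sub_smul, hu, hv']
    abel
  have h2 : ‖v‖ * ‖normalize u - normalize v‖ ≤ 2 * ‖u - v‖ := by
    rw [← abs_of_pos hv0, ← Real.norm_eq_abs, ← norm_smul, h1]
    refine (norm_add_le _ _).trans ?_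
    rw [norm_smul, Real.norm_eq_abs]
    have e1 := abs_norm_sub_norm_le v u
    rw [norm_sub_rev v u] at e1
    nlinarith [norm_normalize_le_one u, norm_nonneg (normalize u), abs_nonneg (‖v‖ - ‖u‖)]
  rw [← mul_assoc, ← div_eq_mul_inv, le_div_iff₀ hv0]
  linarith

section Loss

variable {d h : ℕ}

theorem cosLoss_eq (σ : ℝ) (Φsg Φ : Matrix (Fin h) (Fin d) ℝ) (W : Matrix (Fin h) (Fin h) ℝ) :
    cosLoss σ Φsg Φ W
      = -∫ q, inner ℝ (normalize (apply (W * Φ) q.1)) (normalize (apply Φsg q.2))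
        ∂(viewLaw σ d) := by
  have e : ∀ x x' : EuclideanSpace ℝ (Fin d),
      -(inner ℝ (apply (W * Φ) x) (apply Φsg x') / (‖apply (W * Φ) x‖ * ‖apply Φsg x'‖))
        = -inner ℝ (normalize (apply (W * Φ) x)) (normalize (apply Φsg x')) := by
    intro x x'
    rw [normalize, normalize, real_inner_smul_left, real_inner_smul_right, div_eq_mul_inv, mul_inv]
    ring
  rw [cosLoss]
  simp_rw [e]
  rw [expectViews_eq_integral (C := 1) σ, integral_neg]
  · exact (((measurable_normalize_apply (W * Φ)).comp measurable_fst).inner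
      ((measurable_normalize_apply Φsg).comp measurable_snd)).neg
  · intro x y
    rw [abs_neg]
    exact abs_inner_normalize_le_one _ _

/-- Cauchy-Schwarz for `‖(Ψ₁ - Ψ₂) x‖` times `1 / ‖Ψ₂ x‖`, with the inverse second moment bounding
the second factor. -/
theorem integral_norm_normalize_sub_le (σ : ℝ) (Ψ₁ : Matrix (Fin h) (Fin d) ℝ)
    {Ψ₂ : Matrix (Fin h) (Fin d) ℝ} (hΨ : 2 * opNorm Ψ₂ ^ 2 < ‖Ψ₂‖ ^ 2) :
    ∫ q, ‖normalize (apply Ψ₁ q.1) - normalize (apply Ψ₂ q.1)‖ ∂(viewLaw σ d)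
      ≤ 2 * (‖Ψ₁ - Ψ₂‖ / √(‖Ψ₂‖ ^ 2 - 2 * opNorm Ψ₂ ^ 2)) := by
  set r := √(1 + σ ^ 2) with hr
  have hr0 : 0 < r := Real.sqrt_pos.2 (by positivity)
  have hfst := measurePreserving_view_fst (d := d) σ
  rw [← hr] at hfst
  set D := ‖Ψ₂‖ ^ 2 - 2 * opNorm Ψ₂ ^ 2 with hD
  have hD0 : 0 < D := by linarith
  have hl := lintegral_inv_norm_apply_sq_le hfst hr0 Ψ₂ hΨ
  rw [← hD] at hl
  have hmeas : Measurable fun q : EuclideanSpace ℝ (Fin d) × EuclideanSpace ℝ (Fin d) =>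
      ‖apply Ψ₂ q.1‖ := ((measurable_apply Ψ₂).comp measurable_fst).norm
  -- A finite inverse moment forces `Ψ₂ x ≠ 0` almost surely.
  have hne : ∀ᵐ q ∂(viewLaw σ d), apply Ψ₂ q.1 ≠ 0 := by
    filter_upwards [ae_lt_top (hmeas.pow_const 2).ennreal_ofReal.inv
      (hl.trans_lt ENNReal.ofReal_lt_top).ne] with q hq h0
    simp [h0] at hq
  have hle : ∫⁻ q, ENNReal.ofReal (‖apply Ψ₂ q.1‖⁻¹ ^ 2) ∂(viewLaw σ d)
      ≤ ENNReal.ofReal (1 / (r ^ 2 * D)) := by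
    refine le_trans (lintegral_mono_ae ?_) hl
    filter_upwards [hne] with q hq
    have : 0 < ‖apply Ψ₂ q.1‖ := norm_pos_iff.2 hq
    rw [inv_pow, ENNReal.ofReal_inv_of_pos (by positivity)]
  have hint : Integrable (fun q => ‖apply Ψ₂ q.1‖⁻¹ ^ 2) (viewLaw σ d) := by
    refine ⟨(hmeas.inv.pow_const 2).aestronglyMeasurable, ?_⟩
    rw [hasFiniteIntegral_iff_ofReal (.of_forall fun q => by positivity)]
    exact hle.trans_lt ENNReal.ofReal_lt_top
  have hintle : ∫ q, ‖apply Ψ₂ q.1‖⁻¹ ^ 2 ∂(viewLaw σ d) ≤ 1 / (r ^ 2 * D) := by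
    rw [integral_eq_lintegral_of_nonneg_ae (.of_forall fun q => by positivity)
      hint.aestronglyMeasurable]
    exact ENNReal.toReal_le_of_le_ofReal (by positivity) hle
  rcases (norm_nonneg (Ψ₁ - Ψ₂)).eq_or_lt with h0 | hpos
  · have : Ψ₁ = Ψ₂ := sub_eq_zero.1 (norm_eq_zero.1 h0.symm)
    simp [this]
  have hΔ := integral_norm_apply_sq hfst (Ψ₁ - Ψ₂)
  have hΔi := integrable_norm_apply_sq hfst (Ψ₁ - Ψ₂)
  have hsD : 0 < √D := Real.sqrt_pos.2 hD0
  -- This weight makes both terms of the arithmetic-geometric bound equal to `‖Ψ₁ - Ψ₂‖ / √D`; the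
  -- scale `r` drops out. It requires `Ψ₁ ≠ Ψ₂`, hence the preceding case split.
  set k := 1 / (r ^ 2 * ‖Ψ₁ - Ψ₂‖ * √D) with hk
  have hk0 : 0 < k := by positivity
  calc _ ≤ ∫ q, (k * ‖apply (Ψ₁ - Ψ₂) q.1‖ ^ 2 + k⁻¹ * ‖apply Ψ₂ q.1‖⁻¹ ^ 2) ∂(viewLaw σ d) := by
        refine integral_mono_of_nonneg (.of_forall fun q => norm_nonneg _)
          ((hΔi.const_mul k).add (hint.const_mul k⁻¹)) ?_
        filter_upwards [hne] with q hq
        refine (norm_normalize_sub_normalize_le _ hq).trans ?_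
        rw [← apply_sub]
        set x := ‖apply (Ψ₁ - Ψ₂) q.1‖
        set y := ‖apply Ψ₂ q.1‖⁻¹
        have e : k * x ^ 2 + k⁻¹ * y ^ 2 - 2 * (x * y) = k⁻¹ * (k * x - y) ^ 2 := by
          field_simp
          ring
        have : 0 ≤ k⁻¹ * (k * x - y) ^ 2 := by positivity
        linarith
    _ ≤ k * (r ^ 2 * ‖Ψ₁ - Ψ₂‖ ^ 2) + k⁻¹ * (1 / (r ^ 2 * D)) := by
        rw [integral_add (hΔi.const_mul k) (hint.const_mul k⁻¹), integral_const_mul,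
          integral_const_mul, hΔ]
        gcongr
    _ = _ := by
        have hDD : D = √D ^ 2 := (Real.sq_sqrt hD0.le).symm
        rw [hk]
        generalize √D = u at *
        rw [hDD]
        field_simp
        ring

theorem abs_cosLoss_sub_le {σ : ℝ} (Φsg Φ₁ Φ₂ : Matrix (Fin h) (Fin d) ℝ)
    (W₁ W₂ : Matrix (Fin h) (Fin h) ℝ) (hΨ : 2 * opNorm (W₂ * Φ₂) ^ 2 < ‖W₂ * Φ₂‖ ^ 2) :
    |cosLoss σ Φsg Φ₁ W₁ - cosLoss σ Φsg Φ₂ W₂|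
      ≤ 2 * (‖W₁ * Φ₁ - W₂ * Φ₂‖ / √(‖W₂ * Φ₂‖ ^ 2 - 2 * opNorm (W₂ * Φ₂) ^ 2)) := by
  have hm : ∀ A : Matrix (Fin h) (Fin d) ℝ, Measurable
      fun q : EuclideanSpace ℝ (Fin d) × EuclideanSpace ℝ (Fin d) => normalize (apply A q.1) :=
    fun A => (measurable_normalize_apply A).comp measurable_fst
  have hm' : Measurable fun q : EuclideanSpace ℝ (Fin d) × EuclideanSpace ℝ (Fin d) =>
      normalize (apply Φsg q.2) := (measurable_normalize_apply Φsg).comp measurable_snd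
  have hi : ∀ A : Matrix (Fin h) (Fin d) ℝ, Integrable (fun q =>
      inner ℝ (normalize (apply A q.1)) (normalize (apply Φsg q.2))) (viewLaw σ d) := fun A =>
    Integrable.of_bound ((hm A).inner hm').aestronglyMeasurable 1
      (.of_forall fun q => abs_inner_normalize_le_one _ _)
  refine le_trans ?_ (integral_norm_normalize_sub_le σ (W₁ * Φ₁) hΨ)
  rw [cosLoss_eq, cosLoss_eq, neg_sub_neg, ← integral_sub (hi _) (hi _)]
  refine abs_integral_le_integral_abs.trans ?_
  refine integral_mono_of_nonneg (.of_forall fun q => abs_nonneg _) ?_ (.of_forall fun q => ?_)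
  · refine Integrable.of_bound ((hm _).sub (hm _)).norm.aestronglyMeasurable 2
      (.of_forall fun q => ?_)
    rw [norm_norm]
    refine (norm_sub_le _ _).trans ?_
    linarith [norm_normalize_le_one (apply (W₁ * Φ₁) q.1),
      norm_normalize_le_one (apply (W₂ * Φ₂) q.1)]
  · simp only
    rw [← inner_sub_left]
    refine (abs_real_inner_le_norm _ _).trans ?_
    rw [norm_sub_rev]
    exact mul_le_of_le_one_right (norm_nonneg _) (norm_normalize_le_one _)

end Loss

section Gradient

variable {m n : ℕ}

theorem frobeniusInner_apply (A B : Matrix (Fin m) (Fin n) ℝ) :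
    frobeniusInner A B = ∑ i, ∑ j, A i j * B i j := rfl

theorem frobeniusInner_self (A : Matrix (Fin m) (Fin n) ℝ) : frobeniusInner A A = ‖A‖ ^ 2 := by
  rw [frobeniusInner_apply, frobenius_norm_sq]
  simp [sq]

theorem frobeniusInner_sub_left (A B C : Matrix (Fin m) (Fin n) ℝ) :
    frobeniusInner (A - B) C = frobeniusInner A C - frobeniusInner B C := by
  simp [frobeniusInner_apply, sub_mul, Finset.sum_sub_distrib]

theorem frobeniusInner_smul_left (c : ℝ) (A B : Matrix (Fin m) (Fin n) ℝ) :
    frobeniusInner (c • A) B = c * frobeniusInner A B := by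
  simp [frobeniusInner_apply, Finset.mul_sum, mul_assoc]

theorem norm_add_sq_frobenius (A B : Matrix (Fin m) (Fin n) ℝ) :
    ‖A + B‖ ^ 2 = ‖A‖ ^ 2 + 2 * frobeniusInner A B + ‖B‖ ^ 2 := by
  simp only [frobenius_norm_sq, frobeniusInner_apply, Finset.mul_sum, ← Finset.sum_add_distrib]
  exact Finset.sum_congr rfl fun i _ => Finset.sum_congr rfl fun j _ => by
    rw [Matrix.add_apply]; ring

theorem hasDerivAt_norm_sq_line (A B : Matrix (Fin m) (Fin n) ℝ) :
    HasDerivAt (fun t : ℝ => ‖A + t • B‖ ^ 2) (2 * frobeniusInner A B) 0 := by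
  have h : ∀ t : ℝ, ‖A + t • B‖ ^ 2 = ‖A‖ ^ 2 + 2 * frobeniusInner A B * t + ‖B‖ ^ 2 * t ^ 2 := by
    intro t
    rw [norm_add_sq_frobenius, map_smul, norm_smul, mul_pow, Real.norm_eq_abs, sq_abs, smul_eq_mul]
    ring
  simp_rw [h]
  have h1 := (((hasDerivAt_id (0 : ℝ)).const_mul (2 * frobeniusInner A B)).const_add
    (‖A‖ ^ 2)).add ((hasDerivAt_pow 2 (0 : ℝ)).const_mul (‖B‖ ^ 2))
  refine (h1.congr_of_eventuallyEq (.of_forall fun t => rfl)).congr_deriv ?_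
  simp

/-- Differentiate `f` along its own gradient direction `B = G - ρ • A`: the derivative is `‖B‖ ^ 2`,
and the Lipschitz bound at `A` makes it at most `L * ‖B‖`. The constant `c` stands for the squared
norm of the other parameter. -/
theorem HasMatrixGradientAt.norm_sub_le_of_weight_decay {f : Matrix (Fin m) (Fin n) ℝ → ℝ}
    {G A : Matrix (Fin m) (Fin n) ℝ} {ρ c L : ℝ}
    (hf : HasMatrixGradientAt (fun B => f B + ρ / 2 * (‖B‖ ^ 2 + c)) G A) (hL : 0 ≤ L)
    (hlip : ∀ B, |f B - f A| ≤ L * ‖B - A‖) : ‖G - ρ • A‖ ≤ L := by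
  set B := G - ρ • A with hB
  have h1 : HasDerivAt (fun t : ℝ => f (A + t • B) + ρ / 2 * (‖A + t • B‖ ^ 2 + c))
      (frobeniusInner G B) 0 := HasFDerivAt.hasLineDerivAt hf B
  have h2 := ((hasDerivAt_norm_sq_line A B).add_const c).const_mul (ρ / 2)
  have h3 : HasDerivAt (fun t : ℝ => f (A + t • B)) (‖B‖ ^ 2) 0 := by
    refine ((h1.sub h2).congr_of_eventuallyEq (.of_forall fun t => ?_)).congr_deriv ?_
    · simp
    · have : frobeniusInner B B = frobeniusInner G B - ρ * frobeniusInner A B := by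
        conv_lhs => rw [hB, frobeniusInner_sub_left, frobeniusInner_smul_left, ← hB]
      rw [← frobeniusInner_self, this]
      ring
  have h4 := h3.le_of_lip' (C := L * ‖B‖) (by positivity) (.of_forall fun t => by
    have := hlip (A + t • B)
    rw [add_sub_cancel_left, norm_smul] at this
    simpa [mul_assoc, mul_comm, mul_left_comm] using this)
  rw [Real.norm_eq_abs, abs_of_nonneg (sq_nonneg _)] at h4
  rcases (norm_nonneg B).eq_or_lt with h | h
  · linarith
  · nlinarith

/-- From `2 * y ≤ x`, the radicand is at least `x ^ 2 / 2`, which exceeds `(2 / 3 * x) ^ 2`. -/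
theorem div_sqrt_sub_le {x y c : ℝ} (hx : 0 < x) (hy : 0 ≤ y) (hxy : 2 * y ≤ x) (hc : 0 ≤ c) :
    2 * (c / √(x ^ 2 - 2 * y ^ 2)) ≤ 3 * c / x := by
  have h1 : (2 / 3 * x) ^ 2 ≤ x ^ 2 - 2 * y ^ 2 := by nlinarith
  have h2 : 2 / 3 * x ≤ √(x ^ 2 - 2 * y ^ 2) := Real.le_sqrt_of_sq_le h1
  calc 2 * (c / √(x ^ 2 - 2 * y ^ 2)) ≤ 2 * (c / (2 / 3 * x)) := by gcongr
    _ = _ := by field_simp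

variable {d h : ℕ} {σ ρ : ℝ} {Φ : Matrix (Fin h) (Fin d) ℝ} {W : Matrix (Fin h) (Fin h) ℝ}

/-- The mixed inequality `‖W * B‖ ≤ opNorm W * ‖B‖` puts a spectral norm in the numerator against a
Frobenius norm in the denominator; this ratio is what makes the training drift small. -/
theorem norm_gradient_encoder_sub_le {G : Matrix (Fin h) (Fin d) ℝ}
    (hG : HasMatrixGradientAt (fun Θ => objective σ ρ Φ Θ W) G Φ) (hΨ0 : 0 < ‖W * Φ‖)
    (hΨ : 2 * opNorm (W * Φ) ≤ ‖W * Φ‖) :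
    ‖G - ρ • Φ‖ ≤ 3 * opNorm W / ‖W * Φ‖ := by
  have hop := opNorm_nonneg (W * Φ)
  have hD : 2 * opNorm (W * Φ) ^ 2 < ‖W * Φ‖ ^ 2 := by nlinarith
  refine HasMatrixGradientAt.norm_sub_le_of_weight_decay (f := fun Θ => cosLoss σ Φ Θ W) hG
    (div_nonneg (mul_nonneg (by norm_num) (opNorm_nonneg W)) hΨ0.le) fun B => ?_
  refine (abs_cosLoss_sub_le Φ B Φ W W hD).trans ?_
  refine (div_sqrt_sub_le hΨ0 hop hΨ (norm_nonneg _)).trans ?_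
  rw [← Matrix.mul_sub, mul_div_assoc, mul_div_assoc, mul_assoc, div_mul_eq_mul_div]
  gcongr
  exact frobenius_norm_mul_le_opNorm_mul _ _

theorem norm_gradient_predictor_sub_le {G : Matrix (Fin h) (Fin h) ℝ}
    (hG : HasMatrixGradientAt (fun V => objective σ ρ Φ Φ V) G W) (hΨ0 : 0 < ‖W * Φ‖)
    (hΨ : 2 * opNorm (W * Φ) ≤ ‖W * Φ‖) :
    ‖G - ρ • W‖ ≤ 3 * opNorm Φ / ‖W * Φ‖ := by
  have hop := opNorm_nonneg (W * Φ)
  have hD : 2 * opNorm (W * Φ) ^ 2 < ‖W * Φ‖ ^ 2 := by nlinarith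
  have hG' : HasMatrixGradientAt (fun V => cosLoss σ Φ Φ V + ρ / 2 * (‖V‖ ^ 2 + ‖Φ‖ ^ 2)) G W := by
    simpa only [objective, add_comm (‖Φ‖ ^ 2)] using hG
  refine hG'.norm_sub_le_of_weight_decay
    (div_nonneg (mul_nonneg (by norm_num) (opNorm_nonneg Φ)) hΨ0.le) fun B => ?_
  refine (abs_cosLoss_sub_le Φ Φ Φ B W hD).trans ?_
  refine (div_sqrt_sub_le hΨ0 hop hΨ (norm_nonneg _)).trans ?_
  rw [← Matrix.sub_mul, mul_div_assoc, mul_div_assoc, mul_assoc, div_mul_eq_mul_div,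
    mul_comm (opNorm Φ)]
  gcongr
  exact frobenius_norm_mul_le_mul_opNorm _ _

end Gradient

/-! ### The gradient flow stays close to its initialization -/

section Flow

/-- A barrier argument: the displacement cannot cross the line `K * s`. The rate is only needed
where the two touch, and there the displacement is at most `K * T ≤ 1`; strictness of the rate
prevents crossing. -/
theorem norm_sub_le_one_of_norm_deriv_lt {E : Type*} [NormedAddCommGroup E] [NormedSpace ℝ E]
    {f f' : ℝ → E} {T K : ℝ} (hK : 0 ≤ K) (hKT : K * T ≤ 1)
    (hf : ∀ s ∈ Set.Icc 0 T, HasDerivWithinAt f (f' s) (Set.Icc 0 T) s)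
    (hrate : ∀ s ∈ Set.Icc 0 T, ‖f s - f 0‖ ≤ 1 → ‖f' s‖ < K) :
    ∀ s ∈ Set.Icc 0 T, ‖f s - f 0‖ ≤ 1 := by
  have hle : ∀ s ∈ Set.Icc 0 T, K * s ≤ 1 := fun s hs =>
    (mul_le_mul_of_nonneg_left hs.2 hK).trans hKT
  have h := image_norm_le_of_norm_deriv_right_lt_deriv_boundary (f := fun s => f s - f 0)
    (f' := f') (a := 0) (b := T) (B := fun s => K * s) (B' := fun _ => K)
    (fun s hs => ((hf s hs).continuousWithinAt.sub continuousWithinAt_const))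
    (fun s hs => ?_) (by simp) (fun s => by simpa using (hasDerivAt_id s).const_mul K)
    (fun s hs hsB => hrate s (Set.Ico_subset_Icc_self hs)
      (hsB.le.trans (hle s (Set.Ico_subset_Icc_self hs))))
  · exact fun s hs => (h hs).trans (hle s hs)
  · exact ((hf s (Set.Ico_subset_Icc_self hs)).mono_of_mem_nhdsWithin
      (Icc_mem_nhdsGE_of_mem hs)).sub_const _

/-- The integrating factor: `f' + ρ • f` contains only the loss gradient. -/
theorem hasDerivWithinAt_exp_smul {E : Type*} [NormedAddCommGroup E] [NormedSpace ℝ E]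
    {f : ℝ → E} {f' : E} {S : Set ℝ} {s : ℝ} (ρ : ℝ) (hf : HasDerivWithinAt f f' S s) :
    HasDerivWithinAt (fun u => Real.exp (ρ * u) • f u) (Real.exp (ρ * s) • (f' + ρ • f s)) S s := by
  have h1 : HasDerivWithinAt (fun u : ℝ => Real.exp (ρ * u)) (Real.exp (ρ * s) * ρ) S s := by
    have := ((hasDerivAt_id s).const_mul ρ).exp
    simpa using this.hasDerivWithinAt
  refine (h1.smul hf).congr_deriv ?_
  rw [smul_add, smul_smul]

/-- Since each rate depends on both unknowns, the barrier is applied to the pair. The sup norm on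
the product gives the same unit bound for each component. -/
theorem exp_smul_sub_le_one {E F : Type*} [NormedAddCommGroup E] [NormedSpace ℝ E]
    [NormedAddCommGroup F] [NormedSpace ℝ F] {f : ℝ → E} {g : ℝ → F} {f' : ℝ → E} {g' : ℝ → F}
    {ρ T K : ℝ} (hK : 0 ≤ K) (hKT : K * T ≤ 1)
    (hf : ∀ s ∈ Set.Icc 0 T, HasDerivWithinAt f (f' s) (Set.Icc 0 T) s)
    (hg : ∀ s ∈ Set.Icc 0 T, HasDerivWithinAt g (g' s) (Set.Icc 0 T) s)
    (hrate : ∀ s ∈ Set.Icc 0 T, ‖Real.exp (ρ * s) • f s - f 0‖ ≤ 1 →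
      ‖Real.exp (ρ * s) • g s - g 0‖ ≤ 1 →
      Real.exp (ρ * s) * ‖f' s + ρ • f s‖ < K ∧ Real.exp (ρ * s) * ‖g' s + ρ • g s‖ < K) :
    ∀ s ∈ Set.Icc 0 T, ‖Real.exp (ρ * s) • f s - f 0‖ ≤ 1 ∧
      ‖Real.exp (ρ * s) • g s - g 0‖ ≤ 1 := by
  have h := norm_sub_le_one_of_norm_deriv_lt (E := E × F)
    (f := fun s => (Real.exp (ρ * s) • f s, Real.exp (ρ * s) • g s))
    (f' := fun s => (Real.exp (ρ * s) • (f' s + ρ • f s), Real.exp (ρ * s) • (g' s + ρ • g s)))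
    hK hKT
    (fun s hs => (hasDerivWithinAt_exp_smul ρ (hf s hs)).prodMk
      (hasDerivWithinAt_exp_smul ρ (hg s hs)))
    (fun s hs hle => ?_)
  · intro s hs
    have := h s hs
    simpa [Prod.norm_def] using this
  · have hle' : ‖Real.exp (ρ * s) • f s - f 0‖ ≤ 1 ∧ ‖Real.exp (ρ * s) • g s - g 0‖ ≤ 1 := by
      simpa [Prod.norm_def] using hle
    have := hrate s hs hle'.1 hle'.2
    simpa [Prod.norm_def, norm_smul, -smul_add] using this

variable {d h : ℕ}

/-- Norm bounds at a point whose displacement from the initial point is at most `1`. -/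
theorem norm_bounds_of_displacement_le_one {Φ₀ Φ : Matrix (Fin h) (Fin d) ℝ}
    {W₀ W : Matrix (Fin h) (Fin h) ℝ} {a b : ℝ} (ha : 1 ≤ a) (hab : 11 * a ≤ b)
    (hΦ₀ : opNorm Φ₀ ≤ a) (hW₀ : opNorm W₀ ≤ a) (hΨ₀ : opNorm (W₀ * Φ₀) ≤ a)
    (hb : b ≤ ‖W₀ * Φ₀‖) (hΦ : ‖Φ - Φ₀‖ ≤ 1) (hW : ‖W - W₀‖ ≤ 1) :
    opNorm Φ ≤ 2 * a ∧ opNorm W ≤ 2 * a ∧ opNorm (W * Φ) ≤ 4 * a ∧ b / 2 ≤ ‖W * Φ‖ ∧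
      8 * a ≤ ‖W * Φ‖ := by
  have h1 : opNorm Φ ≤ 2 * a := by
    have e1 := opNorm_add_le Φ₀ (Φ - Φ₀)
    have e2 := opNorm_le_frobenius (Φ - Φ₀)
    rw [add_sub_cancel] at e1
    linarith
  have h2 : opNorm W ≤ 2 * a := by
    have e1 := opNorm_add_le W₀ (W - W₀)
    have e2 := opNorm_le_frobenius (W - W₀)
    rw [add_sub_cancel] at e1
    linarith
  have h3 : ‖W * Φ - W₀ * Φ₀‖ ≤ 3 * a := by
    have e : W * Φ - W₀ * Φ₀ = W * (Φ - Φ₀) + (W - W₀) * Φ₀ := by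
      rw [Matrix.mul_sub, Matrix.sub_mul]
      abel
    rw [e]
    refine (norm_add_le _ _).trans ?_
    have e1 := frobenius_norm_mul_le_opNorm_mul W (Φ - Φ₀)
    have e2 := frobenius_norm_mul_le_mul_opNorm (W - W₀) Φ₀
    have e3 : opNorm W * ‖Φ - Φ₀‖ ≤ 2 * a * 1 := by gcongr
    have e4 : ‖W - W₀‖ * opNorm Φ₀ ≤ 1 * a := by
      gcongr
      exact opNorm_nonneg _
    linarith
  have h4 : opNorm (W * Φ) ≤ 4 * a := by
    have e1 := opNorm_add_le (W₀ * Φ₀) (W * Φ - W₀ * Φ₀)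
    have e2 := opNorm_le_frobenius (W * Φ - W₀ * Φ₀)
    rw [add_sub_cancel] at e1
    linarith
  have h5 : b - 3 * a ≤ ‖W * Φ‖ := by
    have e1 := norm_sub_norm_le (W₀ * Φ₀) (W * Φ)
    rw [norm_sub_rev] at e1
    linarith
  -- `11 * a ≤ b` leaves `b - 3 * a ≥ 8 * a`, twice the spectral bound `4 * a`, which is the margin
  -- required by the gradient bounds.
  exact ⟨h1, h2, h4, by linarith, by linarith⟩

theorem exp_smul_mul_exp_smul (c : ℝ) (W : Matrix (Fin h) (Fin h) ℝ)
    (Φ : Matrix (Fin h) (Fin d) ℝ) :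
    (Real.exp c • W) * (Real.exp c • Φ) = Real.exp (2 * c) • (W * Φ) := by
  rw [Matrix.smul_mul, Matrix.mul_smul, smul_smul, ← Real.exp_add, two_mul]

theorem opNorm_exp_smul {m n : ℕ} (c : ℝ) (A : Matrix (Fin m) (Fin n) ℝ) :
    opNorm (Real.exp c • A) = Real.exp c * opNorm A := by
  rw [opNorm_smul, abs_of_pos (Real.exp_pos _)]

theorem norm_exp_smul {m n : ℕ} (c : ℝ) (A : Matrix (Fin m) (Fin n) ℝ) :
    ‖Real.exp c • A‖ = Real.exp c * ‖A‖ := by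
  rw [norm_smul, Real.norm_eq_abs, abs_of_pos (Real.exp_pos _)]

theorem IsSymmGradientFlow.displacement_le_one {σ ρ T : ℝ} {Φ : ℝ → Matrix (Fin h) (Fin d) ℝ}
    {W : ℝ → Matrix (Fin h) (Fin h) ℝ} (hflow : IsSymmGradientFlow σ ρ T Φ W) (hρ : 0 ≤ ρ)
    {a b : ℝ} (ha : 1 ≤ a) (hab : 11 * a ≤ b)
    (hT : 13 * Real.exp (2 * (ρ * T)) * a / b * T ≤ 1)
    (hΦ₀ : opNorm (Φ 0) ≤ a) (hW₀ : opNorm (W 0) ≤ a) (hΨ₀ : opNorm (W 0 * Φ 0) ≤ a)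
    (hb : b ≤ ‖W 0 * Φ 0‖) :
    ∀ s ∈ Set.Icc 0 T, ‖Real.exp (ρ * s) • Φ s - Φ 0‖ ≤ 1 ∧
      ‖Real.exp (ρ * s) • W s - W 0‖ ≤ 1 := by
  have hb0 : 0 < b := by linarith
  choose! G hG hG' using hflow.flow_Φ
  choose! V hV hV' using hflow.flow_W
  refine exp_smul_sub_le_one (f' := fun s => -G s) (g' := fun s => -((1 / 2 : ℝ) • (V s + (V s)ᵀ)))
    (K := 13 * Real.exp (2 * (ρ * T)) * a / b) (by positivity) hT hG' hV' fun s hs h1 h2 => ?_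
  obtain ⟨k1, k2, k3, k4, k5⟩ := norm_bounds_of_displacement_le_one ha hab hΦ₀ hW₀ hΨ₀ hb h1 h2
  rw [exp_smul_mul_exp_smul] at k3 k4 k5
  rw [opNorm_exp_smul] at k1 k2 k3
  rw [norm_exp_smul] at k4 k5
  set e := Real.exp (ρ * s) with he
  have he0 : 0 < e := Real.exp_pos _
  have he2 : Real.exp (2 * (ρ * s)) = e * e := by rw [two_mul, Real.exp_add]
  rw [he2] at k3 k4 k5
  have hee : e * e ≤ Real.exp (2 * (ρ * T)) := by
    rw [← he2]
    gcongr
    exact hs.2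
  have hΨpos : 0 < ‖W s * Φ s‖ := by
    by_contra! hcon
    have : ‖W s * Φ s‖ = 0 := le_antisymm hcon (norm_nonneg _)
    rw [this, mul_zero] at k5
    linarith
  -- The ratio of norms is unaffected by the exponential factor, so it passes from the rescaled
  -- matrices to the actual ones.
  have hratio : 2 * opNorm (W s * Φ s) ≤ ‖W s * Φ s‖ := by
    have : e * e * (2 * opNorm (W s * Φ s)) ≤ e * e * ‖W s * Φ s‖ := by linarith
    exact le_of_mul_le_mul_left this (by positivity)
  have g1 := norm_gradient_encoder_sub_le (hG s hs) hΨpos hratio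
  have g2 := norm_gradient_predictor_sub_le (hV s hs) hΨpos hratio
  -- The estimates give the constant `3 * 2 * 2 = 12`; taking `13` yields the strict inequality
  -- needed by the barrier.
  have hbound : ∀ c : ℝ, e * c ≤ 2 * a →
      e * (3 * c / ‖W s * Φ s‖) < 13 * Real.exp (2 * (ρ * T)) * a / b := by
    intro c hc
    rw [mul_div_assoc', div_lt_div_iff₀ hΨpos hb0]
    have q1 : b ≤ 2 * (Real.exp (2 * (ρ * T)) * ‖W s * Φ s‖) := by
      have : e * e * ‖W s * Φ s‖ ≤ Real.exp (2 * (ρ * T)) * ‖W s * Φ s‖ := by gcongr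
      linarith
    have q2 : 0 < Real.exp (2 * (ρ * T)) * ‖W s * Φ s‖ := by positivity
    calc e * (3 * c) * b = 3 * (e * c) * b := by ring
      _ ≤ 3 * (2 * a) * b := by gcongr
      _ ≤ 3 * (2 * a) * (2 * (Real.exp (2 * (ρ * T)) * ‖W s * Φ s‖)) := by gcongr
      _ < _ := by nlinarith
  constructor
  · refine lt_of_le_of_lt ?_ (hbound _ k2)
    gcongr
    rwa [neg_add_eq_sub, norm_sub_rev]
  · refine lt_of_le_of_lt ?_ (hbound _ k1)
    gcongr
    refine le_trans ?_ g2
    have hsymm : (W s)ᵀ = W s := hflow.symm s hs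
    -- As `W` is symmetric, the decay term can be moved inside the symmetrization, which does not
    -- increase the norm.
    have : -((1 / 2 : ℝ) • (V s + (V s)ᵀ)) + ρ • W s
        = -((1 / 2 : ℝ) • ((V s - ρ • W s) + (V s - ρ • W s)ᵀ)) := by
      rw [Matrix.transpose_sub, Matrix.transpose_smul, hsymm]
      module
    rw [this, norm_neg]
    exact norm_symmetrize_le _

theorem IsSymmGradientFlow.ratio_le {σ ρ T : ℝ} {Φ : ℝ → Matrix (Fin h) (Fin d) ℝ}
    {W : ℝ → Matrix (Fin h) (Fin h) ℝ} (hflow : IsSymmGradientFlow σ ρ T Φ W) (hρ : 0 ≤ ρ)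
    (hT0 : 0 ≤ T) {a b : ℝ} (ha : 1 ≤ a) (hab : 11 * a ≤ b)
    (hT : 13 * Real.exp (2 * (ρ * T)) * a / b * T ≤ 1)
    (hΦ₀ : opNorm (Φ 0) ≤ a) (hW₀ : opNorm (W 0) ≤ a) (hΨ₀ : opNorm (W 0 * Φ 0) ≤ a)
    (hb : b ≤ ‖W 0 * Φ 0‖) (hb' : b ≤ ‖Φ 0‖) :
    0 < ‖Φ T‖ ∧ 0 < ‖W T * Φ T‖ ∧ opNorm (Φ T) / ‖Φ T‖ ≤ 8 * a / b ∧
      opNorm (W T * Φ T) / ‖W T * Φ T‖ ≤ 8 * a / b := by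
  have hb0 : 0 < b := by linarith
  obtain ⟨h1, h2⟩ := hflow.displacement_le_one hρ ha hab hT hΦ₀ hW₀ hΨ₀ hb T ⟨hT0, le_rfl⟩
  obtain ⟨k1, -, k3, k4, -⟩ := norm_bounds_of_displacement_le_one ha hab hΦ₀ hW₀ hΨ₀ hb h1 h2
  have k5 : b / 2 ≤ ‖Real.exp (ρ * T) • Φ T‖ := by
    have e1 := norm_sub_norm_le (Φ 0) (Real.exp (ρ * T) • Φ T)
    rw [norm_sub_rev] at e1
    linarith
  rw [exp_smul_mul_exp_smul] at k3 k4
  rw [opNorm_exp_smul] at k1 k3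
  rw [norm_exp_smul] at k4 k5
  have e1 := Real.exp_pos (ρ * T)
  have e2 := Real.exp_pos (2 * (ρ * T))
  have p1 : 0 < ‖Φ T‖ := by
    by_contra! hcon
    nlinarith
  have p2 : 0 < ‖W T * Φ T‖ := by
    by_contra! hcon
    nlinarith
  have key : ∀ {c x y : ℝ}, 0 < c → 0 < y → 0 ≤ x → c * x ≤ 4 * a → b / 2 ≤ c * y →
      x / y ≤ 8 * a / b := by
    intro c x y hc hy hx hcx hcy
    rw [div_le_div_iff₀ hy hb0]
    refine le_of_mul_le_mul_left ?_ hc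
    nlinarith
  exact ⟨p1, p2, key e1 p1 (opNorm_nonneg _) (by linarith) k5, key e2 p2 (opNorm_nonneg _) k3 k4⟩

end Flow

/-! ### Gaussian random matrices -/

section GaussianMatrix

variable {ι : Type*} [Fintype ι] {h m : ℕ}

/-- The matrix whose `a`-th column is `r • E a *ᵥ y`. -/
noncomputable def columnMatrix (r : ℝ) (E : Fin m → Matrix (Fin h) ι ℝ) (y : EuclideanSpace ℝ ι) :
    Matrix (Fin h) (Fin m) ℝ :=
  Matrix.of fun c a => r * (E a *ᵥ y.ofLp) c

/-- Each entry of `Xᵀ A X` is a quadratic form in one Gaussian vector, so the variance estimate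
above applies to symmetric and rectangular random matrices alike. -/
theorem columnMatrix_quadratic_apply (r : ℝ) (E : Fin m → Matrix (Fin h) ι ℝ)
    (A : Matrix (Fin h) (Fin h) ℝ) (y : EuclideanSpace ℝ ι) (a b : Fin m) :
    ((columnMatrix r E y)ᵀ * (A * columnMatrix r E y)) a b
      = y.ofLp ⬝ᵥ (r ^ 2 • ((E a)ᵀ * (A * E b))) *ᵥ y.ofLp := by
  have h1 : ((columnMatrix r E y)ᵀ * (A * columnMatrix r E y)) a b
      = (r • (E a *ᵥ y.ofLp)) ⬝ᵥ A *ᵥ (r • (E b *ᵥ y.ofLp)) := rfl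
  rw [h1, Matrix.mulVec_smul, dotProduct_smul, smul_dotProduct, Matrix.smul_mulVec,
    dotProduct_smul, ← Matrix.mulVec_mulVec, ← Matrix.mulVec_mulVec,
    Matrix.dotProduct_mulVec y.ofLp, Matrix.vecMul_transpose, smul_smul, sq]

theorem measurable_columnMatrix_apply (r : ℝ) (E : Fin m → Matrix (Fin h) ι ℝ) (c : Fin h)
    (a : Fin m) : Measurable fun y : EuclideanSpace ℝ ι => columnMatrix r E y c a := by
  simp only [columnMatrix, Matrix.of_apply, Matrix.mulVec, dotProduct]
  fun_prop

/-- `E` and `F` have orthonormal rows, so their transposes are isometric embeddings. -/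
theorem norm_transpose_mul_mul_of_mul_transpose_eq_one {E F : Matrix (Fin h) ι ℝ} (hE : E * Eᵀ = 1)
    (hF : F * Fᵀ = 1) (A : Matrix (Fin h) (Fin h) ℝ) : ‖Eᵀ * (A * F)‖ ^ 2 = ‖A‖ ^ 2 := by
  rw [← trace_transpose_mul_self, ← trace_transpose_mul_self]
  have : (Eᵀ * (A * F))ᵀ * (Eᵀ * (A * F)) = Fᵀ * (Aᵀ * (A * F)) := by
    rw [Matrix.transpose_mul, Matrix.transpose_transpose, Matrix.transpose_mul]
    calc _ = Fᵀ * Aᵀ * ((E * Eᵀ) * (A * F)) := by simp only [Matrix.mul_assoc]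
      _ = _ := by rw [hE, Matrix.one_mul]; simp only [Matrix.mul_assoc]
  rw [this, Matrix.trace_mul_comm]
  congr 1
  calc _ = Aᵀ * A * (F * Fᵀ) := by simp only [Matrix.mul_assoc]
    _ = _ := by rw [hF, Matrix.mul_one]

theorem integral_quadratic_sq_le (B : Matrix ι ι ℝ) :
    ∫ y, (y.ofLp ⬝ᵥ B *ᵥ y.ofLp) ^ 2 ∂(stdGaussian (EuclideanSpace ℝ ι))
      ≤ gaussianSqVariance * ‖B‖ ^ 2 + B.trace ^ 2 := by
  have h := variance_quadratic_stdGaussian_le B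
  rw [variance_eq_sub (memLp_quadratic_stdGaussian B), integral_quadratic_stdGaussian] at h
  simp only [Pi.pow_apply] at h
  linarith

/-- The hypotheses on the column maps under which `columnMatrix` has the second-order statistics
of a matrix of independent entries. -/
structure IsColumnSystem (r : ℝ) (E : Fin m → Matrix (Fin h) ι ℝ) (A : Matrix (Fin h) (Fin h) ℝ) :
    Prop where
  mul_sq : m * r ^ 2 = 1
  mul_transpose : ∀ a, E a * (E a)ᵀ = 1
  trace_eq_zero : ∀ a b, a ≠ b → ((E a)ᵀ * (A * E b)).trace = 0

namespace IsColumnSystem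

variable {r : ℝ} {E : Fin m → Matrix (Fin h) ι ℝ} {A : Matrix (Fin h) (Fin h) ℝ}

theorem trace_self (hE : IsColumnSystem r E A) (a : Fin m) :
    ((E a)ᵀ * (A * E a)).trace = A.trace := by
  rw [Matrix.trace_mul_comm, Matrix.mul_assoc, hE.mul_transpose, Matrix.mul_one]

theorem integrable_norm_sq (r : ℝ) (E : Fin m → Matrix (Fin h) ι ℝ)
    (A : Matrix (Fin h) (Fin h) ℝ) :
    Integrable (fun y => ‖(columnMatrix r E y)ᵀ * (A * columnMatrix r E y)‖ ^ 2)
      (stdGaussian (EuclideanSpace ℝ ι)) := by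
  simp_rw [frobenius_norm_sq, columnMatrix_quadratic_apply]
  exact integrable_finsetSum _ fun a _ => integrable_finsetSum _ fun b _ =>
    (memLp_quadratic_stdGaussian _).integrable_sq

/-- There are `m ^ 2` entries, each of variance at most `gaussianSqVariance * r ^ 4 * ‖A‖ ^ 2`. Only
the `m` diagonal ones have nonzero mean, `r ^ 2 * A.trace`. Then `m * r ^ 2 = 1`. -/
theorem integral_norm_sq_le (hE : IsColumnSystem r E A) :
    ∫ y, ‖(columnMatrix r E y)ᵀ * (A * columnMatrix r E y)‖ ^ 2
        ∂(stdGaussian (EuclideanSpace ℝ ι))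
      ≤ gaussianSqVariance * ‖A‖ ^ 2 + r ^ 2 * A.trace ^ 2 := by
  simp_rw [frobenius_norm_sq (_ * _), columnMatrix_quadratic_apply]
  have hi : ∀ a b, Integrable (fun y : EuclideanSpace ℝ ι =>
      (y.ofLp ⬝ᵥ (r ^ 2 • ((E a)ᵀ * (A * E b))) *ᵥ y.ofLp) ^ 2) (stdGaussian _) := fun a b =>
    (memLp_quadratic_stdGaussian _).integrable_sq
  rw [integral_finsetSum _ fun a _ => integrable_finsetSum _ fun b _ => hi a b]
  simp_rw [integral_finsetSum _ fun b _ => hi _ b]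
  have hk := gaussianSqVariance_nonneg
  have hb : ∀ a b, ∫ y, (y.ofLp ⬝ᵥ (r ^ 2 • ((E a)ᵀ * (A * E b))) *ᵥ y.ofLp) ^ 2
      ∂(stdGaussian (EuclideanSpace ℝ ι))
      ≤ gaussianSqVariance * ‖A‖ ^ 2 * (r ^ 2) ^ 2
        + (if a = b then (r ^ 2) ^ 2 * A.trace ^ 2 else 0) := by
    intro a b
    refine (integral_quadratic_sq_le _).trans (le_of_eq ?_)
    rw [norm_smul, mul_pow, norm_transpose_mul_mul_of_mul_transpose_eq_one (hE.mul_transpose a)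
      (hE.mul_transpose b), Matrix.trace_smul, Real.norm_eq_abs, sq_abs, smul_eq_mul, mul_pow]
    split_ifs with hab
    · rw [hab, hE.trace_self]
      ring
    · rw [hE.trace_eq_zero a b hab]
      ring
  refine (Finset.sum_le_sum fun a _ => Finset.sum_le_sum fun b _ => hb a b).trans (le_of_eq ?_)
  simp only [Finset.sum_add_distrib, Finset.sum_ite_eq, Finset.mem_univ, if_true, Finset.sum_const,
    Finset.card_univ, Fintype.card_fin, nsmul_eq_mul]
  linear_combination (gaussianSqVariance * ‖A‖ ^ 2 * (m * r ^ 2 + 1) + r ^ 2 * A.trace ^ 2)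
    * hE.mul_sq

theorem trace_eq (r : ℝ) (E : Fin m → Matrix (Fin h) ι ℝ) (A : Matrix (Fin h) (Fin h) ℝ)
    (y : EuclideanSpace ℝ ι) :
    ((columnMatrix r E y)ᵀ * (A * columnMatrix r E y)).trace
      = y.ofLp ⬝ᵥ (∑ a, r ^ 2 • ((E a)ᵀ * (A * E a))) *ᵥ y.ofLp := by
  rw [Matrix.trace, Matrix.sum_mulVec, dotProduct_sum]
  exact Finset.sum_congr rfl fun a _ => columnMatrix_quadratic_apply r E A y a a

theorem trace_sum (hE : IsColumnSystem r E A) :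
    (∑ a, r ^ 2 • ((E a)ᵀ * (A * E a))).trace = A.trace := by
  rw [Matrix.trace_sum]
  simp_rw [Matrix.trace_smul, hE.trace_self]
  simp only [smul_eq_mul, Finset.sum_const, Finset.card_univ, Fintype.card_fin, nsmul_eq_mul]
  linear_combination A.trace * hE.mul_sq

theorem norm_sum_quadratic_le (hE : IsColumnSystem r E A) :
    ‖∑ a, r ^ 2 • ((E a)ᵀ * (A * E a))‖ ≤ ‖A‖ := by
  refine (norm_sum_le _ _).trans ?_
  have : ∀ a, ‖r ^ 2 • ((E a)ᵀ * (A * E a))‖ = r ^ 2 * ‖A‖ := by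
    intro a
    rw [norm_smul, Real.norm_eq_abs, abs_of_nonneg (sq_nonneg r)]
    congr 1
    exact (sq_eq_sq₀ (norm_nonneg _) (norm_nonneg _)).1
      (norm_transpose_mul_mul_of_mul_transpose_eq_one (hE.mul_transpose a) (hE.mul_transpose a) A)
  simp_rw [this]
  simp only [Finset.sum_const, Finset.card_univ, Fintype.card_fin, nsmul_eq_mul]
  exact le_of_eq (by linear_combination ‖A‖ * hE.mul_sq)

theorem integrable_trace_sub_sq (r : ℝ) (E : Fin m → Matrix (Fin h) ι ℝ)
    (A : Matrix (Fin h) (Fin h) ℝ) (c : ℝ) :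
    Integrable (fun y => (((columnMatrix r E y)ᵀ * (A * columnMatrix r E y)).trace - c) ^ 2)
      (stdGaussian (EuclideanSpace ℝ ι)) := by
  simp_rw [trace_eq]
  exact ((memLp_quadratic_stdGaussian _).sub (memLp_const c)).integrable_sq

/-- The trace is one quadratic form, whose matrix has norm at most `‖A‖` by the triangle inequality
over columns; no decorrelation between columns is used. -/
theorem integral_trace_sub_sq_le (hE : IsColumnSystem r E A) :
    ∫ y, (((columnMatrix r E y)ᵀ * (A * columnMatrix r E y)).trace - A.trace) ^ 2
      ∂(stdGaussian (EuclideanSpace ℝ ι)) ≤ gaussianSqVariance * ‖A‖ ^ 2 := by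
  simp_rw [trace_eq]
  rw [← hE.trace_sum]
  refine (integral_quadratic_sub_trace_sq_le _).trans ?_
  have hk := gaussianSqVariance_nonneg
  gcongr
  exact hE.norm_sum_quadratic_le

end IsColumnSystem

theorem measure_ge_le_ofReal_div {α : Type*} [MeasurableSpace α] {P : Measure α} [IsFiniteMeasure P]
    {f : α → ℝ} (hf : Integrable f P) (hf0 : ∀ a, 0 ≤ f a) {s C : ℝ} (hs : 0 < s)
    (hC : ∫ a, f a ∂P ≤ C) : P {a | s ≤ f a} ≤ ENNReal.ofReal (C / s) := by
  have h := mul_meas_ge_le_integral_of_nonneg (.of_forall hf0) hf s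
  rw [← ENNReal.ofReal_toReal (measure_ne_top P {a | s ≤ f a})]
  refine ENNReal.ofReal_le_ofReal ?_
  rw [le_div_iff₀ hs, mul_comm]
  exact h.trans hC

theorem IsColumnSystem.measure_norm_sq_ge_le {r : ℝ} {E : Fin m → Matrix (Fin h) ι ℝ}
    {A : Matrix (Fin h) (Fin h) ℝ} (hE : IsColumnSystem r E A) {s : ℝ} (hs : 0 < s) :
    stdGaussian (EuclideanSpace ℝ ι)
        {y | s ≤ ‖(columnMatrix r E y)ᵀ * (A * columnMatrix r E y)‖ ^ 2}
      ≤ ENNReal.ofReal ((gaussianSqVariance * ‖A‖ ^ 2 + r ^ 2 * A.trace ^ 2) / s) :=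
  measure_ge_le_ofReal_div (integrable_norm_sq r E A) (fun _ => sq_nonneg _) hs
    hE.integral_norm_sq_le

theorem IsColumnSystem.measure_trace_le_le {r : ℝ} {E : Fin m → Matrix (Fin h) ι ℝ}
    {A : Matrix (Fin h) (Fin h) ℝ} (hE : IsColumnSystem r E A) {s : ℝ} (hs : 0 < s) :
    stdGaussian (EuclideanSpace ℝ ι)
        {y | ((columnMatrix r E y)ᵀ * (A * columnMatrix r E y)).trace ≤ A.trace - s}
      ≤ ENNReal.ofReal (gaussianSqVariance * ‖A‖ ^ 2 / s ^ 2) := by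
  refine (measure_mono fun y hy => ?_).trans (measure_ge_le_ofReal_div
    (integrable_trace_sub_sq r E A A.trace) (fun _ => sq_nonneg _) (by positivity : 0 < s ^ 2)
    hE.integral_trace_sub_sq_le)
  have hy : ((columnMatrix r E y)ᵀ * (A * columnMatrix r E y)).trace ≤ A.trace - s := hy
  change s ^ 2 ≤ _
  nlinarith

end GaussianMatrix

/-! ### The random initialization -/

section Incidence

variable {ι : Type*} [Fintype ι] [DecidableEq ι] {h m : ℕ}

/-- The column maps for which `columnMatrix r (incidence f) y` has the entries `r * y (f c a)`. -/
def incidence (f : Fin h → Fin m → ι) (a : Fin m) : Matrix (Fin h) ι ℝ :=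
  Matrix.of fun c p => if p = f c a then 1 else 0

theorem columnMatrix_incidence_apply (r : ℝ) (f : Fin h → Fin m → ι) (y : EuclideanSpace ℝ ι)
    (c : Fin h) (a : Fin m) : columnMatrix r (incidence f) y c a = r * y (f c a) := by
  simp [columnMatrix, incidence, Matrix.mulVec, dotProduct]

/-- Within a column the variables are distinct, so the rows of the incidence matrix are orthonormal.
A variable shared by two columns could correlate them, but `hA` says that `A` vanishes at such
positions. -/
theorem isColumnSystem_incidence {r : ℝ} {f : Fin h → Fin m → ι} {A : Matrix (Fin h) (Fin h) ℝ}
    (hr : m * r ^ 2 = 1) (hf : ∀ a, Function.Injective fun c => f c a)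
    (hA : ∀ a b c c', a ≠ b → f c a = f c' b → A c c' = 0) :
    IsColumnSystem r (incidence f) A where
  mul_sq := hr
  mul_transpose a := by
    ext c c'
    simp only [incidence, Matrix.mul_apply, Matrix.transpose_apply, Matrix.of_apply, ite_mul,
      one_mul, zero_mul, Finset.sum_ite_eq', Finset.mem_univ, if_true, Matrix.one_apply]
    exact if_congr (hf a).eq_iff rfl rfl
  trace_eq_zero a b hab := by
    simp only [incidence, Matrix.trace, Matrix.diag_apply, Matrix.mul_apply,
      Matrix.transpose_apply, Matrix.of_apply]
    refine Finset.sum_eq_zero fun p _ => Finset.sum_eq_zero fun c _ => ?_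
    rw [Finset.mul_sum]
    refine Finset.sum_eq_zero fun c' _ => ?_
    split_ifs with h1 h2
    · rw [hA a b c c' hab (h1.symm.trans h2)]
      simp
    all_goals simp

end Incidence

/-- The index pairs of the entries on and above the diagonal. -/
abbrev UpperIndex (h : ℕ) : Type := {p : Fin h × Fin h // p.1 ≤ p.2}

/-- The entry on or above the diagonal which a symmetric matrix repeats at `(c, a)`. -/
def upperPair {h : ℕ} (c a : Fin h) : UpperIndex h := ⟨(min c a, max c a), min_le_max⟩

theorem upperPair_comm {h : ℕ} (c a : Fin h) : upperPair c a = upperPair a c := by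
  simp [upperPair, min_comm, max_comm]

theorem upperPair_of_le {h : ℕ} {c a : Fin h} (hca : c ≤ a) : upperPair c a = ⟨(c, a), hca⟩ := by
  simp [upperPair, hca]

theorem upperPair_left_injective {h : ℕ} (a : Fin h) :
    Function.Injective fun c => upperPair c a := by
  intro c c' hc
  simp only [upperPair, Subtype.mk.injEq, Prod.mk.injEq, Fin.ext_iff, Fin.coe_min, Fin.coe_max]
    at hc ⊢
  omega

theorem natCast_mul_inv_sqrt_sq {m : ℕ} (hm : 0 < m) : (m : ℝ) * (√(m : ℝ))⁻¹ ^ 2 = 1 := by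
  have : (0 : ℝ) < m := by exact_mod_cast hm
  rw [inv_pow, Real.sq_sqrt this.le, mul_inv_cancel₀ this.ne']

/-- The symmetric matrix with entries `y / √h`. -/
noncomputable def symmMatrix {h : ℕ} (y : EuclideanSpace ℝ (UpperIndex h)) :
    Matrix (Fin h) (Fin h) ℝ :=
  columnMatrix (√(h : ℝ))⁻¹ (incidence upperPair) y

/-- The matrix with entries `y / √d`. -/
noncomputable def fullMatrix {h d : ℕ} (y : EuclideanSpace ℝ (Fin h × Fin d)) :
    Matrix (Fin h) (Fin d) ℝ :=
  columnMatrix (√(d : ℝ))⁻¹ (incidence Prod.mk) y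

/-- Two columns of a symmetric matrix share one variable, located in different rows, where the
identity matrix vanishes. -/
theorem isColumnSystem_symmMatrix {h : ℕ} (hh : 0 < h) :
    IsColumnSystem (√(h : ℝ))⁻¹ (incidence (upperPair (h := h))) 1 :=
  isColumnSystem_incidence (natCast_mul_inv_sqrt_sq hh) upperPair_left_injective
    fun a b c c' hab he => Matrix.one_apply_ne fun hc => hab <| by
      rw [← hc, upperPair_comm c a, upperPair_comm c b] at he
      exact upperPair_left_injective c he

theorem isColumnSystem_fullMatrix {h d : ℕ} (hd : 0 < d) (A : Matrix (Fin h) (Fin h) ℝ) :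
    IsColumnSystem (√(d : ℝ))⁻¹ (incidence (Prod.mk : Fin h → Fin d → Fin h × Fin d)) A :=
  isColumnSystem_incidence (natCast_mul_inv_sqrt_sq hd)
    (fun _ _ _ hc => (Prod.mk.inj hc).1) fun _ _ _ _ hab he => absurd (Prod.mk.inj he).2 hab

theorem norm_one_sq (h : ℕ) : ‖(1 : Matrix (Fin h) (Fin h) ℝ)‖ ^ 2 = h := by
  rw [← trace_transpose_mul_self]
  simp

theorem measure_norm_symmMatrix_ge_le {h : ℕ} (hh : 0 < h) {s : ℝ} (hs : 0 < s) :
    stdGaussian (EuclideanSpace ℝ (UpperIndex h)) {y | s ≤ ‖(symmMatrix y)ᵀ * symmMatrix y‖ ^ 2}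
      ≤ ENNReal.ofReal ((gaussianSqVariance + 1) * h / s) := by
  have h1 := (isColumnSystem_symmMatrix hh).measure_norm_sq_ge_le hs
  simp only [Matrix.one_mul, norm_one_sq, Matrix.trace_one, Fintype.card_fin] at h1
  refine h1.trans (le_of_eq ?_)
  congr 2
  linear_combination (h : ℝ) * natCast_mul_inv_sqrt_sq hh

theorem measure_norm_symmMatrix_le_le {h : ℕ} (hh : 0 < h) {s : ℝ} (hs : 0 < s) :
    stdGaussian (EuclideanSpace ℝ (UpperIndex h)) {y | ‖symmMatrix y‖ ^ 2 ≤ h - s}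
      ≤ ENNReal.ofReal (gaussianSqVariance * h / s ^ 2) := by
  have h1 := (isColumnSystem_symmMatrix hh).measure_trace_le_le hs
  simp only [Matrix.one_mul, norm_one_sq, Matrix.trace_one, Fintype.card_fin,
    trace_transpose_mul_self] at h1
  exact h1

theorem trace_sq_le_mul_norm_sq {h : ℕ} (A : Matrix (Fin h) (Fin h) ℝ) :
    A.trace ^ 2 ≤ h * ‖A‖ ^ 2 := by
  have h1 := abs_trace_transpose_mul_le (1 : Matrix (Fin h) (Fin h) ℝ) A
  rw [Matrix.transpose_one, Matrix.one_mul] at h1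
  rw [← norm_one_sq h, ← mul_pow, ← sq_abs]
  gcongr

/-- Here `S` is a frozen value of the predictor, and the column estimate is used with `A = Sᵀ * S`.
The trace contribution carries the factor `h / d ≤ c`. -/
theorem measure_norm_mul_fullMatrix_ge_le {h d : ℕ} (hd : 0 < d) {c : ℝ} (hc : (h : ℝ) ≤ c * d)
    (S : Matrix (Fin h) (Fin h) ℝ) {s : ℝ} (hs : 0 < s) :
    stdGaussian (EuclideanSpace ℝ (Fin h × Fin d))
        {y | s ≤ ‖(S * fullMatrix y)ᵀ * (S * fullMatrix y)‖ ^ 2}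
      ≤ ENNReal.ofReal ((gaussianSqVariance + c) * ‖Sᵀ * S‖ ^ 2 / s) := by
  have h1 := (isColumnSystem_fullMatrix hd (Sᵀ * S)).measure_norm_sq_ge_le hs
  have h2 : ∀ X : Matrix (Fin h) (Fin d) ℝ, (S * X)ᵀ * (S * X) = Xᵀ * (Sᵀ * S * X) := fun X => by
    simp only [Matrix.transpose_mul, Matrix.mul_assoc]
  simp_rw [h2]
  refine h1.trans (ENNReal.ofReal_le_ofReal ?_)
  have h3 : (√(d : ℝ))⁻¹ ^ 2 * (Sᵀ * S).trace ^ 2 ≤ c * ‖Sᵀ * S‖ ^ 2 := by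
    calc _ ≤ (√(d : ℝ))⁻¹ ^ 2 * (c * d * ‖Sᵀ * S‖ ^ 2) := by
          gcongr
          exact (trace_sq_le_mul_norm_sq _).trans (by gcongr)
      _ = _ := by linear_combination c * ‖Sᵀ * S‖ ^ 2 * natCast_mul_inv_sqrt_sq hd
  gcongr
  linarith

theorem measure_norm_mul_fullMatrix_le_le {h d : ℕ} (hd : 0 < d)
    (S : Matrix (Fin h) (Fin h) ℝ) {s : ℝ} (hs : 0 < s) :
    stdGaussian (EuclideanSpace ℝ (Fin h × Fin d)) {y | ‖S * fullMatrix y‖ ^ 2 ≤ ‖S‖ ^ 2 - s}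
      ≤ ENNReal.ofReal (gaussianSqVariance * ‖Sᵀ * S‖ ^ 2 / s ^ 2) := by
  have h1 := (isColumnSystem_fullMatrix hd (Sᵀ * S)).measure_trace_le_le hs
  have h2 : ∀ X : Matrix (Fin h) (Fin d) ℝ, Xᵀ * (Sᵀ * S * X) = (S * X)ᵀ * (S * X) := fun X => by
    simp only [Matrix.transpose_mul, Matrix.mul_assoc]
  simp_rw [h2, trace_transpose_mul_self] at h1
  exact h1

/-- The bounds on an initialization with which `IsSymmGradientFlow.ratio_le` is applied. -/
structure IsWellScaled (θ : ℝ) {h d : ℕ} (Φ : Matrix (Fin h) (Fin d) ℝ)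
    (W : Matrix (Fin h) (Fin h) ℝ) : Prop where
  opNorm_Φ : opNorm Φ ^ 2 ≤ θ * h
  opNorm_W : opNorm W ^ 2 ≤ θ * h
  opNorm_Ψ : opNorm (W * Φ) ^ 2 ≤ θ * h
  norm_Φ : h / 4 ≤ ‖Φ‖ ^ 2
  norm_Ψ : h / 4 ≤ ‖W * Φ‖ ^ 2

/-- Conditioning on the first component: a bound uniform over sections passes to the product. -/
theorem measure_prod_le_of_forall {α β : Type*} [MeasurableSpace α] [MeasurableSpace β]
    (P : Measure α) (Q : Measure β) [IsProbabilityMeasure P] [SFinite Q] {T : Set (α × β)}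
    (hT : MeasurableSet T) {c : ENNReal} (hc : ∀ x, Q (Prod.mk x ⁻¹' T) ≤ c) :
    (P.prod Q) T ≤ c := by
  rw [Measure.prod_apply hT]
  exact (lintegral_mono hc).trans (by simp)

theorem measurable_frobenius_norm_sq {α : Type*} [MeasurableSpace α] {m n : ℕ}
    {f : α → Matrix (Fin m) (Fin n) ℝ} (hf : ∀ i j, Measurable fun a => f a i j) :
    Measurable fun a => ‖f a‖ ^ 2 := by
  simp_rw [frobenius_norm_sq]
  fun_prop

theorem measurable_matrix_mul_apply {α : Type*} [MeasurableSpace α] {l m n : ℕ}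
    {f : α → Matrix (Fin l) (Fin m) ℝ} {g : α → Matrix (Fin m) (Fin n) ℝ}
    (hf : ∀ i j, Measurable fun a => f a i j) (hg : ∀ i j, Measurable fun a => g a i j)
    (i : Fin l) (j : Fin n) : Measurable fun a => (f a * g a) i j := by
  simp_rw [Matrix.mul_apply]
  fun_prop

/-- Six exceptional events, each of probability at most `K / √h`: Markov bounds for the Gram
matrices of `W`, `Φ`, `W * Φ`, and Chebyshev lower bounds for their Frobenius norms. The events on
`W * Φ` include the Gram bound for `W`, so that their estimate conditionally on `W` is uniform. -/
theorem measure_not_isWellScaled_le {h d : ℕ} (hh : 0 < h) (hd : 0 < d) {c θ : ℝ}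
    (hc : (h : ℝ) ≤ c * d) (hc0 : 0 ≤ c) (hθ : 0 < θ) (hθh : 1 ≤ θ ^ 2 * √(h : ℝ)) :
    ((stdGaussian (EuclideanSpace ℝ (UpperIndex h))).prod
        (stdGaussian (EuclideanSpace ℝ (Fin h × Fin d))))
        {p | ¬ IsWellScaled θ (fullMatrix p.2) (symmMatrix p.1)}
      ≤ 6 * ENNReal.ofReal
        ((16 * gaussianSqVariance + 1 + (gaussianSqVariance + c) / θ ^ 2) / √(h : ℝ)) := by
  set P := (stdGaussian (EuclideanSpace ℝ (UpperIndex h))) with hP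
  set Q := (stdGaussian (EuclideanSpace ℝ (Fin h × Fin d))) with hQ
  set κ := gaussianSqVariance
  have hκ : 0 ≤ κ := gaussianSqVariance_nonneg
  set R := √(h : ℝ) with hR
  have hh1 : (1 : ℝ) ≤ h := by exact_mod_cast hh
  have hR1 : 1 ≤ R := Real.one_le_sqrt.2 hh1
  have hRh : R ^ 2 = h := Real.sq_sqrt (by linarith)
  set K := 16 * κ + 1 + (κ + c) / θ ^ 2 with hK
  have hK0 : 0 ≤ (κ + c) / θ ^ 2 := by positivity
  have hWm : ∀ i j, Measurable fun y : EuclideanSpace ℝ (UpperIndex h) => symmMatrix y i j :=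
    fun i j => measurable_columnMatrix_apply _ _ i j
  have hΦm : ∀ i j, Measurable fun y : EuclideanSpace ℝ (Fin h × Fin d) => fullMatrix y i j :=
    fun i j => measurable_columnMatrix_apply _ _ i j
  have hWm' : ∀ i j, Measurable fun p : EuclideanSpace ℝ (UpperIndex h) ×
      EuclideanSpace ℝ (Fin h × Fin d) => symmMatrix p.1 i j :=
    fun i j => (hWm i j).comp measurable_fst
  have hΦm' : ∀ i j, Measurable fun p : EuclideanSpace ℝ (UpperIndex h) ×
      EuclideanSpace ℝ (Fin h × Fin d) => fullMatrix p.2 i j :=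
    fun i j => (hΦm i j).comp measurable_snd
  have hGm := measurable_frobenius_norm_sq (measurable_matrix_mul_apply (fun i j => hWm' j i) hWm')
  have hΨm := measurable_matrix_mul_apply hWm' hΦm'
  have hΨGm := measurable_frobenius_norm_sq (measurable_matrix_mul_apply (fun i j => hΨm j i) hΨm)
  have hfst : ∀ T : Set (EuclideanSpace ℝ (UpperIndex h)), (P.prod Q) {p | p.1 ∈ T} = P T := by
    intro T
    have : {p : EuclideanSpace ℝ (UpperIndex h) × EuclideanSpace ℝ (Fin h × Fin d) | p.1 ∈ T}
      = T ×ˢ Set.univ := by ext; simp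
    rw [this, Measure.prod_prod, measure_univ, mul_one]
  have hsnd : ∀ T : Set (EuclideanSpace ℝ (Fin h × Fin d)), (P.prod Q) {p | p.2 ∈ T} = Q T := by
    intro T
    have : {p : EuclideanSpace ℝ (UpperIndex h) × EuclideanSpace ℝ (Fin h × Fin d) | p.2 ∈ T}
      = Set.univ ×ˢ T := by ext; simp
    rw [this, Measure.prod_prod, measure_univ, one_mul]
  -- The expected value is of order `h = R ^ 2`, so the threshold `R ^ 3` leaves probability of
  -- order `1 / R` and is still far below `h ^ 2`.
  have b1 : (P.prod Q) {p | p.1 ∈ {y | R ^ 3 ≤ ‖(symmMatrix y)ᵀ * symmMatrix y‖ ^ 2}}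
      ≤ ENNReal.ofReal (K / R) := by
    rw [hfst]
    refine (measure_norm_symmMatrix_ge_le hh (by positivity)).trans (ENNReal.ofReal_le_ofReal ?_)
    rw [← hRh]
    calc (κ + 1) * R ^ 2 / R ^ 3 = (κ + 1) / R := by field_simp
      _ ≤ K / R := by gcongr; linarith
  have b2 : (P.prod Q) {p | p.1 ∈ {y | ‖symmMatrix y‖ ^ 2 ≤ (h : ℝ) - h / 2}}
      ≤ ENNReal.ofReal (K / R) := by
    rw [hfst]
    refine (measure_norm_symmMatrix_le_le hh (by positivity)).trans (ENNReal.ofReal_le_ofReal ?_)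
    rw [← hRh]
    calc κ * R ^ 2 / (R ^ 2 / 2) ^ 2 = 4 * κ / R / R := by field_simp; ring
      _ ≤ 4 * κ / R := div_le_self (by positivity) hR1
      _ ≤ K / R := by gcongr; linarith
  have b3 : (P.prod Q) {p | p.2 ∈ {y : EuclideanSpace ℝ (Fin h × Fin d) |
      (θ * h) ^ 2 ≤ ‖(fullMatrix y)ᵀ * fullMatrix y‖ ^ 2}} ≤ ENNReal.ofReal (K / R) := by
    rw [hsnd]
    have := measure_norm_mul_fullMatrix_ge_le hd hc 1 (s := (θ * h) ^ 2) (by positivity)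
    simp only [Matrix.one_mul, Matrix.transpose_one, norm_one_sq] at this
    refine this.trans (ENNReal.ofReal_le_ofReal ?_)
    rw [← hRh]
    calc (κ + c) * R ^ 2 / (θ * R ^ 2) ^ 2 = (κ + c) / θ ^ 2 / R / R := by field_simp
      _ ≤ (κ + c) / θ ^ 2 / R := div_le_self (by positivity) hR1
      _ ≤ K / R := by gcongr; linarith
  have b4 : (P.prod Q) {p | p.2 ∈ {y : EuclideanSpace ℝ (Fin h × Fin d) |
      ‖fullMatrix y‖ ^ 2 ≤ (h : ℝ) - h / 2}} ≤ ENNReal.ofReal (K / R) := by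
    rw [hsnd]
    have := measure_norm_mul_fullMatrix_le_le hd (1 : Matrix (Fin h) (Fin h) ℝ) (s := (h : ℝ) / 2)
      (by positivity)
    simp only [Matrix.one_mul, Matrix.transpose_one, norm_one_sq] at this
    refine this.trans (ENNReal.ofReal_le_ofReal ?_)
    rw [← hRh]
    calc κ * R ^ 2 / (R ^ 2 / 2) ^ 2 = 4 * κ / R / R := by field_simp; ring
      _ ≤ 4 * κ / R := div_le_self (by positivity) hR1
      _ ≤ K / R := by gcongr; linarith
  have b5 : (P.prod Q) {p | ‖(symmMatrix p.1)ᵀ * symmMatrix p.1‖ ^ 2 < R ^ 3 ∧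
      (θ * h) ^ 2 ≤ ‖(symmMatrix p.1 * fullMatrix p.2)ᵀ * (symmMatrix p.1 * fullMatrix p.2)‖ ^ 2}
      ≤ ENNReal.ofReal (K / R) := by
    refine measure_prod_le_of_forall _ _
      ((measurableSet_lt hGm measurable_const).inter (measurableSet_le measurable_const hΨGm))
      fun y => ?_
    by_cases hy : ‖(symmMatrix y)ᵀ * symmMatrix y‖ ^ 2 < R ^ 3
    · refine (measure_mono fun z hz => hz.2).trans ((measure_norm_mul_fullMatrix_ge_le hd hc
        (symmMatrix y) (s := (θ * h) ^ 2) (by positivity)).trans (ENNReal.ofReal_le_ofReal ?_))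
      calc _ ≤ (κ + c) * R ^ 3 / (θ * h) ^ 2 := by gcongr
        _ = (κ + c) / θ ^ 2 / R := by rw [← hRh]; field_simp
        _ ≤ K / R := by gcongr; linarith
    · exact (measure_mono (t := ∅) fun z hz => (hy hz.1).elim).trans (by simp)
  have b6 : (P.prod Q) {p | ‖(symmMatrix p.1)ᵀ * symmMatrix p.1‖ ^ 2 < R ^ 3 ∧
      ‖symmMatrix p.1 * fullMatrix p.2‖ ^ 2 ≤ ‖symmMatrix p.1‖ ^ 2 - h / 4}
      ≤ ENNReal.ofReal (K / R) := by
    refine measure_prod_le_of_forall _ _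
      ((measurableSet_lt hGm measurable_const).inter (measurableSet_le
        (measurable_frobenius_norm_sq hΨm)
        ((measurable_frobenius_norm_sq hWm').sub measurable_const))) fun y => ?_
    by_cases hy : ‖(symmMatrix y)ᵀ * symmMatrix y‖ ^ 2 < R ^ 3
    · refine (measure_mono fun z hz => hz.2).trans ((measure_norm_mul_fullMatrix_le_le hd
        (symmMatrix y) (s := (h : ℝ) / 4) (by positivity)).trans (ENNReal.ofReal_le_ofReal ?_))
      calc _ ≤ κ * R ^ 3 / ((h : ℝ) / 4) ^ 2 := by gcongr
        _ = 16 * κ / R := by rw [← hRh]; field_simp; ring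
        _ ≤ K / R := by gcongr; linarith
    · exact (measure_mono (t := ∅) fun z hz => (hy hz.1).elim).trans (by simp)
  have hsix : (6 : ENNReal) * ENNReal.ofReal (K / R) = ENNReal.ofReal (K / R)
      + (ENNReal.ofReal (K / R) + (ENNReal.ofReal (K / R) + (ENNReal.ofReal (K / R)
      + (ENNReal.ofReal (K / R) + ENNReal.ofReal (K / R))))) := by ring
  rw [hsix]
  refine (measure_mono ?_).trans <| (measure_union_le _ _).trans <| add_le_add b1 <|
    (measure_union_le _ _).trans <| add_le_add b2 <| (measure_union_le _ _).trans <|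
    add_le_add b3 <| (measure_union_le _ _).trans <| add_le_add b4 <|
    (measure_union_le _ _).trans <| add_le_add b5 b6
  intro p hp
  by_contra hbad
  simp only [Set.mem_union, Set.mem_ofPred_eq, not_or, not_and, not_le] at hbad
  obtain ⟨g1, g2, g3, g4, g5, g6⟩ := hbad
  -- The threshold for the Gram matrix of `W` already implies the spectral bound demanded of `W`.
  have hθh' : R ^ 3 ≤ (θ * h) ^ 2 := by
    rw [← hRh]
    calc R ^ 3 = R ^ 3 * 1 := by ring
      _ ≤ R ^ 3 * (θ ^ 2 * R) := by gcongr
      _ = _ := by ring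
  have key : ∀ {n : ℕ} (B : Matrix (Fin h) (Fin n) ℝ), ‖Bᵀ * B‖ ^ 2 < (θ * h) ^ 2 →
      opNorm B ^ 2 ≤ θ * h := fun B hB =>
    (opNorm_sq_le B).trans (lt_of_pow_lt_pow_left₀ 2 (by positivity) hB).le
  exact hp ⟨key _ g3, key _ (g1.trans_le hθh'), key _ (g5 g1), by linarith, by
    have := g6 g1
    linarith⟩

/-- The rescaled independent entries form a standard Gaussian family; splitting it into its two
blocks carries the abstract initialization to the explicit product model. -/
theorem IsGaussianInit.measure_not_isWellScaled_le {Ω : Type*} [MeasurableSpace Ω] {μ : Measure Ω}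
    [IsProbabilityMeasure μ] {h d : ℕ} {Φ₀ : Ω → Matrix (Fin h) (Fin d) ℝ}
    {W₀ : Ω → Matrix (Fin h) (Fin h) ℝ} (hinit : IsGaussianInit μ Φ₀ W₀) (hh : 0 < h) (hd : 0 < d)
    {c θ : ℝ} (hc : (h : ℝ) ≤ c * d) (hc0 : 0 ≤ c) (hθ : 0 < θ)
    (hθh : 1 ≤ θ ^ 2 * √(h : ℝ)) :
    μ {ω | ¬ IsWellScaled θ (Φ₀ ω) (W₀ ω)} ≤ 6 * ENNReal.ofReal
        ((16 * gaussianSqVariance + 1 + (gaussianSqVariance + c) / θ ^ 2) / √(h : ℝ)) := by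
  have hsh : √(h : ℝ) ≠ 0 := (Real.sqrt_pos.2 (by exact_mod_cast hh)).ne'
  have hsd : √(d : ℝ) ≠ 0 := (Real.sqrt_pos.2 (by exact_mod_cast hd)).ne'
  set Z : (Fin h × Fin d) ⊕ UpperIndex h → Ω → ℝ := fun k ω =>
    Sum.elim (fun p => √(d : ℝ) * Φ₀ ω p.1 p.2) (fun p => √(h : ℝ) * W₀ ω p.1.1 p.1.2) k with hZ
  have hlaw : ∀ k, HasLaw (Z k) (gaussianReal 0 1) μ := by
    rintro (k | k)
    · exact hinit.law_Φ k.1 k.2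
    · exact hinit.law_W k.1.1 k.1.2
  have hZm : ∀ k, AEMeasurable (Z k) μ := fun k => (hlaw k).aemeasurable
  have hZi : iIndepFun Z μ := by
    have := hinit.indep.comp (fun k x => Sum.elim (fun _ => √(d : ℝ)) (fun _ => √(h : ℝ)) k * x)
      fun k => measurable_const_mul _
    convert this using 2 with k
    rcases k with k | k <;> rfl
  have hpi : μ.map (fun ω k => Z k ω) = Measure.pi fun _ => gaussianReal 0 1 := by
    rw [(iIndepFun_iff_map_fun_eq_pi_map hZm).1 hZi]
    congr 1
    ext1 k
    exact (hlaw k).map_eq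
  have hZm' : AEMeasurable (fun ω k => Z k ω) μ := aemeasurable_pi_lambda _ hZm
  set F : ((Fin h × Fin d) ⊕ UpperIndex h → ℝ) →
      EuclideanSpace ℝ (UpperIndex h) × EuclideanSpace ℝ (Fin h × Fin d) :=
    fun z => (WithLp.toLp 2 fun p => z (.inr p), WithLp.toLp 2 fun p => z (.inl p)) with hF
  have hFm : Measurable F := by
    refine Measurable.prodMk ?_ ?_
    all_goals exact (WithLp.measurable_toLp 2 _).comp (measurable_pi_lambda _ fun p =>
      measurable_pi_apply _)
  have hFmap : (Measure.pi fun _ => gaussianReal 0 1).map F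
      = (stdGaussian (EuclideanSpace ℝ (UpperIndex h))).prod
        (stdGaussian (EuclideanSpace ℝ (Fin h × Fin d))) := by
    have e := (measurePreserving_sumPiEquivProdPi
      (fun _ : (Fin h × Fin d) ⊕ UpperIndex h => gaussianReal 0 1)).map_eq
    rw [← map_pi_eq_stdGaussian, ← map_pi_eq_stdGaussian,
      Measure.map_prod_map _ _ (by fun_prop) (by fun_prop), ← Measure.prod_swap, ← e,
      Measure.map_map measurable_swap (MeasurableEquiv.measurable _),
      Measure.map_map (by fun_prop) (measurable_swap.comp (MeasurableEquiv.measurable _))]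
    rfl
  have hae : ∀ᵐ ω ∂μ, fullMatrix (F fun k => Z k ω).2 = Φ₀ ω ∧
      symmMatrix (F fun k => Z k ω).1 = W₀ ω := by
    filter_upwards [hinit.symm_W] with ω hω
    constructor
    · ext i j
      simp only [fullMatrix, columnMatrix_incidence_apply, hF, hZ, Sum.elim_inl]
      exact inv_mul_cancel_left₀ hsd _
    · have hle : ∀ i j, i ≤ j → symmMatrix (F fun k => Z k ω).1 i j = W₀ ω i j := by
        intro i j hij
        simp only [symmMatrix, columnMatrix_incidence_apply, hF, hZ, Sum.elim_inr,
          upperPair_of_le hij]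
        exact inv_mul_cancel_left₀ hsh _
      ext i j
      rcases le_total i j with hij | hij
      · exact hle i j hij
      · rw [← hω.apply i j, ← hle j i hij]
        simp only [symmMatrix, columnMatrix_incidence_apply, upperPair_comm i j]
  calc μ {ω | ¬ IsWellScaled θ (Φ₀ ω) (W₀ ω)}
      ≤ μ ((fun ω => F fun k => Z k ω) ⁻¹'
          {p | ¬ IsWellScaled θ (fullMatrix p.2) (symmMatrix p.1)}) := by
        refine measure_mono_ae ?_
        filter_upwards [hae] with ω hω hb
        change ¬ IsWellScaled θ (fullMatrix (F fun k => Z k ω).2)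
          (symmMatrix (F fun k => Z k ω).1)
        rw [hω.1, hω.2]
        exact hb
    _ ≤ μ.map (fun ω => F fun k => Z k ω)
          {p | ¬ IsWellScaled θ (fullMatrix p.2) (symmMatrix p.1)} :=
        -- Only this inequality is needed, and it requires no measurability of the exceptional set.
        Measure.le_map_apply (hFm.comp_aemeasurable hZm') _
    _ ≤ _ := by
        have : μ.map (fun ω => F fun k => Z k ω) = (μ.map fun ω k => Z k ω).map F :=
          (AEMeasurable.map_map_of_aemeasurable hFm.aemeasurable hZm').symm
        rw [this, hpi, hFmap]
        exact SimSiam.measure_not_isWellScaled_le hh hd hc hc0 hθ hθh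

/-- The scales are `a = q √h` and `b = √h / 2`. Then `11 * a ≤ b` reads `22 * q ≤ 1`, the drift
constant becomes `26 * q`, and each ratio at time `T` is at most `8 * a / b = 16 * q`, whence `32 *
q` in total. -/
theorem IsSymmGradientFlow.nuclearNorm_sub_le {h d : ℕ} {σ ρ T : ℝ}
    {Φ : ℝ → Matrix (Fin h) (Fin d) ℝ} {W : ℝ → Matrix (Fin h) (Fin h) ℝ}
    (hflow : IsSymmGradientFlow σ ρ T Φ W) (hρ : 0 ≤ ρ) (hT0 : 0 ≤ T) {q : ℝ} (hq : 0 < q)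
    (hq1 : 22 * q ≤ 1) (hqT : 26 * Real.exp (2 * (ρ * T)) * q * T ≤ 1)
    (hqh : 1 ≤ q * √(h : ℝ)) (hgood : IsWellScaled (q ^ 2) (Φ 0) (W 0)) :
    nuclearNorm (featureExpectation σ (Φ T) (W T) - closedForm σ (Φ T) (W T))
      ≤ closedFormConst * (32 * q) := by
  set R := √(h : ℝ) with hR
  have hR0 : 0 < R := by
    by_contra hn
    have : R = 0 := le_antisymm (not_lt.1 hn) (Real.sqrt_nonneg _)
    rw [this] at hqh
    linarith
  have hRh : R ^ 2 = h := Real.sq_sqrt (Nat.cast_nonneg h)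
  have hle : ∀ x : ℝ, x ^ 2 ≤ q ^ 2 * h → x ≤ q * R := fun x hx =>
    le_of_sq_le_sq (by rw [mul_pow, hRh]; exact hx) (by positivity)
  have hge : ∀ x : ℝ, 0 ≤ x → h / 4 ≤ x ^ 2 → R / 2 ≤ x := fun x hx0 hx =>
    le_of_sq_le_sq (by rw [div_pow, hRh]; linarith) hx0
  obtain ⟨p1, p2, r1, r2⟩ := hflow.ratio_le hρ hT0 (a := q * R) (b := R / 2) hqh
    (by nlinarith) (by
      have : 13 * Real.exp (2 * (ρ * T)) * (q * R) / (R / 2) * T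
        = 26 * Real.exp (2 * (ρ * T)) * q * T := by field_simp; ring
      rw [this]
      exact hqT)
    (hle _ hgood.opNorm_Φ) (hle _ hgood.opNorm_W) (hle _ hgood.opNorm_Ψ)
    (hge _ (norm_nonneg _) hgood.norm_Ψ) (hge _ (norm_nonneg _) hgood.norm_Φ)
  have he : 8 * (q * R) / (R / 2) = 16 * q := by field_simp; ring
  rw [he] at r1 r2
  refine (nuclearNorm_featureExpectation_sub_closedForm_le σ (hflow.symm T ⟨hT0, le_rfl⟩)
    p1 p2).trans ?_
  have := closedFormConst_pos
  gcongr
  linarith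

end SimSiam

/-! ### Passage to the limit at a fixed scale `q`. -/

theorem mainTheorem1
    {Ω : Type*} [MeasurableSpace Ω] (μ : Measure Ω) [IsProbabilityMeasure μ]
    (σ ρ α t : ℝ) (hσ : 0 < σ) (hρ : 0 < ρ) (hα : 0 < α) (ht : 0 ≤ t)
    (d h : ℕ → ℕ) (hd : Tendsto d atTop atTop) (hh : Tendsto h atTop atTop)
    (hdh : Tendsto (fun n => (d n : ℝ) / (h n : ℝ)) atTop (𝓝 α))
    (Φ : (n : ℕ) → Ω → ℝ → Matrix (Fin (h n)) (Fin (d n)) ℝ)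
    (W : (n : ℕ) → Ω → ℝ → Matrix (Fin (h n)) (Fin (h n)) ℝ)
    (hinit : ∀ n, SimSiam.IsGaussianInit μ (fun ω => Φ n ω 0) (fun ω => W n ω 0))
    (hflow : Tendsto (fun n => μ {ω | ¬ SimSiam.IsSymmGradientFlow σ ρ t (Φ n ω) (W n ω)})
      atTop (𝓝 0))
    (hΦ : ∀ δ : ENNReal, 0 < δ → ∃ c : ℝ, 0 < c ∧
      ∀ᶠ n in atTop, μ {ω | ‖Φ n ω t‖ < c} ≤ δ)
    (hΨ : ∀ δ : ENNReal, 0 < δ → ∃ c : ℝ, 0 < c ∧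
      ∀ᶠ n in atTop, μ {ω | ‖W n ω t * Φ n ω t‖ < c} ≤ δ)
    (ε : ℝ) (hε : 0 < ε) :
    Tendsto
      (fun n => μ {ω | ε ≤ SimSiam.nuclearNorm
        (SimSiam.featureExpectation σ (Φ n ω t) (W n ω t)
          - SimSiam.closedForm σ (Φ n ω t) (W n ω t))})
      atTop (𝓝 0) := by
  have hC := SimSiam.closedFormConst_pos
  -- `q` depends on `ε` and `t` but not on `n`; every requirement on it holds near `0`.
  obtain ⟨q, hq0, hq1, hqT, hqε⟩ : ∃ q : ℝ, 0 < q ∧ 22 * q ≤ 1 ∧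
      26 * Real.exp (2 * (ρ * t)) * q * t ≤ 1 ∧ SimSiam.closedFormConst * (32 * q) < ε := by
    have hlim : ∀ f : ℝ → ℝ, Continuous f → f 0 = 0 → ∀ y : ℝ, 0 < y →
        ∀ᶠ q in 𝓝[>] (0 : ℝ), f q < y := fun f hf hf0 y hy =>
      nhdsWithin_le_nhds (hf.continuousAt.eventually_lt_const (by rw [hf0]; exact hy))
    have e1 := hlim (fun q => 22 * q) (by fun_prop) (by simp) 1 one_pos
    have e2 := hlim (fun q => 26 * Real.exp (2 * (ρ * t)) * q * t) (by fun_prop) (by simp) 1 one_pos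
    have e3 := hlim (fun q => SimSiam.closedFormConst * (32 * q)) (by fun_prop) (by simp) ε hε
    obtain ⟨q, h1, h2, h3, h4⟩ :=
      (e1.and (e2.and (e3.and (eventually_mem_nhdsWithin (a := (0 : ℝ)))))).exists
    exact ⟨q, h4, h1.le, h2.le, h3⟩
  have hh' : Tendsto (fun n => √(h n : ℝ)) atTop atTop :=
    Real.tendsto_sqrt_atTop.comp (tendsto_natCast_atTop_atTop.comp hh)
  -- The aspect ratio bound is `c = 2 / α`, valid once `d / h > α / 2`, and `θ = q ^ 2`.
  set K : ℝ := 16 * SimSiam.gaussianSqVariance + 1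
    + (SimSiam.gaussianSqVariance + 2 / α) / (q ^ 2) ^ 2
  have hbad : Tendsto (fun n => μ {ω | ¬ SimSiam.IsWellScaled (q ^ 2) (Φ n ω 0) (W n ω 0)})
      atTop (𝓝 0) := by
    have hlim : Tendsto (fun n => 6 * ENNReal.ofReal (K / √(h n : ℝ))) atTop (𝓝 0) := by
      have h1 := ENNReal.tendsto_ofReal (hh'.const_div_atTop K)
      have h2 := ENNReal.Tendsto.const_mul h1 (Or.inr (by simp : (6 : ENNReal) ≠ ⊤))
      simpa using h2
    refine tendsto_of_tendsto_of_tendsto_of_le_of_le' tendsto_const_nhds hlim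
      (Eventually.of_forall fun _ => zero_le) ?_
    filter_upwards [hd.eventually_ge_atTop 1, hh.eventually_ge_atTop 1,
      hdh.eventually_const_lt (half_lt_self hα),
      hh'.eventually_ge_atTop (1 / (q ^ 2) ^ 2)] with n hd1 hh1 hlt hqh
    have hh0 : (0 : ℝ) < h n := by exact_mod_cast hh1
    refine (hinit n).measure_not_isWellScaled_le hh1 hd1 ?_ (by positivity) (by positivity) ?_
    · rw [lt_div_iff₀ hh0] at hlt
      rw [div_mul_eq_mul_div, le_div_iff₀ hα]
      linarith
    · rwa [div_le_iff₀' (by positivity)] at hqh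
  have hsum := hflow.add hbad
  rw [add_zero] at hsum
  refine tendsto_of_tendsto_of_tendsto_of_le_of_le' tendsto_const_nhds hsum
    (Eventually.of_forall fun _ => zero_le) ?_
  filter_upwards [hh'.eventually_ge_atTop (1 / q)] with n hn
  -- A large error forces either failure of the gradient flow or a badly scaled initialization;
  -- outside both events the error is below `ε`.
  refine (measure_mono fun ω hω => ?_).trans (measure_union_le _ _)
  by_contra hgood
  rw [Set.mem_union, not_or] at hgood
  refine (lt_irrefl ε) (lt_of_le_of_lt ?_ hqε)
  exact le_trans hω ((not_not.1 hgood.1).nuclearNorm_sub_le hρ.le ht hq0 hq1 hqT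
    (by rwa [div_le_iff₀' hq0] at hn) (not_not.1 hgood.2))
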